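/- **Model.** Fix $\sigma>0$. For $m\in\mathbb N$, $n>0$ and $\theta\in\ell^2$, let $P_\theta$ (expectation $E_\theta$) be the law of the data $\mathbf Y=(Y^j_i:\ 1\le j\le m,\ i\ge 1)$, where $$Y^j_i=\theta_i+\sqrt{\sigma^2m/n}\;Z^j_i,\qquad Z^j_i \text{ i.i.d. } N(0,1),$$ and let $p(\mathbf Y^j\,|\,\theta)\propto\prod_i e^{-n(Y^j_i-\theta_i)^2/(2\sigma^2m)}$ be the local likelihoods, normalized by their value at $\theta=0$. Let $\Pi(\cdot\,|\,\alpha)=\bigotimes_{i\ge1}N(0,i^{-1-2\alpha})$; for $\alpha>0$ this is a probability measure on $\ell^2$. **Tuning parameter.** Let $\hat\alpha$ be a measurable function of $\mathbf Y$ that is almost surely a maximizer over $\alpha\in[0,\log n]$ of $$\sum_{j=1}^m\log\int p(\mathbf Y^j\,|\,\theta)\,\Pi(d\theta\,|\,\alpha),$$ where the local log-marginal likelihoods are understood as the limits, as $N\to\infty$, of those based on the first $N$ coordinates (so that they make sense at $\alpha=0$ too). **Global posterior (method VII, WASP).** For $\alpha>0$ let $\tilde\Pi^j(\cdot\,|\,\alpha,\mathbf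 Y^j)$ be the probability measure on $\ell^2$ with $d\tilde\Pi^j(\theta\,|\,\alpha,\mathbf Y^j)\propto p(\mathbf Y^j\,|\,\theta)^m\,d\Pi(\theta\,|\,\alpha)$. Let $\mathbf\Pi_{VII}(\cdot\,|\,\mathbf Y)$ be a random probability measure on $\ell^2$ (a Markov kernel) that almost surely on $\{\hat\alpha>0\}$ is a 2-Wasserstein barycenter of $\tilde\Pi^1(\cdot\,|\,\hat\alpha,\mathbf Y^1),\dots,\tilde\Pi^m(\cdot\,|\,\hat\alpha,\mathbf Y^m)$, i.e. a minimizer of $\mu\mapsto\frac1m\sum_{j=1}^mW_2^2\big(\mu,\tilde\Pi^j(\cdot\,|\,\hat\alpha,\mathbf Y^j)\big)$ over the probability measures $\mu$ on $\ell^2$ with finite second moment, where $W_2^2(\mu,\nu)=\inf_\gamma\iint\|x-y\|_2^2\,\gamma(dx,dy)$ over the couplings $\gamma$ of $\mu$ and $\nu$. On $\{\hat\alpha=0\}$ it may be any probability measure. **Credible balls.** Let $\hat\theta$ be the mean of $\mathbf\Pi_{VII}(\cdot\,|\,\mathbf Y)$. For $\gamma\in(0,1)$ let $r_\gamma=r_\gamma(\mathbf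 Y)$ satisfy, almost surely on $\{\hat\alpha>0\}$, $\mathbf\Pi_{VII}(\theta:\|\theta-\hat\theta\|_2\le r_\gamma\,|\,\mathbf Y)=1-\gamma$, and for $L>0$ put $\hat C(L)=\{\theta:\|\theta-\hat\theta\|_2\le Lr_\gamma\}$. **Theorem.** Let $\beta,M,\sigma>0$, and let $\theta_0=\theta_0^{(n,m)}\in\ell^2$ be any signal with $$\theta_{0,i}^2=\begin{cases}M^2i^{-1-2\beta}&\text{if } i\ge (n/(\sigma^2\sqrt m))^{1/(1+2\beta)},\\ 0&\text{otherwise.}\end{cases}$$ Then there is a constant $c>0$, depending only on $\beta,M,\sigma$, such that $$E_{\theta_0}\mathbf\Pi_{VII}\big(\theta:\ \|\theta-\theta_0\|_2\le c\,(n/\sqrt m)^{-\beta/(1+2\beta)}\,\big|\,\mathbf Y\big)\to0$$ as $m\to\infty$ and $n/m\to\infty$. Furthermore, for all $\gamma\in(0,1)$ and all $L>0$, $$P_{\theta_0}\big(\theta_0\in\hat C(L)\big)\to0$$ as $m\to\infty$ and $n/m\to\infty$. Both limits are uniform over the signs of the coordinates of $\theta_0$ and over the choices of $\hat\alpha$,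 $\mathbf\Pi_{VII}$ and $r_\gamma$. -/

import Mathlib

open MeasureTheory ProbabilityTheory Filter Topology
open scoped ENNReal NNReal

noncomputable section

namespace DistributedWN

/-- The sequence space `ℓ²`. The index `i : ℕ` stands for the `(i + 1)`-st coordinate, so that
the frequency belonging to `i` is `freq i = i + 1`. -/
abbrev Ell2 : Type := lp (fun _ : ℕ => ℝ) 2

instance instMeasurableSpaceEll2 : MeasurableSpace Ell2 := borel Ell2

instance instBorelSpaceEll2 : BorelSpace Ell2 := ⟨rfl⟩

/-- The frequencies `1, 2, 3, …`. -/
def freq (i : ℕ) : ℝ := (i : ℝ) + 1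

/-- The sequence of coordinates of an element of `ℓ²`. -/
def coords (θ : Ell2) : ℕ → ℝ := fun i => θ i

/-! ### The model -/

/-- All the data: `Y j i` is the `i`-th observation of the `j`-th observer. -/
abbrev Data (m : ℕ) : Type := Fin m → ℕ → ℝ

/-- The law of the local data: independent coordinates, the `i`-th one being
`N(θ i, σ² m / n)`. -/
def localLaw (σ n : ℝ) (m : ℕ) (θ : Ell2) : Measure (ℕ → ℝ) :=
  Measure.infinitePi (fun i => gaussianReal (coords θ i) (σ ^ 2 * m / n).toNNReal)

/-- The law `P_θ` of all the data: the `m` observers are independent. -/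
def dataLaw (σ n : ℝ) (m : ℕ) (θ : Ell2) : Measure (Data m) :=
  Measure.pi (fun _ => localLaw σ n m θ)

/-- The prior `Π(· | α) = ⨂ N(0, i ^ (-1 - 2α))`, as a measure on sequences. -/
def priorSeq (α : ℝ) : Measure (ℕ → ℝ) :=
  Measure.infinitePi (fun i => gaussianReal 0 (freq i ^ (-1 - 2 * α)).toNNReal)

/-- The prior `Π(· | α)` as a measure on `ℓ²` (a probability measure for `α > 0`). -/
def prior (α : ℝ) : Measure Ell2 := (priorSeq α).comap coords

/-- The local likelihood based on the first `N` coordinates,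
`∏_{i < N} exp (- n (y i - θ i)² / (2 σ² m))`, divided by its value at `θ = 0`, which does not
depend on `θ`. The normalization makes the infinite product meaningful. -/
def likTrunc (σ n : ℝ) (m N : ℕ) (y θ : ℕ → ℝ) : ℝ :=
  ∏ i ∈ Finset.range N,
    Real.exp (-(n * (y i - θ i) ^ 2) / (2 * σ ^ 2 * m)) /
      Real.exp (-(n * (y i) ^ 2) / (2 * σ ^ 2 * m))

/-- The local likelihood `p(y | θ)`, the limit of the likelihoods of the first `N` coordinates
(written as a limsup; for almost all data `y` and all `α > 0` the limit exists for
`Π(· | α)`-almost all `θ`). -/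
def lik (σ n : ℝ) (m : ℕ) (y : ℕ → ℝ) (θ : Ell2) : ℝ≥0∞ :=
  limsup (fun N : ℕ => ENNReal.ofReal (likTrunc σ n m N y (coords θ))) atTop

/-! ### The distributed maximum marginal likelihood estimator -/

/-- The local log-marginal likelihood `log ∫ p(y | θ) Π(dθ | α)`, as the limit of the log-marginal
likelihoods of the first `N` coordinates. In this form it makes sense for `α = 0` as well, where
the prior does not live on `ℓ²`. -/
def logMarginal (σ n : ℝ) (m : ℕ) (y : ℕ → ℝ) (α : ℝ) : ℝ :=
  limUnder atTop (fun N : ℕ => Real.log (∫ θ, likTrunc σ n m N y θ ∂(priorSeq α)))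

/-- The map `α ↦ ∑ j, log ∫ p(Y^j | θ) Π(dθ | α)`. -/
def distLogMarginal (σ n : ℝ) (m : ℕ) (Y : Data m) (α : ℝ) : ℝ :=
  ∑ j, logMarginal σ n m (Y j) α

/-- `αhat` is (a measurable version of) the maximizer of `distLogMarginal` over `[0, log n]`. -/
def IsDistMMLE (σ n : ℝ) (m : ℕ) (θ₀ : Ell2) (αhat : Data m → ℝ) : Prop :=
  Measurable αhat ∧
    ∀ᵐ Y ∂(dataLaw σ n m θ₀), αhat Y ∈ Set.Icc 0 (Real.log n) ∧
      IsMaxOn (distLogMarginal σ n m Y) (Set.Icc 0 (Real.log n)) (αhat Y)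

/-! ### Generalized local posteriors and Wasserstein barycenters -/

/-- The generalized local posterior, `∝ p(y | θ) ^ m Π(dθ | α)`. -/
def genPosterior (σ n : ℝ) (m : ℕ) (α : ℝ) (y : ℕ → ℝ) : Measure Ell2 :=
  (∫⁻ θ, lik σ n m y θ ^ m ∂(prior α))⁻¹ •
    (prior α).withDensity (fun θ => lik σ n m y θ ^ m)

/-- The squared `2`-Wasserstein distance between measures on `ℓ²`. -/
def W2sq (μ ν : Measure Ell2) : ℝ≥0∞ :=
  ⨅ (γ : Measure (Ell2 × Ell2)) (_ : γ.map Prod.fst = μ ∧ γ.map Prod.snd = ν),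
    ∫⁻ p, ‖p.1 - p.2‖ₑ ^ 2 ∂γ

/-- Probability measures on `ℓ²` with finite second moment. -/
def IsP2 (μ : Measure Ell2) : Prop :=
  IsProbabilityMeasure μ ∧ ∫⁻ θ, ‖θ‖ₑ ^ 2 ∂μ < ∞

/-- `μ` is a `2`-Wasserstein barycenter of `ν 1, …, ν m`. -/
def IsBarycenter {m : ℕ} (ν : Fin m → Measure Ell2) (μ : Measure Ell2) : Prop :=
  IsP2 μ ∧ ∀ μ' : Measure Ell2, IsP2 μ' →
    (m : ℝ≥0∞)⁻¹ * ∑ j, W2sq μ (ν j) ≤ (m : ℝ≥0∞)⁻¹ * ∑ j, W2sq μ' (ν j)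

/-- The random measure `post` is the global posterior obtained by plugging `αhat` into the
generalized local posteriors and taking their barycenter. The local posteriors are defined for
positive `α` only, so nothing is required on the event `αhat = 0`. -/
def IsGlobalPosterior (σ n : ℝ) (m : ℕ) (θ₀ : Ell2) (αhat : Data m → ℝ)
    (post : Kernel (Data m) Ell2) : Prop :=
  IsMarkovKernel post ∧
    ∀ᵐ Y ∂(dataLaw σ n m θ₀), 0 < αhat Y →
      IsBarycenter (fun j => genPosterior σ n m (αhat Y) (Y j)) (post Y)

/-! ### Credible balls -/

/-- The mean of a measure on `ℓ²`. -/
def postMean (μ : Measure Ell2) : Ell2 := ∫ θ, θ ∂μ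

/-- `r` is a radius for which the ball around the mean of `μ` has mass `1 - γ`. -/
def IsCredibleRadius (μ : Measure Ell2) (γ r : ℝ) : Prop :=
  μ {θ | ‖θ - postMean μ‖ ≤ r} = ENNReal.ofReal (1 - γ)

/-- The credible ball, blown up by the factor `L`. -/
def credibleBall (μ : Measure Ell2) (L r : ℝ) : Set Ell2 :=
  {θ | ‖θ - postMean μ‖ ≤ L * r}

/-! ### The difficult signals -/

/-- `θ₀ i ² = M² i ^ (-1 - 2β)` for frequencies `i ≥ (n / (σ² √m)) ^ (1 / (1 + 2β))`, and
`θ₀ i = 0` for the other ones; the signs are arbitrary. -/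
def IsDifficult (β M σ n : ℝ) (m : ℕ) (θ₀ : Ell2) : Prop :=
  ∀ i : ℕ, (coords θ₀ i) ^ 2 =
    if (n / (σ ^ 2 * √(m : ℝ))) ^ (1 / (1 + 2 * β)) ≤ freq i
    then M ^ 2 * freq i ^ (-1 - 2 * β) else 0

end DistributedWN

end

open DistributedWN

/-! Write `t = n/(σ²m)` for the precision of one observer, `a = m t = n/σ²` for the pooled precision
and `K` for the cut-off of the signal, so that `K^(1+2β) = t√m`. The signal sits where no single
observer can see it: `t θ₀,ᵢ² ≤ M²/√m` for every `i`, and it shifts the mean of the pooled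
statistics `∑_j ∑_{i≤k} (t (Y^j_i)² - 1)` by at most a multiple of `√m K`, and not at all for `k <
K`.

Tuning. Up to a factor 1/2 the distributed log-marginal likelihood is `-m H(α)` plus a fluctuation,
where `H(α) = entropySum t α` is at least `t^(1/(1+2α))/16`. Summation by parts against the monotone
shrinkage weights bounds the fluctuation by `2^(1+2α) t^(1/(1+2α)) R` with one random `R` that does
not depend on `α` (`SlowSums.exists_tendsto`); no chaining over `α` is needed. If `1 + 2α̂ ≤ P`,
comparison with a much larger `α` forces `R` to be of order `m`
(`le_sumSize_of_le_distLogMarginal`), whereas `R` has mean `O(√m)`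
(`exists_lintegral_totalSize_le`). Hence, outside an event of probability `O(m^(-1/2))`, the
estimator oversmooths: `a ≤ K^(1+2α̂)`.

Aggregation. The power `m` of the likelihood turns every local posterior into a Gaussian product
measure of noise precision `a`; all of them are translates of one centred law
(`genPosterior_eq_map`, resting on the martingale argument in `exists_density_infinitePi`). A
Wasserstein barycenter of translates has the average mean (`postMean_barycenter`) and no more spread
than the common law (`lintegral_barycenter_le`).

Conclusion. Under oversmoothing the posterior mean shrinks all frequencies above `K` by at least one
half. The block of about `K` frequencies after `K` then carries a squared bias of order `K^(-2β)`,
the square of the rate (`block_bias`). The total posterior variance (`tsum_postVar_le`) and the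
variance of the averaged data on the block are `O(K/a) = O(K^(-2β)/√m)`. Markov's inequality gives
both claims (`exists_atypical_event`). -/

namespace DistributedWN

/-! ### The sequence space -/

lemma coords_injective : Function.Injective coords := fun _ _ h => lp.ext h

lemma continuous_coords : Continuous coords :=
  continuous_pi fun i => (lp.evalCLM ℝ (fun _ : ℕ => ℝ) (p := 2) i).continuous

/-- Needed for `Ell2` to be Polish, which makes the continuous injection `coords` a measurable
embedding; measures on `ℓ²` can then be handled through their coordinates. -/
instance : TopologicalSpace.SeparableSpace Ell2 := by
  have h1 : (Set.range fun i : ℕ => (lp.single 2 i (1 : ℝ) : Ell2)).Countable :=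
    Set.countable_range _
  have h2 := (h1.isSeparable.span (R := ℝ)).closure
  refine TopologicalSpace.isSeparable_univ_iff.1 (h2.mono fun f _ => ?_)
  have h3 := lp.hasSum_single (E := fun _ : ℕ => ℝ) (p := 2) (by simp) f
  refine mem_closure_of_tendsto h3 (Eventually.of_forall fun s => ?_)
  refine Submodule.sum_mem _ fun i _ => ?_
  have : (lp.single 2 i (f i) : Ell2) = f i • (lp.single 2 i (1 : ℝ) : Ell2) := by
    rw [← lp.single_smul]; simp
  rw [this]
  exact Submodule.smul_mem _ _ (Submodule.subset_span ⟨i, rfl⟩)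

instance : PolishSpace Ell2 where

lemma measurableEmbedding_coords : MeasurableEmbedding coords :=
  continuous_coords.measurableEmbedding coords_injective

lemma range_coords : Set.range coords = {x | Summable fun i => x i ^ 2} := by
  ext x
  constructor
  · rintro ⟨θ, rfl⟩
    simpa [coords] using (lp.memℓp θ).summable (by simp)
  · intro hx
    refine ⟨⟨x, (memℓp_gen_iff (by simp)).2 (by simpa using hx)⟩, rfl⟩

lemma summable_coords_sq (θ : Ell2) : Summable fun i => coords θ i ^ 2 := by
  have : coords θ ∈ Set.range coords := ⟨θ, rfl⟩
  rwa [range_coords] at this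

lemma norm_sq_eq_tsum (θ : Ell2) : ‖θ‖ ^ 2 = ∑' i, coords θ i ^ 2 := by
  have := lp.norm_rpow_eq_tsum (E := fun _ : ℕ => ℝ) (p := 2) (by simp) θ
  simpa [coords] using this

lemma enorm_sq_eq_tsum (θ : Ell2) : ‖θ‖ₑ ^ 2 = ∑' i, ENNReal.ofReal (coords θ i ^ 2) := by
  rw [← ENNReal.ofReal_tsum_of_nonneg (fun i => sq_nonneg _) (summable_coords_sq θ),
    ← norm_sq_eq_tsum, ENNReal.ofReal_pow (norm_nonneg _), ofReal_norm]

lemma sum_sq_le_norm_sq (θ : Ell2) (s : Finset ℕ) : ∑ i ∈ s, coords θ i ^ 2 ≤ ‖θ‖ ^ 2 := by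
  rw [norm_sq_eq_tsum]
  exact (summable_coords_sq θ).sum_le_tsum _ (fun _ _ => sq_nonneg _)

/-- The measure on `ℓ²` with a given law of the coordinates. -/
lemma map_coords_comap {P : Measure (ℕ → ℝ)} (hP : ∀ᵐ x ∂P, Summable fun i => x i ^ 2) :
    (P.comap coords).map coords = P := by
  rw [measurableEmbedding_coords.map_comap, Measure.restrict_eq_self_of_ae_mem]
  simpa [range_coords] using hP

lemma eq_of_map_coords_eq {μ ν : Measure Ell2} (h : μ.map coords = ν.map coords) : μ = ν := by
  have := congrArg (Measure.comap coords) h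
  rwa [measurableEmbedding_coords.comap_map, measurableEmbedding_coords.comap_map] at this

/-! ### Densities of infinite product measures -/

/-- Where `|f| ≥ C/ε` one has `|f| ≤ (ε/C) |f|²`, so the tail integral is at most `ε`. The case `C =
0` is separate because of the division by `C`. -/
lemma uniformIntegrable_of_lintegral_sq_le {Ω : Type*} {mΩ : MeasurableSpace Ω} {μ : Measure Ω}
    [IsFiniteMeasure μ] {f : ℕ → Ω → ℝ} (hf : ∀ n, Measurable (f n)) {C : ℝ≥0}
    (hC : ∀ n, ∫⁻ x, ‖f n x‖ₑ ^ 2 ∂μ ≤ C) : UniformIntegrable f 1 μ := by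
  refine uniformIntegrable_of le_rfl (by simp) (fun n => (hf n).aestronglyMeasurable) fun ε hε => ?_
  refine ⟨C / ε.toNNReal, fun n => ?_⟩
  rw [eLpNorm_one_eq_lintegral_enorm]
  have hε' : (ENNReal.ofReal ε) ≠ 0 := by simpa using hε
  by_cases hC0 : C = 0
  · have h0 : ∫⁻ x, ‖f n x‖ₑ ^ 2 ∂μ = 0 := by simpa [hC0] using hC n
    rw [lintegral_eq_zero_iff (by fun_prop)] at h0
    have : ∫⁻ x, ‖Set.indicator {x | C / ε.toNNReal ≤ ‖f n x‖₊} (f n) x‖ₑ ∂μ = 0 := by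
      rw [lintegral_eq_zero_iff']
      · filter_upwards [h0] with x hx
        have : f n x = 0 := by simpa using hx
        simp [Set.indicator, this]
      · exact ((hf n).indicator (measurableSet_le measurable_const
          (hf n).nnnorm)).enorm.aemeasurable
    rw [this]; exact zero_le
  have hC1 : (C : ℝ≥0∞) ≠ 0 := by simpa using hC0
  calc ∫⁻ x, ‖Set.indicator {x | C / ε.toNNReal ≤ ‖f n x‖₊} (f n) x‖ₑ ∂μ
      ≤ ∫⁻ x, (ENNReal.ofReal ε / C) * ‖f n x‖ₑ ^ 2 ∂μ := by
        refine lintegral_mono fun x => ?_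
        by_cases hx : C / ε.toNNReal ≤ ‖f n x‖₊
        · rw [Set.indicator_of_mem (by exact hx)]
          have h1 : (1 : ℝ≥0∞) ≤ ENNReal.ofReal ε / C * ‖f n x‖ₑ := by
            have h2 : (C : ℝ≥0∞) / ENNReal.ofReal ε ≤ ‖f n x‖ₑ := by
              have h3 := ENNReal.coe_le_coe.2 hx
              rwa [ENNReal.coe_div (by simpa using hε)] at h3
            calc (1 : ℝ≥0∞) = ENNReal.ofReal ε / C * (C / ENNReal.ofReal ε) := by
                  rw [← mul_div_assoc, ENNReal.div_mul_cancel hC1 ENNReal.coe_ne_top,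
                    ENNReal.div_self hε' ENNReal.ofReal_ne_top]
              _ ≤ _ := by gcongr
          calc ‖f n x‖ₑ = 1 * ‖f n x‖ₑ := (one_mul _).symm
            _ ≤ ENNReal.ofReal ε / C * ‖f n x‖ₑ * ‖f n x‖ₑ := by gcongr
            _ = _ := by ring
        · rw [Set.indicator_of_notMem (by exact hx)]; simp
    _ = (ENNReal.ofReal ε / C) * ∫⁻ x, ‖f n x‖ₑ ^ 2 ∂μ := lintegral_const_mul _ (by fun_prop)
    _ ≤ (ENNReal.ofReal ε / C) * C := by gcongr; exact hC n
    _ = _ := ENNReal.div_mul_cancel hC1 ENNReal.coe_ne_top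

lemma lintegral_infinitePi_prod (P : ℕ → Measure ℝ) [∀ i, IsProbabilityMeasure (P i)]
    (s : Finset ℕ) {g : ℕ → ℝ → ℝ≥0∞} (hg : ∀ i, Measurable (g i)) :
    ∫⁻ x, ∏ i ∈ s, g i (x i) ∂(Measure.infinitePi P) = ∏ i ∈ s, ∫⁻ x, g i x ∂(P i) := by
  rw [lintegral_prod_eq_prod_lintegral_of_indepFun s (fun i (x : ℕ → ℝ) => g i (x i))
    (iIndepFun_infinitePi hg) (fun i => (hg i).comp (measurable_pi_apply i))]
  refine Finset.prod_congr rfl fun i _ => ?_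
  exact (measurePreserving_eval_infinitePi P i).lintegral_comp (hg i)

lemma ofReal_prod_eq {f : ℕ → ℝ → ℝ} (h0 : ∀ i x, 0 ≤ f i x) (s : Finset ℕ) (x : ℕ → ℝ) :
    ENNReal.ofReal (∏ i ∈ s, f i (x i)) = ∏ i ∈ s, ENNReal.ofReal (f i (x i)) :=
  ENNReal.ofReal_prod_of_nonneg fun _ _ => h0 _ _

section
variable {P : ℕ → Measure ℝ} [∀ i, IsProbabilityMeasure (P i)] {f : ℕ → ℝ → ℝ}

/-- The factors are independent with mean one. Time `N` carries `N + 1` factors because the natural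
filtration at `N` already contains coordinate `N`. -/
lemma martingale_prod_density (hf : ∀ i, Measurable (f i)) (h0 : ∀ i x, 0 ≤ f i x)
    (h1 : ∀ i, ∫⁻ x, ENNReal.ofReal (f i x) ∂(P i) = 1) :
    Martingale (fun N (x : ℕ → ℝ) => ∏ i ∈ Finset.range (N + 1), f i (x i))
      (Filtration.natural (fun i (x : ℕ → ℝ) => x i)
        (fun i => (measurable_pi_apply i).stronglyMeasurable)) (Measure.infinitePi P) := by
  have hm : ∀ i, Measurable fun x : ℕ → ℝ => f i (x i) := fun i =>
    (hf i).comp (measurable_pi_apply i)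
  have hadp : StronglyAdapted (Filtration.natural (fun i (x : ℕ → ℝ) => x i)
        (fun i => (measurable_pi_apply i).stronglyMeasurable))
      (fun N (x : ℕ → ℝ) => ∏ i ∈ Finset.range (N + 1), f i (x i)) := by
    intro N
    refine Measurable.stronglyMeasurable ?_
    refine Finset.measurable_fun_prod _ fun i hi => (hf i).comp ?_
    have : MeasurableSpace.comap (fun x : ℕ → ℝ => x i) inferInstance ≤
      Filtration.natural (fun i (x : ℕ → ℝ) => x i)
        (fun i => (measurable_pi_apply i).stronglyMeasurable) N :=
      le_iSup₂_of_le i (Nat.lt_succ_iff.1 (Finset.mem_range.1 hi)) le_rfl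
    exact (comap_measurable _).mono this le_rfl
  have hint : ∀ N, Integrable (fun x : ℕ → ℝ => ∏ i ∈ Finset.range N, f i (x i))
      (Measure.infinitePi P) := by
    intro N
    refine ⟨(Finset.measurable_fun_prod _ fun i _ => hm i).aestronglyMeasurable, ?_⟩
    rw [hasFiniteIntegral_iff_ofReal (Eventually.of_forall fun x =>
      Finset.prod_nonneg fun i _ => h0 _ _)]
    simp_rw [ofReal_prod_eq h0]
    rw [lintegral_infinitePi_prod P _ (g := fun i x => ENNReal.ofReal (f i x))
      (fun i => (hf i).ennreal_ofReal)]
    simp [h1]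
  have hint1 : ∀ i, Integrable (fun x : ℕ → ℝ => f i (x i)) (Measure.infinitePi P) ∧
      ∫ x, f i (x i) ∂(Measure.infinitePi P) = 1 := by
    intro i
    have := (measurePreserving_eval_infinitePi P i).lintegral_comp (hf i).ennreal_ofReal
    simp only [Function.eval, h1] at this
    refine ⟨⟨(hm i).aestronglyMeasurable, ?_⟩, ?_⟩
    · rw [hasFiniteIntegral_iff_ofReal (Eventually.of_forall fun x => h0 _ _), this]; simp
    · rw [integral_eq_lintegral_of_nonneg_ae (Eventually.of_forall fun x => h0 _ _)
        (hm i).aestronglyMeasurable, this]; simp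
  refine martingale_nat hadp (fun N => hint (N + 1)) fun N => ?_
  have hprod : (fun x : ℕ → ℝ => ∏ i ∈ Finset.range (N + 1 + 1), f i (x i)) =
      (fun x : ℕ → ℝ => ∏ i ∈ Finset.range (N + 1), f i (x i)) *
        (fun x : ℕ → ℝ => f (N + 1) (x (N + 1))) := by
    ext x; simp [Finset.prod_range_succ]
  have hI : iIndepFun (fun i (x : ℕ → ℝ) => x i) (Measure.infinitePi P) :=
    iIndepFun_infinitePi (X := fun _ x => x) fun _ => measurable_id
  have hcond : (Measure.infinitePi P)[fun x : ℕ → ℝ => f (N + 1) (x (N + 1)) |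
      Filtration.natural (fun i (x : ℕ → ℝ) => x i)
        (fun i => (measurable_pi_apply i).stronglyMeasurable) N] =ᵐ[Measure.infinitePi P]
      fun _ => 1 := by
    have := condExp_indep_eq (μ := Measure.infinitePi P)
      (m₁ := MeasurableSpace.comap (fun x : ℕ → ℝ => x (N + 1)) inferInstance)
      (measurable_pi_apply (N + 1)).comap_le (Filtration.le _ N)
      (f := fun x : ℕ → ℝ => f (N + 1) (x (N + 1)))
      ((hf (N + 1)).comp (comap_measurable _)).stronglyMeasurable
      (hI.indep_comap_natural_of_lt (fun i => (measurable_pi_apply i).stronglyMeasurable)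
        (Nat.lt_succ_self N))
    rwa [(hint1 (N + 1)).2] at this
  rw [hprod]
  have hpull := condExp_mul_of_stronglyMeasurable_left (μ := Measure.infinitePi P) (hadp N)
    (by rw [← hprod]; exact hint _) (hint1 (N + 1)).1
  filter_upwards [hpull, hcond] with x hx1 hx2
  rw [hx1, Pi.mul_apply, hx2, mul_one]

/-- If the products of the square norms of the densities are bounded, then the product of the
measures `P i` with these densities is absolutely continuous, with the product density. -/
lemma exists_density_infinitePi {Q : ℕ → Measure ℝ} [∀ i, IsProbabilityMeasure (Q i)]
    (hf : ∀ i, Measurable (f i)) (h0 : ∀ i x, 0 ≤ f i x)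
    (hQ : ∀ i, Q i = (P i).withDensity fun x => ENNReal.ofReal (f i x)) {C : ℝ≥0}
    (hC : ∀ N, ∏ i ∈ Finset.range N, ∫⁻ x, ENNReal.ofReal (f i x) ^ 2 ∂(P i) ≤ C) :
    ∃ F : (ℕ → ℝ) → ℝ≥0∞,
      (∀ᵐ x ∂(Measure.infinitePi P), Tendsto
        (fun N => ENNReal.ofReal (∏ i ∈ Finset.range N, f i (x i))) atTop (𝓝 (F x))) ∧
      (Measure.infinitePi P).withDensity F = Measure.infinitePi Q := by
  have h1 : ∀ i, ∫⁻ x, ENNReal.ofReal (f i x) ∂(P i) = 1 := by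
    intro i
    have : Q i Set.univ = 1 := measure_univ
    rwa [hQ, withDensity_apply _ MeasurableSet.univ, Measure.restrict_univ] at this
  have hmart := martingale_prod_density hf h0 h1
  set ℱ := Filtration.natural (fun i (x : ℕ → ℝ) => x i)
        (fun i => (measurable_pi_apply i).stronglyMeasurable) with hℱ
  -- Second moments of products of independent factors multiply, so `hC` is boundedness in L²; the
  -- martingale is therefore closed by its limit.
  have hui : UniformIntegrable (fun N (x : ℕ → ℝ) => ∏ i ∈ Finset.range (N + 1), f i (x i)) 1
      (Measure.infinitePi P) := by
    refine uniformIntegrable_of_lintegral_sq_le (C := C) (fun N =>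
      Finset.measurable_fun_prod _ fun i _ => (hf i).comp (measurable_pi_apply i)) fun N => ?_
    refine le_trans (le_of_eq ?_) (hC (N + 1))
    rw [← lintegral_infinitePi_prod P _ (fun i => (hf i).ennreal_ofReal.pow_const 2)]
    refine lintegral_congr fun x => ?_
    rw [Real.enorm_of_nonneg (Finset.prod_nonneg fun i _ => h0 _ _), ofReal_prod_eq h0,
      Finset.prod_pow]
  have hlim := hmart.submartingale.ae_tendsto_limitProcess_of_uniformIntegrable hui
  have hcond := fun N => hmart.ae_eq_condExp_limitProcess hui N
  set F := Filtration.limitProcess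
    (fun N (x : ℕ → ℝ) => ∏ i ∈ Finset.range (N + 1), f i (x i)) ℱ (Measure.infinitePi P) with hF
  have hFint : Integrable F (Measure.infinitePi P) :=
    (Filtration.memLp_limitProcess_of_eLpNorm_bdd hui.1 hui.2.2.choose_spec).integrable le_rfl
  have hF0 : 0 ≤ᵐ[Measure.infinitePi P] F := by
    filter_upwards [hlim] with x hx
    exact ge_of_tendsto' hx fun N => Finset.prod_nonneg fun i _ => h0 _ _
  refine ⟨fun x => ENNReal.ofReal (F x), ?_, ?_⟩
  · filter_upwards [hlim] with x hx
    rw [← tendsto_add_atTop_iff_nat 1]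
    exact (ENNReal.continuous_ofReal.tendsto _).comp hx
  · refine Measure.eq_infinitePi _ fun s t ht => ?_
    obtain ⟨N, hN⟩ : ∃ N, s ⊆ Finset.range (N + 1) :=
      ⟨s.sup id, fun i hi => Finset.mem_range.2 (Nat.lt_succ_iff.2 (Finset.le_sup (f := id) hi))⟩
    classical
    -- Filling up with whole lines turns the box into an event of `ℱ N`, on which the limit and the
    -- `N`-th product have the same integral.
    set t' : ℕ → Set ℝ := fun i => if i ∈ s then t i else Set.univ with ht'
    have ht'm : ∀ i, MeasurableSet (t' i) := fun i => by
      simp only [ht']; split_ifs; exacts [ht i, MeasurableSet.univ]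
    have hset : Set.pi (s : Set ℕ) t = Set.pi (Finset.range (N + 1) : Set ℕ) t' := by
      ext x
      simp only [Set.mem_pi, Finset.mem_coe, ht']
      constructor
      · intro h i _
        split_ifs with hi
        exacts [h i hi, Set.mem_univ _]
      · intro h i hi
        have := h i (hN hi)
        rwa [if_pos hi] at this
    have hprod : ∏ i ∈ s, Q i (t i) = ∏ i ∈ Finset.range (N + 1), Q i (t' i) := by
      rw [← Finset.prod_subset hN (f := fun i => Q i (t' i))]
      · exact Finset.prod_congr rfl fun i hi => by simp [ht', hi]
      · intro i _ hi; simp [ht', hi]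
    have hmeasF : MeasurableSet[ℱ N] (Set.pi (Finset.range (N + 1) : Set ℕ) t') := by
      have : Set.pi (Finset.range (N + 1) : Set ℕ) t' =
          ⋂ i ∈ Finset.range (N + 1), (fun x : ℕ → ℝ => x i) ⁻¹' t' i := by
        ext x; simp [Set.mem_pi]
      rw [this]
      refine Finset.measurableSet_biInter _ fun i hi => ?_
      have h3 : MeasurableSpace.comap (fun x : ℕ → ℝ => x i) inferInstance ≤ ℱ N :=
        le_iSup₂_of_le i (Nat.lt_succ_iff.1 (Finset.mem_range.1 hi)) le_rfl
      exact h3 _ ⟨t' i, ht'm i, rfl⟩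
    have hmeas := ℱ.le N _ hmeasF
    rw [hset, hprod, withDensity_apply _ hmeas]
    rw [← ofReal_integral_eq_lintegral_ofReal hFint.integrableOn (ae_restrict_of_ae hF0),
      ← setIntegral_condExp (ℱ.le N) hFint hmeasF,
      ← setIntegral_congr_ae hmeas ((hcond N).mono fun x hx _ => hx),
      ofReal_integral_eq_lintegral_ofReal (hmart.integrable N).integrableOn
        (Eventually.of_forall fun x => Finset.prod_nonneg fun i _ => h0 _ _),
      ← lintegral_indicator hmeas]
    have : ∀ x : ℕ → ℝ, (Set.pi (Finset.range (N + 1) : Set ℕ) t').indicator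
        (fun x => ENNReal.ofReal (∏ i ∈ Finset.range (N + 1), f i (x i))) x =
        ∏ i ∈ Finset.range (N + 1), (t' i).indicator (fun z => ENNReal.ofReal (f i z)) (x i) := by
      intro x
      by_cases hx : x ∈ Set.pi (Finset.range (N + 1) : Set ℕ) t'
      · rw [Set.indicator_of_mem hx, ofReal_prod_eq h0]
        exact Finset.prod_congr rfl fun i hi => by rw [Set.indicator_of_mem (hx i hi)]
      · rw [Set.indicator_of_notMem hx]
        simp only [Set.mem_pi, not_forall] at hx
        obtain ⟨i, hi, hxi⟩ := hx
        exact (Finset.prod_eq_zero hi (Set.indicator_of_notMem hxi _)).symm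
    rw [lintegral_congr this, lintegral_infinitePi_prod P _
      (fun i => (hf i).ennreal_ofReal.indicator (ht'm i))]
    refine Finset.prod_congr rfl fun i _ => ?_
    rw [lintegral_indicator (ht'm i), hQ, withDensity_apply _ (ht'm i)]

end

/-! ### Gaussian measures with an exponential-quadratic density -/

/-- The integral of `exp (b x - a x² / 2)` with respect to `N(0, l)`. -/
noncomputable def tiltMass (a b l : ℝ) : ℝ :=
  (√(1 + a * l))⁻¹ * Real.exp (b ^ 2 * l / (2 * (1 + a * l)))

lemma tiltMass_pos {a b l : ℝ} (ha : 0 ≤ a) (hl : 0 < l) : 0 < tiltMass a b l := by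
  unfold tiltMass; positivity

lemma log_tiltMass {a b l : ℝ} (ha : 0 ≤ a) (hl : 0 < l) :
    Real.log (tiltMass a b l) = -(1 / 2) * Real.log (1 + a * l) + b ^ 2 * l / (2 * (1 + a * l)) := by
  have h : 0 < 1 + a * l := by positivity
  rw [tiltMass, Real.log_mul (by positivity) (Real.exp_ne_zero _), Real.log_exp, Real.log_inv,
    Real.log_sqrt h.le]
  ring

/-- Completing the square. -/
lemma gaussianPDFReal_mul_exp {a b l : ℝ} (ha : 0 ≤ a) (hl : 0 < l) (x : ℝ) :
    gaussianPDFReal 0 l.toNNReal x * Real.exp (b * x - a * x ^ 2 / 2) = tiltMass a b l *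
      gaussianPDFReal (b * (l / (1 + a * l))) (l / (1 + a * l)).toNNReal x := by
  have h : 0 < 1 + a * l := by positivity
  rw [gaussianPDFReal, gaussianPDFReal, tiltMass, Real.coe_toNNReal _ hl.le,
    Real.coe_toNNReal _ (by positivity)]
  have h1 : √(2 * Real.pi * (l / (1 + a * l))) = √(2 * Real.pi * l) / √(1 + a * l) := by
    rw [← Real.sqrt_div (by positivity)]; congr 1; ring
  have h2 : √(1 + a * l) ≠ 0 := by positivity
  have h3 : √(2 * Real.pi * l) ≠ 0 := by positivity
  rw [h1, mul_assoc, ← Real.exp_add]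
  have h4 : -(x - 0) ^ 2 / (2 * l) + (b * x - a * x ^ 2 / 2) =
      b ^ 2 * l / (2 * (1 + a * l)) +
        -(x - b * (l / (1 + a * l))) ^ 2 / (2 * (l / (1 + a * l))) := by
    field_simp; ring
  rw [h4, Real.exp_add]
  field_simp

lemma lintegral_tilt {a b l : ℝ} (ha : 0 ≤ a) (hl : 0 < l) :
    ∫⁻ x, ENNReal.ofReal (Real.exp (b * x - a * x ^ 2 / 2)) ∂(gaussianReal 0 l.toNNReal) =
      ENNReal.ofReal (tiltMass a b l) := by
  have hv : 0 < l / (1 + a * l) := by positivity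
  rw [gaussianReal_of_var_ne_zero _ (by simpa using hl),
    lintegral_withDensity_eq_lintegral_mul _ (measurable_gaussianPDF _ _) (by fun_prop)]
  have : ∀ x, (gaussianPDF 0 l.toNNReal * fun x => ENNReal.ofReal
      (Real.exp (b * x - a * x ^ 2 / 2))) x = ENNReal.ofReal (tiltMass a b l) *
      gaussianPDF (b * (l / (1 + a * l))) (l / (1 + a * l)).toNNReal x := by
    intro x
    rw [Pi.mul_apply, gaussianPDF, gaussianPDF, ← ENNReal.ofReal_mul (gaussianPDFReal_nonneg _ _ _),
      gaussianPDFReal_mul_exp ha hl, ENNReal.ofReal_mul (tiltMass_pos ha hl).le]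
  rw [lintegral_congr this, lintegral_const_mul _ (measurable_gaussianPDF _ _),
    lintegral_gaussianPDF_eq_one _ (by simpa using hv), mul_one]

lemma gaussianReal_eq_withDensity {a b l : ℝ} (ha : 0 ≤ a) (hl : 0 < l) :
    gaussianReal (b * (l / (1 + a * l))) (l / (1 + a * l)).toNNReal =
      (gaussianReal 0 l.toNNReal).withDensity
        fun x => ENNReal.ofReal (Real.exp (b * x - a * x ^ 2 / 2) / tiltMass a b l) := by
  have hv : 0 < l / (1 + a * l) := by positivity
  rw [gaussianReal_of_var_ne_zero 0 (by simpa using hl),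
    gaussianReal_of_var_ne_zero _ (by simpa using hv),
    ← withDensity_mul _ (measurable_gaussianPDF _ _) (by fun_prop)]
  congr 1
  ext x
  rw [Pi.mul_apply, gaussianPDF, gaussianPDF, ← ENNReal.ofReal_mul (gaussianPDFReal_nonneg _ _ _),
    ← mul_div_assoc (gaussianPDFReal 0 _ x), gaussianPDFReal_mul_exp ha hl, mul_div_cancel_left₀ _ (tiltMass_pos ha hl).ne']

/-- Squaring the tilt doubles `a` and `b`, so the second moment is `tiltMass (2a) (2b) l / tiltMass
a b l ^ 2`. The bound is an exponential so that products over coordinates are controlled by a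
convergent series. -/
lemma lintegral_tilt_sq_le {a b l : ℝ} (ha : 0 ≤ a) (hl : 0 < l) :
    ∫⁻ x, ENNReal.ofReal (Real.exp (b * x - a * x ^ 2 / 2) / tiltMass a b l) ^ 2
      ∂(gaussianReal 0 l.toNNReal) ≤ ENNReal.ofReal (Real.exp (a * l + 2 * (b ^ 2 * l))) := by
  have ht := tiltMass_pos (b := b) ha hl
  have h1 : ∀ x, ENNReal.ofReal (Real.exp (b * x - a * x ^ 2 / 2) / tiltMass a b l) ^ 2 =
      ENNReal.ofReal ((tiltMass a b l ^ 2)⁻¹) *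
        ENNReal.ofReal (Real.exp ((2 * b) * x - (2 * a) * x ^ 2 / 2)) := by
    intro x
    rw [← ENNReal.ofReal_pow (by positivity), ← ENNReal.ofReal_mul (by positivity), div_pow,
      ← Real.exp_nat_mul]
    congr 1
    rw [div_eq_inv_mul]; congr 2; push_cast; ring
  rw [lintegral_congr h1, lintegral_const_mul _ (by fun_prop), lintegral_tilt (by positivity) hl,
    ← ENNReal.ofReal_mul (by positivity)]
  refine ENNReal.ofReal_le_ofReal ?_
  have h2 : tiltMass (2 * a) (2 * b) l ≤ Real.exp (2 * (b ^ 2 * l)) := by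
    unfold tiltMass
    have h3 : 1 ≤ √(1 + 2 * a * l) := Real.one_le_sqrt.2 (by nlinarith [mul_nonneg ha hl.le])
    calc (√(1 + 2 * a * l))⁻¹ * Real.exp ((2 * b) ^ 2 * l / (2 * (1 + 2 * a * l)))
        ≤ 1 * Real.exp (2 * (b ^ 2 * l)) := by
          gcongr
          · exact inv_le_one_of_one_le₀ h3
          · rw [div_le_iff₀ (by positivity)]
            nlinarith [mul_nonneg (mul_nonneg ha hl.le) (mul_nonneg (sq_nonneg b) hl.le)]
      _ = _ := one_mul _
  have h3 : (tiltMass a b l ^ 2)⁻¹ ≤ Real.exp (a * l) := by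
    unfold tiltMass
    have h4 : (1 : ℝ) ≤ Real.exp (b ^ 2 * l / (2 * (1 + a * l))) := Real.one_le_exp (by positivity)
    rw [mul_pow, inv_pow, Real.sq_sqrt (by positivity), mul_inv, inv_inv]
    calc (1 + a * l) * (Real.exp (b ^ 2 * l / (2 * (1 + a * l))) ^ 2)⁻¹ ≤ (1 + a * l) * 1 := by
          gcongr
          exact inv_le_one_of_one_le₀ (one_le_pow₀ h4)
      _ ≤ _ := by linarith [Real.add_one_le_exp (a * l)]
  rw [Real.exp_add]
  exact mul_le_mul h3 h2 (tiltMass_pos (by positivity) hl).le (by positivity)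

/-! ### The generalized local posteriors -/

lemma freq_pos (i : ℕ) : 0 < freq i := by unfold freq; positivity

lemma one_le_freq (i : ℕ) : 1 ≤ freq i := by unfold freq; simp

lemma summable_freq_rpow {s : ℝ} (hs : s < -1) : Summable fun i => freq i ^ s := by
  have := (summable_nat_add_iff 1).2 (Real.summable_nat_rpow.2 hs)
  simpa [freq] using this

lemma likTrunc_eq (σ n : ℝ) (m N : ℕ) (y θ : ℕ → ℝ) :
    likTrunc σ n m N y θ = ∏ i ∈ Finset.range N,
      Real.exp (n / (σ ^ 2 * m) * y i * θ i - n / (σ ^ 2 * m) * θ i ^ 2 / 2) := by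
  refine Finset.prod_congr rfl fun i _ => ?_
  rw [← Real.exp_sub]
  congr 1
  ring

lemma likTrunc_nonneg (σ n : ℝ) (m N : ℕ) (y θ : ℕ → ℝ) : 0 ≤ likTrunc σ n m N y θ := by
  rw [likTrunc_eq]; positivity

lemma likTrunc_pow_eq (σ n : ℝ) (m N : ℕ) (y θ : ℕ → ℝ) {a : ℝ} (ha : a = m * (n / (σ ^ 2 * m))) :
    likTrunc σ n m N y θ ^ m = ∏ i ∈ Finset.range N,
      Real.exp (a * y i * θ i - a * θ i ^ 2 / 2) := by
  rw [likTrunc_eq, ← Finset.prod_pow]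
  refine Finset.prod_congr rfl fun i _ => ?_
  rw [← Real.exp_nat_mul, ha]
  congr 1
  ring

lemma tendsto_prod_tiltMass {a : ℝ} (ha : 0 ≤ a) {b l : ℕ → ℝ} (hl : ∀ i, 0 < l i)
    (hsl : Summable l) (hb : Summable fun i => b i ^ 2 * l i) :
    ∃ c : ℝ, 0 < c ∧
      Tendsto (fun N => ∏ i ∈ Finset.range N, tiltMass a (b i) (l i)) atTop (𝓝 c) := by
  have hs : Summable fun i => Real.log (tiltMass a (b i) (l i)) := by
    simp_rw [fun i => log_tiltMass (b := b i) ha (hl i)]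
    refine Summable.add (Summable.mul_left _ ?_) ?_
    · refine Summable.of_nonneg_of_le (fun i => Real.log_nonneg ?_) (fun i => ?_) (hsl.mul_left a)
      · have := hl i; nlinarith [mul_nonneg ha this.le]
      · have h := hl i
        linarith [Real.log_le_sub_one_of_pos (show 0 < 1 + a * l i by positivity)]
    · refine Summable.of_nonneg_of_le (fun i => ?_) (fun i => ?_) hb
      · have h := hl i; positivity
      · have h := hl i
        refine div_le_self (by positivity) ?_
        nlinarith [mul_nonneg ha h.le]
  refine ⟨Real.exp (∑' i, Real.log (tiltMass a (b i) (l i))), Real.exp_pos _, ?_⟩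
  refine ((Real.continuous_exp.tendsto _).comp hs.hasSum.tendsto_sum_nat).congr fun N => ?_
  rw [Function.comp, Real.exp_sum]
  exact Finset.prod_congr rfl fun i _ => Real.exp_log (tiltMass_pos ha (hl i))

/-- The infinite product of the densities of `N(b l / (1 + a l), l / (1 + a l))` with respect to
`N(0, l)`, up to a constant. -/
lemma exists_density_gaussian {a : ℝ} (ha : 0 ≤ a) {b l : ℕ → ℝ} (hl : ∀ i, 0 < l i)
    (hsl : Summable l) (hb : Summable fun i => b i ^ 2 * l i) :
    ∃ (c : ℝ) (F : (ℕ → ℝ) → ℝ≥0∞), 0 < c ∧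
      (∀ᵐ x ∂(Measure.infinitePi fun i => gaussianReal 0 (l i).toNNReal), Tendsto
        (fun N => ENNReal.ofReal (∏ i ∈ Finset.range N, Real.exp (b i * x i - a * x i ^ 2 / 2)))
        atTop (𝓝 (ENNReal.ofReal c * F x))) ∧
      (Measure.infinitePi fun i => gaussianReal 0 (l i).toNNReal).withDensity F =
        Measure.infinitePi fun i =>
          gaussianReal (b i * (l i / (1 + a * l i))) (l i / (1 + a * l i)).toNNReal := by
  obtain ⟨c, hc0, hc⟩ := tendsto_prod_tiltMass ha hl hsl hb
  have hC : ∀ N, ∏ i ∈ Finset.range N,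
      ∫⁻ x, ENNReal.ofReal (Real.exp (b i * x - a * x ^ 2 / 2) / tiltMass a (b i) (l i)) ^ 2
        ∂(gaussianReal 0 (l i).toNNReal) ≤
      ((Real.exp (∑' i, (a * l i + 2 * (b i ^ 2 * l i)))).toNNReal : ℝ≥0∞) := by
    intro N
    refine (Finset.prod_le_prod' fun i _ => lintegral_tilt_sq_le ha (hl i)).trans ?_
    rw [← ENNReal.ofReal_prod_of_nonneg fun _ _ => (Real.exp_pos _).le, ← Real.exp_sum]
    refine ENNReal.ofReal_le_ofReal (Real.exp_le_exp.2 ?_)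
    refine Summable.sum_le_tsum _ (fun i _ => ?_) ((hsl.mul_left a).add (hb.mul_left 2))
    have := hl i; positivity
  obtain ⟨F, hF, hFQ⟩ := exists_density_infinitePi
    (P := fun i => gaussianReal 0 (l i).toNNReal)
    (f := fun i x => Real.exp (b i * x - a * x ^ 2 / 2) / tiltMass a (b i) (l i))
    (Q := fun i => gaussianReal (b i * (l i / (1 + a * l i))) (l i / (1 + a * l i)).toNNReal)
    (fun i => by fun_prop) (fun i x => by have := tiltMass_pos (b := b i) ha (hl i); positivity)
    (fun i => gaussianReal_eq_withDensity ha (hl i)) hC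
  refine ⟨c, F, hc0, ?_, hFQ⟩
  filter_upwards [hF] with x hx
  have h1 := ENNReal.Tendsto.mul (ENNReal.tendsto_ofReal hc)
    (Or.inl (by simpa using hc0)) hx (Or.inr ENNReal.ofReal_ne_top)
  refine h1.congr fun N => ?_
  rw [← ENNReal.ofReal_mul (Finset.prod_nonneg fun i _ => (tiltMass_pos ha (hl i)).le),
    ← Finset.prod_mul_distrib]
  congr 1
  refine Finset.prod_congr rfl fun i _ => ?_
  rw [mul_div_cancel₀ _ (tiltMass_pos ha (hl i)).ne']

/-- The posterior variances for prior variances `l i` and noise precision `a`. -/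
noncomputable def postVar (a : ℝ) (l : ℕ → ℝ) (i : ℕ) : ℝ := l i / (1 + a * l i)

lemma ae_summable_sq {Ω : Type*} {mΩ : MeasurableSpace Ω} {μ : Measure Ω}
    {X : ℕ → Ω → ℝ} (hX : ∀ i, Measurable (X i))
    (hs : ∑' i, ∫⁻ x, ENNReal.ofReal (X i x ^ 2) ∂μ ≠ ∞) :
    ∀ᵐ x ∂μ, Summable fun i => X i x ^ 2 := by
  rw [← lintegral_tsum fun i => ((hX i).pow_const 2).ennreal_ofReal.aemeasurable] at hs
  filter_upwards [ae_lt_top (by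
    exact Measurable.tsum fun i => ((hX i).pow_const 2).ennreal_ofReal) hs] with x hx
  have := ENNReal.summable_toReal hx.ne
  simpa [ENNReal.toReal_ofReal, sq_nonneg] using this

lemma lintegral_sq_gaussianReal (μ : ℝ) (v : ℝ≥0) :
    ∫⁻ x, ENNReal.ofReal (x ^ 2) ∂(gaussianReal μ v) = ENNReal.ofReal (μ ^ 2 + v) := by
  have hL := memLp_id_gaussianReal (μ := μ) (v := v) 2
  have hi : Integrable (fun x : ℝ => x ^ 2) (gaussianReal μ v) := hL.integrable_sq
  rw [← ofReal_integral_eq_lintegral_ofReal hi (Eventually.of_forall fun x => sq_nonneg x)]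
  congr 1
  have := variance_eq_sub hL
  rw [variance_id_gaussianReal] at this
  simp only [id_eq, integral_id_gaussianReal, Pi.pow_apply] at this
  linarith

lemma ae_summable_sq_gaussian {μ v : ℕ → ℝ} (hμ : Summable fun i => μ i ^ 2) (hv0 : ∀ i, 0 ≤ v i)
    (hv : Summable v) :
    ∀ᵐ x ∂(Measure.infinitePi fun i => gaussianReal (μ i) (v i).toNNReal),
      Summable fun i => x i ^ 2 := by
  refine ae_summable_sq (X := fun i (x : ℕ → ℝ) => x i)
    (fun i => measurable_pi_apply i) ?_
  have : ∀ i, ∫⁻ x, ENNReal.ofReal (x i ^ 2)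
      ∂(Measure.infinitePi fun i => gaussianReal (μ i) (v i).toNNReal) =
      ENNReal.ofReal (μ i ^ 2 + v i) := by
    intro i
    have h := (measurePreserving_eval_infinitePi
      (fun i => gaussianReal (μ i) (v i).toNNReal) i).lintegral_comp
      (f := fun x => ENNReal.ofReal (x ^ 2)) (by fun_prop)
    rw [lintegral_sq_gaussianReal, Real.coe_toNNReal _ (hv0 i)] at h
    exact h
  simp_rw [this]
  rw [← ENNReal.ofReal_tsum_of_nonneg (fun i => add_nonneg (sq_nonneg _) (hv0 i)) (hμ.add hv)]
  exact ENNReal.ofReal_ne_top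

lemma map_coords_withDensity (μ : Measure Ell2) {g : (ℕ → ℝ) → ℝ≥0∞} (hg : Measurable g) :
    (μ.withDensity fun θ => g (coords θ)).map coords = (μ.map coords).withDensity g := by
  ext s hs
  have hc := continuous_coords.measurable
  rw [Measure.map_apply hc hs, withDensity_apply _ (hc hs), withDensity_apply _ hs,
    setLIntegral_map hs hg hc]

/-- The power `m` multiplies the local precision `n/(σ²m)` by `m`. The total mass `c` of the tilted
prior cancels in the normalization; only `0 < c < ∞` matters. -/
lemma map_coords_genPosterior {σ n : ℝ} {m : ℕ} {α : ℝ} {y : ℕ → ℝ} {a : ℝ} (ha : 0 ≤ a)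
    (hα : 0 < α) (haN : a = m * (n / (σ ^ 2 * m)))
    (hy : Summable fun i => y i ^ 2 * freq i ^ (-1 - 2 * α)) :
    (genPosterior σ n m α y).map coords = Measure.infinitePi fun i =>
      gaussianReal (a * y i * postVar a (fun i => freq i ^ (-1 - 2 * α)) i)
        (postVar a (fun i => freq i ^ (-1 - 2 * α)) i).toNNReal := by
  set l : ℕ → ℝ := fun i => freq i ^ (-1 - 2 * α) with hldef
  have hl : ∀ i, 0 < l i := fun i => Real.rpow_pos_of_pos (freq_pos i) _
  have hsl : Summable l := summable_freq_rpow (by linarith)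
  have hb : Summable fun i => (a * y i) ^ 2 * l i := by
    refine (hy.mul_left (a ^ 2)).congr fun i => ?_
    ring
  obtain ⟨c, F, hc, hF, hFQ⟩ := exists_density_gaussian ha hl hsl hb
  have hprior : (prior α).map coords = priorSeq α := by
    refine map_coords_comap ?_
    exact ae_summable_sq_gaussian (μ := fun _ => 0) (by simp) (fun i => (hl i).le) hsl
  set g : (ℕ → ℝ) → ℝ≥0∞ :=
    fun x => (limsup (fun N : ℕ => ENNReal.ofReal (likTrunc σ n m N y x)) atTop) ^ m with hg
  have hgm : Measurable g := by
    refine (Measurable.limsup fun N => ?_).pow_const m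
    simp_rw [likTrunc_eq]
    fun_prop
  have hgF : g =ᵐ[priorSeq α] fun x => ENNReal.ofReal c * F x := by
    filter_upwards [hF] with x hx
    have h1 : g x = limsup (fun N : ℕ => ENNReal.ofReal (likTrunc σ n m N y x) ^ m) atTop :=
      (show Monotone fun z : ℝ≥0∞ => z ^ m from fun _ _ h => pow_le_pow_left' h m)
        |>.map_limsup_of_continuousAt _ (ENNReal.continuous_pow m).continuousAt
    rw [h1]
    refine (hx.congr fun N => ?_).limsup_eq
    rw [← ENNReal.ofReal_pow (likTrunc_nonneg _ _ _ _ _ _), likTrunc_pow_eq _ _ _ _ _ _ haN]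
  have hdens : ((prior α).withDensity fun θ => lik σ n m y θ ^ m).map coords =
      ENNReal.ofReal c • Measure.infinitePi fun i =>
        gaussianReal (a * y i * postVar a l i) (postVar a l i).toNNReal := by
    have h2 := map_coords_withDensity (prior α) hgm
    rw [hprior, withDensity_congr_ae hgF] at h2
    have h3 : (fun θ : Ell2 => g (coords θ)) = fun θ => lik σ n m y θ ^ m := rfl
    rw [h3] at h2
    rw [h2]
    change (priorSeq α).withDensity (ENNReal.ofReal c • F) = _
    rw [withDensity_smul' _ _ ENNReal.ofReal_ne_top]
    congr 1
  have hmass : ∫⁻ θ, lik σ n m y θ ^ m ∂(prior α) = ENNReal.ofReal c := by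
    have h4 := congrArg (fun μ => μ Set.univ) hdens
    simpa [Measure.map_apply continuous_coords.measurable MeasurableSet.univ] using h4
  rw [genPosterior, Measure.map_smul, hdens, hmass, smul_smul,
    ENNReal.inv_mul_cancel (by simpa using hc) ENNReal.ofReal_ne_top, one_smul]

/-! ### Barycenters of translates of a measure -/

lemma lintegral_enorm_sq {Ω E : Type*} {mΩ : MeasurableSpace Ω} [NormedAddCommGroup E]
    (f : Ω → E) (μ : Measure Ω) : ∫⁻ x, ‖f x‖ₑ ^ 2 ∂μ = eLpNorm f 2 μ ^ 2 := by
  have := eLpNorm_nnreal_pow_eq_lintegral (f := f) (μ := μ) (p := 2) (by norm_num)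
  simpa using this.symm

lemma memLp_two_of_lintegral {Ω E : Type*} {mΩ : MeasurableSpace Ω} [NormedAddCommGroup E]
    {f : Ω → E} {μ : Measure Ω} (hf : AEStronglyMeasurable f μ) (h : ∫⁻ x, ‖f x‖ₑ ^ 2 ∂μ < ∞) :
    MemLp f 2 μ := by
  refine ⟨hf, ?_⟩
  rw [lintegral_enorm_sq] at h
  by_contra h'
  rw [not_lt, top_le_iff] at h'
  simp [h'] at h

lemma lintegral_enorm_sq_eq_ofReal {Ω E : Type*} {mΩ : MeasurableSpace Ω} [NormedAddCommGroup E]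
    {f : Ω → E} {μ : Measure Ω} (hf : MemLp f 2 μ) :
    ∫⁻ x, ‖f x‖ₑ ^ 2 ∂μ = ENNReal.ofReal (∫ x, ‖f x‖ ^ 2 ∂μ) := by
  have hi : Integrable (fun x => ‖f x‖ ^ 2) μ := hf.integrable_norm_pow (by norm_num)
  rw [ofReal_integral_eq_lintegral_ofReal hi (Eventually.of_forall fun x => sq_nonneg _)]
  refine lintegral_congr fun x => ?_
  rw [ENNReal.ofReal_pow (norm_nonneg _), ofReal_norm]

lemma integral_norm_sq_eq {Ω : Type*} {mΩ : MeasurableSpace Ω} {γ : Measure Ω}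
    [IsProbabilityMeasure γ] {D : Ω → Ell2} (hD : MemLp D 2 γ) :
    ∫ x, ‖D x‖ ^ 2 ∂γ = ‖∫ x, D x ∂γ‖ ^ 2 + ∫ x, ‖D x - ∫ x, D x ∂γ‖ ^ 2 ∂γ := by
  set e := ∫ x, D x ∂γ with he
  have hi : Integrable D γ := hD.integrable (by norm_num)
  have hw : MemLp (fun x => D x - e) 2 γ := hD.sub (memLp_const e)
  have hwi : Integrable (fun x => D x - e) γ := hw.integrable (by norm_num)
  have h1 : ∀ x, ‖D x‖ ^ 2 = ‖e‖ ^ 2 + 2 * inner ℝ e (D x - e) + ‖D x - e‖ ^ 2 := by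
    intro x
    rw [← norm_add_sq_real, add_sub_cancel]
  have h2 : Integrable (fun x => ‖D x - e‖ ^ 2) γ := hw.integrable_norm_pow (by norm_num)
  have h3 : Integrable (fun x => inner ℝ e (D x - e)) γ := hwi.const_inner e
  simp_rw [h1]
  have h4 : Integrable (fun x => ‖e‖ ^ 2 + 2 * inner ℝ e (D x - e)) γ :=
    (integrable_const _).add (h3.const_mul 2)
  rw [integral_add h4 h2,
    integral_add (integrable_const _) (h3.const_mul 2), integral_const_mul,
    integral_inner hwi, integral_sub hi (integrable_const _)]
  simp [he]

/-- The average of finitely many points. -/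
noncomputable def average {m : ℕ} (a : Fin m → Ell2) : Ell2 := (m : ℝ)⁻¹ • ∑ j, a j

lemma sum_norm_sub_sq {m : ℕ} (hm : 0 < m) (a : Fin m → Ell2) (x : Ell2) :
    ∑ j, ‖x - a j‖ ^ 2 = m * ‖x - average a‖ ^ 2 + ∑ j, ‖average a - a j‖ ^ 2 := by
  have hm' : (m : ℝ) ≠ 0 := by positivity
  have h0 : ∑ j, (average a - a j) = 0 := by
    rw [Finset.sum_sub_distrib, average]
    simp only [Finset.sum_const, Finset.card_univ, Fintype.card_fin]
    rw [← Nat.cast_smul_eq_nsmul ℝ, smul_smul, mul_inv_cancel₀ hm', one_smul, sub_self]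
  have h1 : ∀ j, ‖x - a j‖ ^ 2 = ‖x - average a‖ ^ 2 +
      2 * inner ℝ (x - average a) (average a - a j) + ‖average a - a j‖ ^ 2 := by
    intro j
    rw [← norm_add_sq_real, sub_add_sub_cancel]
  simp_rw [h1, Finset.sum_add_distrib, ← Finset.mul_sum, ← inner_sum, h0]
  simp

lemma aestronglyMeasurable_fun_id (μ : Measure Ell2) :
    AEStronglyMeasurable (fun θ : Ell2 => θ) μ := continuous_id.aestronglyMeasurable

lemma measurable_add_const' (a : Ell2) : Measurable fun θ : Ell2 => θ + a :=
  (continuous_id.add continuous_const).measurable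

section
variable {m : ℕ} {ν : Measure Ell2} [IsProbabilityMeasure ν] {a : Fin m → Ell2} {μ : Measure Ell2}

lemma memLp_add_const (hν2 : ∫⁻ θ, ‖θ‖ₑ ^ 2 ∂ν < ∞) (c : Ell2) :
    MemLp (fun θ : Ell2 => θ) 2 (ν.map (· + c)) := by
  have h : MemLp (fun θ : Ell2 => θ) 2 ν :=
    memLp_two_of_lintegral (aestronglyMeasurable_fun_id _) hν2
  rw [memLp_map_measure_iff (aestronglyMeasurable_fun_id _)
    (measurable_add_const' c).aemeasurable]
  exact h.add (memLp_const c)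

lemma integral_add_const (hν2 : ∫⁻ θ, ‖θ‖ₑ ^ 2 ∂ν < ∞) (hν0 : ∫ θ, θ ∂ν = 0) (c : Ell2) :
    ∫ θ, θ ∂(ν.map (· + c)) = c := by
  have h : MemLp (fun θ : Ell2 => θ) 2 ν :=
    memLp_two_of_lintegral (aestronglyMeasurable_fun_id _) hν2
  rw [integral_map (measurable_add_const' c).aemeasurable (aestronglyMeasurable_fun_id _),
    integral_add (h.integrable (by norm_num)) (integrable_const _), hν0]
  simp

lemma W2sq_translates_le (b c : Ell2) :
    W2sq (ν.map (· + b)) (ν.map (· + c)) ≤ ENNReal.ofReal (‖b - c‖ ^ 2) := by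
  have hm : Measurable fun θ : Ell2 => (θ + b, θ + c) :=
    (measurable_add_const' b).prodMk (measurable_add_const' c)
  refine (iInf₂_le (ν.map fun θ => (θ + b, θ + c))
    ⟨by rw [Measure.map_map measurable_fst hm]; rfl,
      by rw [Measure.map_map measurable_snd hm]; rfl⟩).trans ?_
  have hc : Measurable fun p : Ell2 × Ell2 => ‖p.1 - p.2‖ₑ ^ 2 :=
    (measurable_fst.sub measurable_snd).enorm.pow_const 2
  rw [lintegral_map hc hm]
  simp only [add_sub_add_left_eq_sub, lintegral_const, measure_univ, mul_one]
  rw [ENNReal.ofReal_pow (norm_nonneg _), ofReal_norm]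

/-- The translate of `ν` by `average a` is a competitor of total cost at most `∑ ‖average a - a
j‖²`. The cost of any coupling is the squared difference of the means plus the variance of `p.1 -
p.2`, and the squared differences alone already add up to that amount plus `m ‖postMean μ - average
a‖²`. Nearly optimal couplings thus have nearly constant difference. The slack `ε`, shared equally
among the observers, replaces the existence of optimal couplings. -/
lemma exists_couplings_of_isBarycenter (hm : 0 < m) (hν2 : ∫⁻ θ, ‖θ‖ₑ ^ 2 ∂ν < ∞)
    (hν0 : ∫ θ, θ ∂ν = 0) (hμ : IsBarycenter (fun j => ν.map (· + a j)) μ) {ε : ℝ} (hε : 0 < ε) :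
    m * ‖postMean μ - average a‖ ^ 2 ≤ ε ∧
    ∀ j, ∃ γ : Measure (Ell2 × Ell2), γ.map Prod.fst = μ ∧ γ.map Prod.snd = ν.map (· + a j) ∧
      ∫⁻ p, ‖(p.1 - p.2) - (postMean μ - a j)‖ₑ ^ 2 ∂γ ≤ ENNReal.ofReal ε := by
  have hm' : (m : ℝ≥0∞) ≠ 0 := by simpa using hm.ne'
  obtain ⟨hμP, hmin⟩ := hμ
  have hμp : IsProbabilityMeasure μ := hμP.1
  have hνp : ∀ c, IsProbabilityMeasure (ν.map (· + c)) := fun c =>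
    Measure.isProbabilityMeasure_map (measurable_add_const' c).aemeasurable
  have h1 : ∑ j, W2sq μ (ν.map (· + a j)) ≤ ENNReal.ofReal (∑ j, ‖average a - a j‖ ^ 2) := by
    have h2 := hmin (ν.map (· + average a)) ⟨hνp _, by
      rw [lintegral_enorm_sq]
      exact ENNReal.pow_lt_top (memLp_add_const hν2 _).2⟩
    rw [ENNReal.mul_le_mul_iff_right (ENNReal.inv_ne_zero.2 (ENNReal.natCast_ne_top m))
      (ENNReal.inv_ne_top.2 hm')] at h2
    refine h2.trans ?_
    rw [ENNReal.ofReal_sum_of_nonneg fun _ _ => sq_nonneg _]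
    exact Finset.sum_le_sum fun j _ => W2sq_translates_le _ _
  have hfin : ∀ j, W2sq μ (ν.map (· + a j)) < ∞ := fun j =>
    lt_of_le_of_lt ((Finset.single_le_sum (f := fun j => W2sq μ (ν.map (· + a j)))
      (fun _ _ => zero_le) (Finset.mem_univ j)).trans h1) ENNReal.ofReal_lt_top
  have hγ : ∀ j, ∃ γ : Measure (Ell2 × Ell2), (γ.map Prod.fst = μ ∧
      γ.map Prod.snd = ν.map (· + a j)) ∧
      ∫⁻ p, ‖p.1 - p.2‖ₑ ^ 2 ∂γ < W2sq μ (ν.map (· + a j)) + ENNReal.ofReal (ε / m) := by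
    intro j
    have h3 : W2sq μ (ν.map (· + a j)) < W2sq μ (ν.map (· + a j)) + ENNReal.ofReal (ε / m) :=
      ENNReal.lt_add_right (hfin j).ne (by
        simp only [ne_eq, ENNReal.ofReal_eq_zero, not_le]; positivity)
    conv_lhs at h3 => rw [W2sq]
    simp only [iInf_lt_iff] at h3
    obtain ⟨γ, hγ1, hγ2⟩ := h3
    exact ⟨γ, hγ1, hγ2⟩
  choose γ hγ1 hγ2 using hγ
  have hγp : ∀ j, IsProbabilityMeasure (γ j) := fun j =>
    ⟨by
      have : (γ j).map Prod.fst Set.univ = 1 := by rw [(hγ1 j).1]; exact measure_univ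
      rwa [Measure.map_apply measurable_fst MeasurableSet.univ] at this⟩
  have hL1 : ∀ j, MemLp (fun p : Ell2 × Ell2 => p.1) 2 (γ j) := by
    intro j
    have h4 : MemLp (fun θ : Ell2 => θ) 2 ((γ j).map Prod.fst) := by
      rw [(hγ1 j).1]
      exact memLp_two_of_lintegral (aestronglyMeasurable_fun_id _) hμP.2
    exact (memLp_map_measure_iff (aestronglyMeasurable_fun_id _)
      measurable_fst.aemeasurable).1 h4
  have hL2 : ∀ j, MemLp (fun p : Ell2 × Ell2 => p.2) 2 (γ j) := by
    intro j
    have h4 : MemLp (fun θ : Ell2 => θ) 2 ((γ j).map Prod.snd) := by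
      rw [(hγ1 j).2]
      exact memLp_add_const hν2 _
    exact (memLp_map_measure_iff (aestronglyMeasurable_fun_id _)
      measurable_snd.aemeasurable).1 h4
  have hD : ∀ j, MemLp (fun p : Ell2 × Ell2 => p.1 - p.2) 2 (γ j) := fun j => (hL1 j).sub (hL2 j)
  have hmean : ∀ j, ∫ p, (p.1 - p.2) ∂(γ j) = postMean μ - a j := by
    intro j
    rw [integral_sub ((hL1 j).integrable (by norm_num)) ((hL2 j).integrable (by norm_num))]
    congr 1
    · rw [postMean, ← (hγ1 j).1, integral_map measurable_fst.aemeasurable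
        (aestronglyMeasurable_fun_id _)]
    · rw [← integral_add_const hν2 hν0 (a j), ← (hγ1 j).2,
        integral_map measurable_snd.aemeasurable (aestronglyMeasurable_fun_id _)]
  have hcost : ∑ j, ∫ p, ‖p.1 - p.2‖ ^ 2 ∂(γ j) ≤ ∑ j, ‖average a - a j‖ ^ 2 + ε := by
    have h5 : ENNReal.ofReal (∑ j, ∫ p, ‖p.1 - p.2‖ ^ 2 ∂(γ j)) ≤
        ENNReal.ofReal (∑ j, ‖average a - a j‖ ^ 2 + ε) := by
      rw [ENNReal.ofReal_sum_of_nonneg fun j _ => integral_nonneg fun p => sq_nonneg _]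
      calc ∑ j, ENNReal.ofReal (∫ p, ‖p.1 - p.2‖ ^ 2 ∂(γ j))
          ≤ ∑ j, (W2sq μ (ν.map (· + a j)) + ENNReal.ofReal (ε / m)) := by
            refine Finset.sum_le_sum fun j _ => ?_
            rw [← lintegral_enorm_sq_eq_ofReal (hD j)]
            exact (hγ2 j).le
        _ = ∑ j, W2sq μ (ν.map (· + a j)) + ENNReal.ofReal ε := by
            rw [Finset.sum_add_distrib]
            congr 1
            simp only [Finset.sum_const, Finset.card_univ, Fintype.card_fin, nsmul_eq_mul]
            rw [← ENNReal.ofReal_natCast, ← ENNReal.ofReal_mul (by positivity)]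
            congr 1
            field_simp
        _ ≤ _ := by
            rw [ENNReal.ofReal_add (Finset.sum_nonneg fun _ _ => sq_nonneg _) hε.le]
            gcongr
    exact (ENNReal.ofReal_le_ofReal_iff
      (add_nonneg (Finset.sum_nonneg fun _ _ => sq_nonneg _) hε.le)).1 h5
  have hsplit : ∀ j, ∫ p, ‖p.1 - p.2‖ ^ 2 ∂(γ j) = ‖postMean μ - a j‖ ^ 2 +
      ∫ p, ‖(p.1 - p.2) - (postMean μ - a j)‖ ^ 2 ∂(γ j) := by
    intro j
    rw [integral_norm_sq_eq (hD j), hmean]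
  simp_rw [hsplit, Finset.sum_add_distrib, sum_norm_sub_sq hm a (postMean μ)] at hcost
  have hnn : ∀ j, 0 ≤ ∫ p, ‖(p.1 - p.2) - (postMean μ - a j)‖ ^ 2 ∂(γ j) := fun j =>
    integral_nonneg fun p => sq_nonneg _
  have hsum := Finset.sum_nonneg fun j (_ : j ∈ Finset.univ) => hnn j
  refine ⟨by linarith, fun j => ⟨γ j, (hγ1 j).1, (hγ1 j).2, ?_⟩⟩
  have h8 : MemLp (fun p : Ell2 × Ell2 => (p.1 - p.2) - (postMean μ - a j)) 2 (γ j) :=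
    (hD j).sub (memLp_const _)
  rw [lintegral_enorm_sq_eq_ofReal h8]
  refine ENNReal.ofReal_le_ofReal ?_
  have h6 := Finset.single_le_sum (f := fun j =>
    ∫ p, ‖(p.1 - p.2) - (postMean μ - a j)‖ ^ 2 ∂(γ j)) (fun j _ => hnn j) (Finset.mem_univ j)
  have h7 : 0 ≤ (m : ℝ) * ‖postMean μ - average a‖ ^ 2 := by positivity
  linarith

lemma postMean_barycenter (hm : 0 < m) (hν2 : ∫⁻ θ, ‖θ‖ₑ ^ 2 ∂ν < ∞)
    (hν0 : ∫ θ, θ ∂ν = 0) (hμ : IsBarycenter (fun j => ν.map (· + a j)) μ) :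
    postMean μ = average a := by
  have h1 : (m : ℝ) * ‖postMean μ - average a‖ ^ 2 ≤ 0 :=
    le_of_forall_pos_le_add fun ε hε => by
      simpa using (exists_couplings_of_isBarycenter hm hν2 hν0 hμ hε).1
  have hm' : (0 : ℝ) < m := by exact_mod_cast hm
  have h2 : ‖postMean μ - average a‖ ^ 2 ≤ 0 := by
    by_contra h; rw [not_le] at h; nlinarith [mul_pos hm' h]
  have h3 : ‖postMean μ - average a‖ = 0 := by
    have := sq_nonneg ‖postMean μ - average a‖
    exact pow_eq_zero_iff (two_ne_zero) |>.1 (le_antisymm h2 this)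
  exact sub_eq_zero.1 (norm_eq_zero.1 h3)

/-- The central second moments of a barycenter of translates of `ν` are at most those of `ν`. -/
lemma lintegral_barycenter_le {F : Type*} [NormedAddCommGroup F] [NormedSpace ℝ F]
    (hm : 0 < m) (hν2 : ∫⁻ θ, ‖θ‖ₑ ^ 2 ∂ν < ∞) (hν0 : ∫ θ, θ ∂ν = 0)
    (hμ : IsBarycenter (fun j => ν.map (· + a j)) μ) (T : Ell2 →L[ℝ] F) :
    ∫⁻ θ, ‖T (θ - average a)‖ₑ ^ 2 ∂μ ≤ ∫⁻ θ, ‖T θ‖ₑ ^ 2 ∂ν := by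
  rw [lintegral_enorm_sq, lintegral_enorm_sq]
  refine pow_le_pow_left' ?_ 2
  -- A coupling whose difference is constant up to `δ` in L² makes `μ` a translate of `ν` up to `δ`;
  -- Minkowski's inequality carries this through `T`. Any one observer suffices, here the one of
  -- index 0.
  have key : ∀ δ : ℝ≥0, 0 < δ → eLpNorm (fun θ => T (θ - average a)) 2 μ ≤
      eLpNorm (fun θ => T θ) 2 ν + ‖T‖ₑ * δ := by
    intro δ hδ
    obtain ⟨-, h⟩ := exists_couplings_of_isBarycenter hm hν2 hν0 hμ
      (ε := (δ : ℝ) ^ 2) (by positivity)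
    obtain ⟨γ, h1, h2, h3⟩ := h ⟨0, hm⟩
    rw [postMean_barycenter hm hν2 hν0 hμ] at h3
    rw [lintegral_enorm_sq, ENNReal.ofReal_pow δ.coe_nonneg, ENNReal.ofReal_coe_nnreal,
      ENNReal.pow_le_pow_left_iff two_ne_zero] at h3
    have e1 : eLpNorm (fun θ => T (θ - average a)) 2 μ =
        eLpNorm (fun p : Ell2 × Ell2 => T (p.1 - average a)) 2 γ := by
      rw [← h1, eLpNorm_map_measure _ measurable_fst.aemeasurable]
      · rfl
      · exact Continuous.aestronglyMeasurable (by fun_prop)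
    have e2 : eLpNorm (fun θ => T θ) 2 ν =
        eLpNorm (fun p : Ell2 × Ell2 => T (p.2 - a ⟨0, hm⟩)) 2 γ := by
      have e3 : eLpNorm (fun θ => T (θ - a ⟨0, hm⟩)) 2 (ν.map (· + a ⟨0, hm⟩)) =
          eLpNorm (fun θ => T θ) 2 ν := by
        rw [eLpNorm_map_measure _ (measurable_add_const' _).aemeasurable]
        · congr 1; ext θ; simp
        · exact Continuous.aestronglyMeasurable (by fun_prop)
      rw [← e3, ← h2, eLpNorm_map_measure _ measurable_snd.aemeasurable]
      · rfl
      · exact Continuous.aestronglyMeasurable (by fun_prop)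
    rw [e1, e2]
    have e4 : (fun p : Ell2 × Ell2 => T (p.1 - average a)) =
        (fun p : Ell2 × Ell2 => T (p.2 - a ⟨0, hm⟩)) +
          fun p => T ((p.1 - p.2) - (average a - a ⟨0, hm⟩)) := by
      ext p
      rw [Pi.add_apply, ← map_add]
      congr 1; abel
    rw [e4]
    refine (eLpNorm_add_le (Continuous.aestronglyMeasurable (by fun_prop))
      (Continuous.aestronglyMeasurable (by fun_prop)) (by norm_num)).trans ?_
    gcongr
    calc eLpNorm (fun p : Ell2 × Ell2 => T ((p.1 - p.2) - (average a - a ⟨0, hm⟩))) 2 γ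
        ≤ ‖T‖ₑ * eLpNorm (fun p : Ell2 × Ell2 => (p.1 - p.2) - (average a - a ⟨0, hm⟩)) 2 γ := by
          refine eLpNorm_le_nnreal_smul_eLpNorm_of_ae_le_mul (c := ‖T‖₊)
            (Eventually.of_forall fun p => T.le_opNNNorm _) 2 |>.trans ?_
          rw [ENNReal.smul_def, smul_eq_mul]; rfl
      _ ≤ _ := by gcongr
  have hlim : Tendsto (fun δ : ℝ≥0 => eLpNorm (fun θ => T θ) 2 ν + ‖T‖ₑ * (δ : ℝ≥0∞)) (𝓝[>] 0)
      (𝓝 (eLpNorm (fun θ => T θ) 2 ν + ‖T‖ₑ * ((0 : ℝ≥0) : ℝ≥0∞))) := by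
    refine (Tendsto.const_add _ (ENNReal.Tendsto.const_mul ?_ (Or.inr enorm_ne_top))).mono_left
      nhdsWithin_le_nhds
    exact (ENNReal.continuous_coe.tendsto 0)
  simp only [ENNReal.coe_zero, mul_zero, add_zero] at hlim
  exact ge_of_tendsto hlim (eventually_nhdsWithin_of_forall fun δ hδ => key δ hδ)

end

/-! ### The global posterior -/

open Classical in
/-- The element of `ℓ²` with given coordinates (`0` if they are not square summable). -/
noncomputable def toEll2 (x : ℕ → ℝ) : Ell2 :=
  if h : x ∈ Set.range coords then h.choose else 0

lemma coords_toEll2 {x : ℕ → ℝ} (hx : Summable fun i => x i ^ 2) : coords (toEll2 x) = x := by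
  have h : x ∈ Set.range coords := by rw [range_coords]; exact hx
  rw [toEll2, dif_pos h]
  exact h.choose_spec

lemma coords_add (x y : Ell2) : coords (x + y) = coords x + coords y := rfl

lemma coords_sub (x y : Ell2) : coords (x - y) = coords x - coords y := rfl

lemma coords_average {m : ℕ} (a : Fin m → Ell2) (i : ℕ) :
    coords (average a) i = (m : ℝ)⁻¹ * ∑ j, coords (a j) i := by
  change (lp.evalCLM ℝ (fun _ : ℕ => ℝ) (p := 2) i) (average a) = _
  rw [average, map_smul, map_sum]
  rfl

/-- The prior variances. -/
noncomputable def priorVar (α : ℝ) (i : ℕ) : ℝ := freq i ^ (-1 - 2 * α)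

lemma priorVar_pos (α : ℝ) (i : ℕ) : 0 < priorVar α i := Real.rpow_pos_of_pos (freq_pos i) _

lemma summable_priorVar {α : ℝ} (hα : 0 < α) : Summable (priorVar α) :=
  summable_freq_rpow (by linarith)

lemma postVar_pos {a : ℝ} (ha : 0 ≤ a) (α : ℝ) (i : ℕ) : 0 < postVar a (priorVar α) i := by
  have := priorVar_pos α i
  unfold postVar; positivity

lemma postVar_le_priorVar {a : ℝ} (ha : 0 ≤ a) (α : ℝ) (i : ℕ) :
    postVar a (priorVar α) i ≤ priorVar α i := by
  have := priorVar_pos α i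
  exact div_le_self this.le (by nlinarith [mul_nonneg ha this.le])

lemma mul_postVar_le_one {a : ℝ} (ha : 0 ≤ a) (α : ℝ) (i : ℕ) :
    a * postVar a (priorVar α) i ≤ 1 := by
  have := priorVar_pos α i
  have h2 : 0 < 1 + a * priorVar α i := by positivity
  rw [postVar, ← mul_div_assoc, div_le_one h2]
  linarith

lemma summable_postVar {a : ℝ} (ha : 0 ≤ a) {α : ℝ} (hα : 0 < α) :
    Summable (postVar a (priorVar α)) :=
  (summable_priorVar hα).of_nonneg_of_le (fun i => (postVar_pos ha α i).le)
    (postVar_le_priorVar ha α)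

/-- The centered posterior, common to all the observers. -/
noncomputable def centeredPosterior (a α : ℝ) : Measure Ell2 :=
  (Measure.infinitePi fun i => gaussianReal 0 (postVar a (priorVar α) i).toNNReal).comap coords

/-- The mean of the generalized local posterior. -/
noncomputable def localMean (a α : ℝ) (y : ℕ → ℝ) : Ell2 :=
  toEll2 fun i => a * y i * postVar a (priorVar α) i

/-- The data need not be square summable. One factor `a v ≤ 1` and one factor `v ≤ priorVar` of the
squared shrinkage reduce the claim to the weighted summability `hy`. -/
lemma coords_localMean {a α : ℝ} (ha : 0 ≤ a) {y : ℕ → ℝ}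
    (hy : Summable fun i => y i ^ 2 * priorVar α i) :
    coords (localMean a α y) = fun i => a * y i * postVar a (priorVar α) i := by
  refine coords_toEll2 ?_
  refine (hy.mul_left a).of_nonneg_of_le (fun i => sq_nonneg _) fun i => ?_
  have h1 := mul_postVar_le_one ha α i
  have h2 := postVar_le_priorVar ha α i
  have h3 := (postVar_pos ha α i).le
  calc (a * y i * postVar a (priorVar α) i) ^ 2
      = a * y i ^ 2 * ((a * postVar a (priorVar α) i) * postVar a (priorVar α) i) := by ring
    _ ≤ a * y i ^ 2 * (1 * priorVar α i) := by gcongr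
    _ = _ := by ring

lemma map_coords_centeredPosterior {a α : ℝ} (ha : 0 ≤ a) (hα : 0 < α) :
    (centeredPosterior a α).map coords =
      Measure.infinitePi fun i => gaussianReal 0 (postVar a (priorVar α) i).toNNReal :=
  map_coords_comap (ae_summable_sq_gaussian (μ := fun _ => 0) (by simp)
    (fun i => (postVar_pos ha α i).le) (summable_postVar ha hα))

lemma isProbabilityMeasure_centeredPosterior {a α : ℝ} (ha : 0 ≤ a) (hα : 0 < α) :
    IsProbabilityMeasure (centeredPosterior a α) := by
  constructor
  have h : (centeredPosterior a α).map coords Set.univ = 1 := by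
    rw [map_coords_centeredPosterior ha hα]; exact measure_univ
  rwa [Measure.map_apply continuous_coords.measurable MeasurableSet.univ] at h

lemma measurePreserving_coord_centeredPosterior {a α : ℝ} (ha : 0 ≤ a) (hα : 0 < α) (i : ℕ) :
    MeasurePreserving (fun θ => coords θ i) (centeredPosterior a α)
      (gaussianReal 0 (postVar a (priorVar α) i).toNNReal) :=
  (measurePreserving_eval_infinitePi
    (fun i => gaussianReal 0 (postVar a (priorVar α) i).toNNReal) i).comp
    ⟨continuous_coords.measurable, map_coords_centeredPosterior ha hα⟩

lemma lintegral_coord_sq_centeredPosterior {a α : ℝ} (ha : 0 ≤ a) (hα : 0 < α) (i : ℕ) :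
    ∫⁻ θ, ENNReal.ofReal (coords θ i ^ 2) ∂(centeredPosterior a α) =
      ENNReal.ofReal (postVar a (priorVar α) i) := by
  rw [(measurePreserving_coord_centeredPosterior ha hα i).lintegral_comp
    (f := fun x => ENNReal.ofReal (x ^ 2)) (by fun_prop), lintegral_sq_gaussianReal,
    Real.coe_toNNReal _ (postVar_pos ha α i).le]
  simp

lemma lintegral_norm_sq_centeredPosterior {a α : ℝ} (ha : 0 ≤ a) (hα : 0 < α) :
    ∫⁻ θ, ‖θ‖ₑ ^ 2 ∂(centeredPosterior a α) =
      ENNReal.ofReal (∑' i, postVar a (priorVar α) i) := by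
  simp_rw [enorm_sq_eq_tsum]
  rw [lintegral_tsum fun i => (by
    have : Measurable fun θ : Ell2 => coords θ i :=
      (measurable_pi_apply i).comp continuous_coords.measurable
    fun_prop)]
  simp_rw [lintegral_coord_sq_centeredPosterior ha hα]
  rw [ENNReal.ofReal_tsum_of_nonneg (fun i => (postVar_pos ha α i).le) (summable_postVar ha hα)]

lemma integral_centeredPosterior {a α : ℝ} (ha : 0 ≤ a) (hα : 0 < α) :
    ∫ θ, θ ∂(centeredPosterior a α) = 0 := by
  have := isProbabilityMeasure_centeredPosterior ha hα
  have hL : MemLp (fun θ : Ell2 => θ) 2 (centeredPosterior a α) := by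
    refine memLp_two_of_lintegral (aestronglyMeasurable_fun_id _) ?_
    rw [lintegral_norm_sq_centeredPosterior ha hα]
    exact ENNReal.ofReal_lt_top
  refine coords_injective (funext fun i => ?_)
  change (lp.evalCLM ℝ (fun _ : ℕ => ℝ) (p := 2) i) (∫ θ, θ ∂(centeredPosterior a α)) = 0
  rw [← ContinuousLinearMap.integral_comp_comm _ (hL.integrable (by norm_num))]
  have h := (measurePreserving_coord_centeredPosterior ha hα i)
  have h2 := integral_map h.measurable.aemeasurable (μ := centeredPosterior a α)
    (f := fun x : ℝ => x) continuous_id.aestronglyMeasurable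
  rw [h.map_eq, integral_id_gaussianReal] at h2
  exact h2.symm

/-- The posterior variances depend on `a` and `α` only; the data merely move the centre. -/
lemma genPosterior_eq_map {σ n : ℝ} {m : ℕ} {α : ℝ} {y : ℕ → ℝ} {a : ℝ} (ha : 0 ≤ a)
    (hα : 0 < α) (haN : a = m * (n / (σ ^ 2 * m)))
    (hy : Summable fun i => y i ^ 2 * priorVar α i) :
    genPosterior σ n m α y = (centeredPosterior a α).map (· + localMean a α y) := by
  refine eq_of_map_coords_eq ?_
  have h1 := map_coords_genPosterior ha hα haN hy
  rw [h1, Measure.map_map continuous_coords.measurable (measurable_add_const' _)]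
  have h2 : coords ∘ (· + localMean a α y) =
      (fun x i => x i + a * y i * postVar a (priorVar α) i) ∘ coords := by
    ext θ i
    simp only [Function.comp, coords_add, coords_localMean ha hy, Pi.add_apply]
  have hm : Measurable fun (x : ℕ → ℝ) i => x i + a * y i * postVar a (priorVar α) i := by
    fun_prop
  rw [h2, ← Measure.map_map hm continuous_coords.measurable,
    map_coords_centeredPosterior ha hα,
    Measure.infinitePi_map_pi (f := fun i (z : ℝ) => z + a * y i * postVar a (priorVar α) i) _
      (fun i => by fun_prop)]
  simp_rw [gaussianReal_map_add_const, zero_add]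
  rfl

/-- Mean and spread of the barycenter of the generalized local posteriors. -/
lemma barycenter_genPosterior {σ n : ℝ} {m : ℕ} (hm : 0 < m) {α : ℝ} {Y : Data m} {a : ℝ}
    (ha : 0 ≤ a) (hα : 0 < α) (haN : a = m * (n / (σ ^ 2 * m)))
    (hY : ∀ j, Summable fun i => Y j i ^ 2 * priorVar α i) {μ : Measure Ell2}
    (hμ : IsBarycenter (fun j => genPosterior σ n m α (Y j)) μ) :
    (∀ i, coords (postMean μ) i = a * postVar a (priorVar α) i * ((m : ℝ)⁻¹ * ∑ j, Y j i)) ∧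
    (∀ i, ∫⁻ θ, ENNReal.ofReal ((coords θ i - coords (postMean μ) i) ^ 2) ∂μ ≤
      ENNReal.ofReal (postVar a (priorVar α) i)) ∧
    ∫⁻ θ, ‖θ - postMean μ‖ₑ ^ 2 ∂μ ≤ ENNReal.ofReal (∑' i, postVar a (priorVar α) i) := by
  have hp := isProbabilityMeasure_centeredPosterior ha hα
  simp_rw [fun j => genPosterior_eq_map ha hα haN (hY j)] at hμ
  have h2 := lintegral_norm_sq_centeredPosterior ha hα
  have hfin : ∫⁻ θ, ‖θ‖ₑ ^ 2 ∂(centeredPosterior a α) < ∞ := by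
    rw [h2]; exact ENNReal.ofReal_lt_top
  have h0 := integral_centeredPosterior ha hα
  have hmean := postMean_barycenter hm hfin h0 hμ
  refine ⟨fun i => ?_, fun i => ?_, ?_⟩
  · rw [hmean, coords_average]
    simp_rw [fun j => coords_localMean ha (hY j)]
    rw [← Finset.sum_mul, ← Finset.mul_sum]
    ring
  · have h := lintegral_barycenter_le hm hfin h0 hμ (lp.evalCLM ℝ (fun _ : ℕ => ℝ) (p := 2) i)
    have e : ∀ x : ℝ, ‖x‖ₑ ^ 2 = ENNReal.ofReal (x ^ 2) := fun x => by
      rw [← ofReal_norm, ← ENNReal.ofReal_pow (norm_nonneg _), Real.norm_eq_abs, sq_abs]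
    simp_rw [e] at h
    rw [hmean]
    exact h.trans_eq (lintegral_coord_sq_centeredPosterior ha hα i)
  · have h := lintegral_barycenter_le hm hfin h0 hμ (ContinuousLinearMap.id ℝ Ell2)
    rw [hmean, ← h2]
    exact h

/-! ### The log-marginal likelihood -/

/-- The shrinkage weights `x / (1 + x)` with `x = t k ^ (-p)`. -/
noncomputable def weight (t p : ℝ) (i : ℕ) : ℝ := t / (freq i ^ p + t)

/-- The function `log (1 + x) - x / (1 + x)`. -/
noncomputable def entropyFn (x : ℝ) : ℝ := Real.log (1 + x) - x / (1 + x)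

lemma entropyFn_nonneg {x : ℝ} (hx : 0 ≤ x) : 0 ≤ entropyFn x := by
  have h : 0 < 1 + x := by positivity
  have h1 := Real.one_sub_inv_le_log_of_pos h
  have h2 : 1 - (1 + x)⁻¹ = x / (1 + x) := by field_simp; ring
  rw [entropyFn]; linarith

lemma entropyFn_le_sq {x : ℝ} (hx : 0 ≤ x) : entropyFn x ≤ x ^ 2 := by
  have h : 0 < 1 + x := by positivity
  have h1 := Real.log_le_sub_one_of_pos h
  have h2 : x - x ^ 2 ≤ x / (1 + x) := by
    rw [le_div_iff₀ h]
    nlinarith [pow_nonneg hx 3]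
  rw [entropyFn]; linarith

/-- Write `log (1 + x) = log 2 + log ((1 + x)/2)` and use `log z ≥ 1 - 1/z`; what remains is `log 2
- 1/2 > 1/8`. -/
lemma le_entropyFn {x : ℝ} (hx : 1 ≤ x) : 1 / 8 ≤ entropyFn x := by
  have h : 0 < 1 + x := by positivity
  have h1 := Real.one_sub_inv_le_log_of_pos (show 0 < (1 + x) / 2 by positivity)
  rw [Real.log_div h.ne' two_ne_zero] at h1
  have h2 := Real.log_two_gt_d9
  have h3 : x / (1 + x) - 1 / 2 ≤ 1 - ((1 + x) / 2)⁻¹ := by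
    have h4 : 1 - ((1 + x) / 2)⁻¹ - (x / (1 + x) - 1 / 2) = (x - 1) / (2 * (1 + x)) := by
      field_simp; ring
    have h5 : 0 ≤ (x - 1) / (2 * (1 + x)) := div_nonneg (by linarith) (by positivity)
    linarith
  rw [entropyFn]; linarith

/-- Apply `log z ≤ z - 1` to `z = (1 + x)^q` and use subadditivity of the power. A small `q` makes
the entropy at a large `α` a small power of `t`. -/
lemma entropyFn_le_rpow {x q : ℝ} (hx : 0 ≤ x) (hq : 0 < q) (hq1 : q ≤ 1) :
    entropyFn x ≤ x ^ q / q := by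
  have h : 0 < 1 + x := by positivity
  have h1 : Real.log (1 + x) = Real.log ((1 + x) ^ q) / q := by
    rw [Real.log_rpow h]; field_simp
  have h2 : (1 + x) ^ q ≤ 1 + x ^ q := by
    have := Real.rpow_add_le_add_rpow zero_le_one hx hq.le hq1
    rwa [Real.one_rpow] at this
  have h3 : Real.log ((1 + x) ^ q) ≤ x ^ q := by
    have := Real.log_le_sub_one_of_pos (Real.rpow_pos_of_pos h q)
    linarith
  have h4 : 0 ≤ x / (1 + x) := by positivity
  rw [entropyFn, h1]
  have := div_le_div_of_nonneg_right h3 hq.le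
  linarith

/-! ### Expansion of the truncated log-marginal likelihood. -/

lemma integral_likTrunc {σ n : ℝ} {m : ℕ} {t : ℝ} (ht : t = n / (σ ^ 2 * m)) (ht0 : 0 ≤ t)
    (N : ℕ) (y : ℕ → ℝ) (α : ℝ) :
    ∫ θ, likTrunc σ n m N y θ ∂(priorSeq α) =
      ∏ i ∈ Finset.range N, tiltMass t (t * y i) (priorVar α i) := by
  have hm : Measurable fun θ => likTrunc σ n m N y θ := by
    simp_rw [likTrunc_eq]; fun_prop
  rw [integral_eq_lintegral_of_nonneg_ae
    (Eventually.of_forall fun θ => likTrunc_nonneg _ _ _ _ _ _) hm.aestronglyMeasurable]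
  simp_rw [likTrunc_eq, ← ht, ENNReal.ofReal_prod_of_nonneg fun _ _ => (Real.exp_pos _).le]
  rw [priorSeq, lintegral_infinitePi_prod _ _
    (g := fun i x => ENNReal.ofReal (Real.exp (t * y i * x - t * x ^ 2 / 2)))
    (fun i => by fun_prop)]
  rw [ENNReal.toReal_prod]
  refine Finset.prod_congr rfl fun i _ => ?_
  have := lintegral_tilt (b := t * y i) ht0 (priorVar_pos α i)
  rw [priorVar] at this
  rw [this]
  exact ENNReal.toReal_ofReal (tiltMass_pos ht0 (priorVar_pos α i)).le

/-- With `x = t * priorVar α i`, the term `-log (1 + x) + x/(1 + x) · t y²` is recentred at `t y² -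
1`, which has mean zero under pure noise. The two resulting series converge separately, even at `α =
0`, where the prior variances are not summable. -/
lemma log_integral_likTrunc {σ n : ℝ} {m : ℕ} {t : ℝ} (ht : t = n / (σ ^ 2 * m)) (ht0 : 0 ≤ t)
    (N : ℕ) (y : ℕ → ℝ) (α : ℝ) :
    Real.log (∫ θ, likTrunc σ n m N y θ ∂(priorSeq α)) =
      (1 / 2) * (-∑ i ∈ Finset.range N, entropyFn (t * priorVar α i) +
        ∑ i ∈ Finset.range N, weight t (1 + 2 * α) i * (t * y i ^ 2 - 1)) := by
  rw [integral_likTrunc ht ht0,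
    Real.log_prod fun i _ => (tiltMass_pos ht0 (priorVar_pos α i)).ne',
    ← Finset.sum_neg_distrib, ← Finset.sum_add_distrib, Finset.mul_sum]
  refine Finset.sum_congr rfl fun i _ => ?_
  have hl := priorVar_pos α i
  rw [log_tiltMass ht0 hl, entropyFn]
  have hw : weight t (1 + 2 * α) i = t * priorVar α i / (1 + t * priorVar α i) := by
    have hf : priorVar α i = (freq i ^ (1 + 2 * α))⁻¹ := by
      rw [priorVar, ← Real.rpow_neg (freq_pos i).le]; ring_nf
    have := Real.rpow_pos_of_pos (freq_pos i) (1 + 2 * α)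
    rw [hf, weight]; field_simp
  have h1 : 0 < 1 + t * priorVar α i := by positivity
  rw [hw]
  field_simp
  ring

/-! ### Summation by parts against the shrinkage weights. -/

lemma weight_pos {t p : ℝ} (ht : 0 < t) (i : ℕ) : 0 < weight t p i := by
  have := Real.rpow_pos_of_pos (freq_pos i) p
  unfold weight; positivity

lemma freq_succ (i : ℕ) : freq (i + 1) = freq i + 1 := by simp [freq]

lemma weight_sub_nonneg {t p : ℝ} (ht : 0 < t) (hp : 1 ≤ p) (i : ℕ) :
    0 ≤ weight t p i - weight t p (i + 1) := by
  have h1 := Real.rpow_pos_of_pos (freq_pos i) p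
  have h2 : freq i ^ p ≤ freq (i + 1) ^ p :=
    Real.rpow_le_rpow (freq_pos i).le (by rw [freq_succ]; linarith) (by linarith)
  unfold weight
  rw [sub_nonneg]
  gcongr

/-- With `A = k^p` and `J = t^(1/p)`, the decrement is at most `(2^p/k) · tA/(A + t)²`. The last
factor is at most 1, which settles `k ≤ J`, and at most `t/A = (J/k)^p`, which settles `k ≥ J`. The
power `t^(1/p)` is the one in the lower bound for `entropySum`. -/
lemma weight_sub_le {t p : ℝ} (ht : 0 < t) (hp : 1 ≤ p) (i : ℕ) :
    weight t p i - weight t p (i + 1) ≤ 2 ^ p * t ^ (1 / p) / freq i ^ 2 := by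
  set k := freq i with hk
  have hk1 : 1 ≤ k := one_le_freq i
  have hk0 : 0 < k := freq_pos i
  set A := k ^ p with hA
  have hA0 : 0 < A := Real.rpow_pos_of_pos hk0 p
  have hp0 : 0 < p := by linarith
  set J := t ^ (1 / p) with hJ
  have hJ0 : 0 < J := Real.rpow_pos_of_pos ht _
  have hJp : J ^ p = t := by rw [hJ, ← Real.rpow_mul ht.le]; field_simp; simp
  have h2p : (0 : ℝ) < 2 ^ p := by positivity
  -- Convexity of `z ↦ z^p` between 1 and 2, at the point `1 + 1/k`.
  have hB1 : (k + 1) ^ p ≤ A + 2 ^ p * A / k := by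
    have ha : 0 ≤ 1 - 1 / k := by rw [sub_nonneg, div_le_one hk0]; exact hk1
    have hb : 0 ≤ 1 / k := by positivity
    have hc := (convexOn_rpow hp).2 (Set.mem_Ici.2 (zero_le_one (α := ℝ)))
      (Set.mem_Ici.2 (zero_le_two (α := ℝ))) ha hb (by ring)
    simp only [smul_eq_mul, Real.one_rpow, mul_one] at hc
    have e1 : k + 1 = k * (1 - 1 / k + 1 / k * 2) := by field_simp; ring
    rw [e1, Real.mul_rpow hk0.le (by rw [show 1 - 1 / k + 1 / k * 2 = 1 + 1 / k by ring]; positivity)]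
    calc k ^ p * (1 - 1 / k + 1 / k * 2) ^ p ≤ k ^ p * (1 - 1 / k + 1 / k * 2 ^ p) := by gcongr
      _ ≤ k ^ p * (1 + 1 / k * 2 ^ p) := by
          gcongr
          linarith [show 0 < 1 / k by positivity]
      _ = _ := by rw [← hA]; ring
  have hAB : A ≤ (k + 1) ^ p := Real.rpow_le_rpow hk0.le (by linarith) hp0.le
  have hkey : t * A / (A + t) ^ 2 ≤ J / k := by
    rcases le_total k J with h | h
    · calc t * A / (A + t) ^ 2 ≤ 1 := by
            rw [div_le_one (by positivity)]; nlinarith [mul_pos ht hA0]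
        _ ≤ J / k := by rwa [one_le_div hk0]
    · have h3 : t / A ≤ J / k := by
        rw [hA, ← hJp, ← Real.div_rpow hJ0.le hk0.le]
        calc (J / k) ^ p ≤ (J / k) ^ (1 : ℝ) :=
              Real.rpow_le_rpow_of_exponent_ge (by positivity) (by rwa [div_le_one hk0]) hp
          _ = J / k := Real.rpow_one _
      refine le_trans ?_ h3
      rw [div_le_div_iff₀ (by positivity) hA0]
      nlinarith [mul_pos ht hA0, mul_pos (mul_pos ht ht) hA0, mul_pos (mul_pos ht ht) ht]
  have e2 : weight t p i - weight t p (i + 1) =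
      t * ((k + 1) ^ p - A) / ((A + t) * ((k + 1) ^ p + t)) := by
    rw [weight, weight, freq_succ, ← hk, ← hA]
    have : 0 < (k + 1) ^ p := by positivity
    field_simp; ring
  rw [e2]
  calc t * ((k + 1) ^ p - A) / ((A + t) * ((k + 1) ^ p + t))
      ≤ t * (2 ^ p * A / k) / ((A + t) * (A + t)) := by
        gcongr
        linarith
    _ = 2 ^ p / k * (t * A / (A + t) ^ 2) := by field_simp
    _ ≤ 2 ^ p / k * (J / k) := by gcongr
    _ = _ := by field_simp

lemma sum_mul_eq_abel (u w : ℕ → ℝ) (N : ℕ) :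
    ∑ i ∈ Finset.range N, u i * w i = u N * ∑ i ∈ Finset.range N, w i +
      ∑ i ∈ Finset.range N, (u i - u (i + 1)) * ∑ j ∈ Finset.range (i + 1), w j := by
  induction N with
  | zero => simp
  | succ N ih =>
    rw [Finset.sum_range_succ, ih,
      Finset.sum_range_succ (fun i => (u i - u (i + 1)) * ∑ j ∈ Finset.range (i + 1), w j),
      Finset.sum_range_succ w N]
    ring

/-- The partial sums of `w` grow slowly enough for summation by parts against the weights. -/
structure SlowSums (w : ℕ → ℝ) : Prop where
  tendsto : Tendsto (fun N : ℕ => (∑ i ∈ Finset.range N, w i) / N) atTop (𝓝 0)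
  summable : Summable fun i => |∑ j ∈ Finset.range (i + 1), w j| / freq i ^ 2

/-- The size of the partial sums of `w`. -/
noncomputable def sumSize (w : ℕ → ℝ) : ℝ :=
  ∑' i, |∑ j ∈ Finset.range (i + 1), w j| / freq i ^ 2

lemma SlowSums.sum {m : ℕ} {w : Fin m → ℕ → ℝ} (h : ∀ j, SlowSums (w j)) :
    SlowSums fun i => ∑ j, w j i := by
  have e : ∀ N, ∑ i ∈ Finset.range N, ∑ j, w j i = ∑ j, ∑ i ∈ Finset.range N, w j i :=
    fun N => Finset.sum_comm
  constructor
  · have h1 := tendsto_finsetSum Finset.univ fun j _ => (h j).tendsto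
    rw [Finset.sum_const_zero] at h1
    refine h1.congr fun N => ?_
    rw [e, Finset.sum_div]
  · simp_rw [e]
    refine (summable_sum (s := Finset.univ) fun j _ => (h j).summable).of_nonneg_of_le
      (fun i => by positivity) fun i => ?_
    rw [← Finset.sum_div]
    gcongr
    exact Finset.abs_sum_le_sum_abs _ _

/-- Abel summation; the boundary term vanishes since the `N`-th weight is at most `t/N`. As `sumSize
w` does not involve `p`, one bound on the data serves all `α` at once. -/
lemma SlowSums.exists_tendsto {w : ℕ → ℝ} (h : SlowSums w) {t p : ℝ} (ht : 0 < t) (hp : 1 ≤ p) :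
    ∃ L, Tendsto (fun N => ∑ i ∈ Finset.range N, weight t p i * w i) atTop (𝓝 L) ∧
      |L| ≤ 2 ^ p * t ^ (1 / p) * sumSize w := by
  set T : ℕ → ℝ := fun N => ∑ i ∈ Finset.range N, w i with hT
  have hle : ∀ i, ‖(weight t p i - weight t p (i + 1)) * T (i + 1)‖ ≤
      2 ^ p * t ^ (1 / p) * (|T (i + 1)| / freq i ^ 2) := by
    intro i
    rw [norm_mul, Real.norm_of_nonneg (weight_sub_nonneg ht hp i), Real.norm_eq_abs]
    calc (weight t p i - weight t p (i + 1)) * |T (i + 1)|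
        ≤ (2 ^ p * t ^ (1 / p) / freq i ^ 2) * |T (i + 1)| := by
          gcongr; exact weight_sub_le ht hp i
      _ = _ := by ring
  have hs2 : Summable fun i => 2 ^ p * t ^ (1 / p) * (|T (i + 1)| / freq i ^ 2) :=
    h.summable.mul_left _
  have hs := Summable.of_norm_bounded hs2 hle
  refine ⟨∑' i, (weight t p i - weight t p (i + 1)) * T (i + 1), ?_, ?_⟩
  · have h0 : Tendsto (fun N => weight t p N * T N) atTop (𝓝 0) := by
      have h1 : Tendsto (fun N : ℕ => t * |T N / N|) atTop (𝓝 0) := by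
        simpa using (h.tendsto.abs).const_mul t
      refine squeeze_zero_norm (fun N => ?_) h1
      rcases Nat.eq_zero_or_pos N with rfl | hN
      · simp [hT]
      have hN' : (0 : ℝ) < N := by exact_mod_cast hN
      rw [norm_mul, Real.norm_of_nonneg (weight_pos ht N).le, Real.norm_eq_abs, abs_div,
        abs_of_pos hN']
      have h2 : weight t p N ≤ t / N := by
        unfold weight
        gcongr
        calc (N : ℝ) ≤ freq N := by simp [freq]
          _ = freq N ^ (1 : ℝ) := (Real.rpow_one _).symm
          _ ≤ freq N ^ p := Real.rpow_le_rpow_of_exponent_le (one_le_freq N) hp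
          _ ≤ _ := by linarith
      calc weight t p N * |T N| ≤ t / N * |T N| := by gcongr
        _ = _ := by ring
    have h3 := h0.add hs.hasSum.tendsto_sum_nat
    rw [zero_add] at h3
    exact h3.congr fun N => (sum_mul_eq_abel _ _ N).symm
  · rw [sumSize, ← tsum_mul_left, ← Real.norm_eq_abs]
    exact tsum_of_norm_bounded hs2.hasSum hle

/-! ### Comparison of the deterministic and the random part. -/

/-- The deterministic part of the log-marginal likelihood. -/
noncomputable def entropySum (t α : ℝ) : ℝ := ∑' i, entropyFn (t * priorVar α i)

lemma summable_entropy {t α : ℝ} (ht : 0 < t) (hα : 0 ≤ α) :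
    Summable fun i => entropyFn (t * priorVar α i) := by
  have hs : Summable fun i => t ^ 2 * freq i ^ (-2 - 4 * α) :=
    (summable_freq_rpow (by linarith)).mul_left _
  refine hs.of_nonneg_of_le (fun i => entropyFn_nonneg ?_) fun i => ?_
  · have := priorVar_pos α i; positivity
  · have := priorVar_pos α i
    refine (entropyFn_le_sq (by positivity)).trans_eq ?_
    rw [mul_pow, priorVar, ← Real.rpow_natCast (freq i ^ _), ← Real.rpow_mul (freq_pos i).le]
    congr 2; push_cast; ring

lemma logMarginal_tendsto {σ n : ℝ} {m : ℕ} {t : ℝ} (ht : t = n / (σ ^ 2 * m)) (ht0 : 0 < t)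
    {α : ℝ} (hα : 0 ≤ α) {y : ℕ → ℝ} (hy : SlowSums fun i => t * y i ^ 2 - 1) :
    ∃ L, Tendsto (fun N => ∑ i ∈ Finset.range N, weight t (1 + 2 * α) i * (t * y i ^ 2 - 1))
      atTop (𝓝 L) ∧ logMarginal σ n m y α = (1 / 2) * (-entropySum t α + L) := by
  obtain ⟨L, hL, -⟩ := hy.exists_tendsto ht0 (p := 1 + 2 * α) (by linarith)
  refine ⟨L, hL, Tendsto.limUnder_eq ?_⟩
  have h1 := (((summable_entropy ht0 hα).hasSum.tendsto_sum_nat).neg.add hL).const_mul (1 / 2)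
  exact h1.congr fun N => (log_integral_likTrunc ht ht0.le N y α).symm

lemma distLogMarginal_eq {σ n : ℝ} {m : ℕ} {t : ℝ} (ht : t = n / (σ ^ 2 * m)) (ht0 : 0 < t)
    {α : ℝ} (hα : 0 ≤ α) {Y : Data m} (hY : ∀ j, SlowSums fun i => t * Y j i ^ 2 - 1) :
    ∃ L, |L| ≤ 2 ^ (1 + 2 * α) * t ^ (1 / (1 + 2 * α)) *
        sumSize (fun i => ∑ j, (t * Y j i ^ 2 - 1)) ∧
      distLogMarginal σ n m Y α = (1 / 2) * (-(m * entropySum t α) + L) := by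
  choose L hL hlog using fun j => logMarginal_tendsto ht ht0 hα (hY j)
  obtain ⟨L', hL', hbound⟩ := (SlowSums.sum hY).exists_tendsto ht0 (p := 1 + 2 * α) (by linarith)
  have h1 : L' = ∑ j, L j := by
    refine tendsto_nhds_unique hL' ((tendsto_finsetSum Finset.univ fun j _ => hL j).congr ?_)
    intro N
    rw [Finset.sum_comm]
    simp_rw [Finset.mul_sum]
  refine ⟨L', hbound, ?_⟩
  rw [distLogMarginal]
  simp_rw [hlog]
  rw [← Finset.mul_sum, Finset.sum_add_distrib, h1]
  simp

/-- At frequencies up to `J = t^(1/(1+2α))` the argument of `entropyFn` is at least 1, so each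
contributes at least 1/8; and `⌊J⌋ ≥ J/2`. -/
lemma le_entropySum {t α : ℝ} (ht : 1 ≤ t) (hα : 0 ≤ α) :
    t ^ (1 / (1 + 2 * α)) / 16 ≤ entropySum t α := by
  set J := t ^ (1 / (1 + 2 * α)) with hJ
  have hp : 0 < 1 + 2 * α := by positivity
  have hJ1 : 1 ≤ J := Real.one_le_rpow ht (by positivity)
  have hJp : J ^ (1 + 2 * α) = t := by
    rw [hJ, ← Real.rpow_mul (by linarith)]; field_simp; simp
  have h1 : ∑ i ∈ Finset.range ⌊J⌋₊, entropyFn (t * priorVar α i) ≤ entropySum t α :=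
    (summable_entropy (by linarith) hα).sum_le_tsum _ fun i _ =>
      entropyFn_nonneg (by have := priorVar_pos α i; positivity)
  refine le_trans ?_ h1
  calc J / 16 ≤ ∑ i ∈ Finset.range ⌊J⌋₊, (1 / 8 : ℝ) := by
        rw [Finset.sum_const, Finset.card_range, nsmul_eq_mul]
        have h2 := Nat.lt_floor_add_one J
        have h3 : (1 : ℝ) ≤ ⌊J⌋₊ := by exact_mod_cast Nat.one_le_floor_iff J |>.2 hJ1
        linarith
    _ ≤ _ := by
        refine Finset.sum_le_sum fun i hi => le_entropyFn ?_
        have h4 : freq i ≤ J := by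
          have h5 : i + 1 ≤ ⌊J⌋₊ := Finset.mem_range.1 hi
          have h6 : ((i + 1 : ℕ) : ℝ) ≤ J := (Nat.cast_le.2 h5).trans (Nat.floor_le (by linarith))
          simpa [freq] using h6
        have h7 : freq i ^ (1 + 2 * α) ≤ t := by
          rw [← hJp]; exact Real.rpow_le_rpow (freq_pos i).le h4 hp.le
        rw [priorVar, show -1 - 2 * α = -(1 + 2 * α) by ring, Real.rpow_neg (freq_pos i).le,
          ← div_eq_mul_inv, one_le_div (Real.rpow_pos_of_pos (freq_pos i) _)]
        exact h7

/-- Here `1 + 2α = 4P`, and the exponent `q = 1/(2P)` turns `t k^(-4P)` into `t^(1/(2P)) k^(-2)`: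
summable, and of lower order than `t^(1/P)`. -/
lemma entropySum_le {t P : ℝ} (ht : 0 < t) (hP : 1 ≤ P) :
    entropySum t ((4 * P - 1) / 2) ≤ 2 * P * t ^ (1 / (2 * P)) * ∑' i, freq i ^ (-2 : ℝ) := by
  have hs : Summable fun i => 2 * P * t ^ (1 / (2 * P)) * freq i ^ (-2 : ℝ) :=
    (summable_freq_rpow (by norm_num)).mul_left _
  rw [entropySum, ← tsum_mul_left]
  refine Summable.tsum_le_tsum (fun i => ?_) (summable_entropy ht (by linarith)) hs
  have := priorVar_pos ((4 * P - 1) / 2) i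
  refine (entropyFn_le_rpow (q := 1 / (2 * P)) (by positivity) (by positivity) ?_).trans_eq ?_
  · rw [div_le_one (by positivity)]; linarith
  · rw [Real.mul_rpow ht.le this.le, priorVar, ← Real.rpow_mul (freq_pos i).le]
    rw [show (-1 - 2 * ((4 * P - 1) / 2)) * (1 / (2 * P)) = -2 by field_simp; ring]
    field_simp

/-- If the maximizer of the log-marginal likelihood is bounded, then the data are atypical. -/
lemma le_sumSize_of_le_distLogMarginal {P : ℝ} (hP : 1 ≤ P) : ∃ t₀ : ℝ, 1 ≤ t₀ ∧
    ∀ {σ n : ℝ} {m : ℕ} {t : ℝ}, t = n / (σ ^ 2 * m) → t₀ ≤ t → ∀ {Y : Data m},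
      (∀ j, SlowSums fun i => t * Y j i ^ 2 - 1) → ∀ {α : ℝ}, 0 ≤ α → 1 + 2 * α ≤ P →
      distLogMarginal σ n m Y ((4 * P - 1) / 2) ≤ distLogMarginal σ n m Y α →
      m / (64 * 2 ^ (4 * P)) ≤ sumSize fun i => ∑ j, (t * Y j i ^ 2 - 1) := by
  set S := ∑' i, freq i ^ (-2 : ℝ) with hS
  have hS0 : 0 ≤ S := tsum_nonneg fun i => (Real.rpow_pos_of_pos (freq_pos i) _).le
  -- Beyond this threshold `g = t^(1/(2P)) ≥ 1 + 64PS`, so the entropy at the comparison point, at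
  -- most `2PgS`, is below `g²/32 ≤ J/32`. This is half of the lower bound `J/16` at `α`, and the
  -- fluctuations have to make up for the other half.
  refine ⟨(1 + 64 * P * S) ^ (2 * P), Real.one_le_rpow (by
    have : 0 ≤ 64 * P * S := by positivity
    linarith) (by positivity), ?_⟩
  intro σ n m t ht hle Y hY α hα hαP hmax
  have hb : 1 ≤ 1 + 64 * P * S := by
    have : 0 ≤ 64 * P * S := by positivity
    linarith
  have ht1 : 1 ≤ t := (Real.one_le_rpow hb (by positivity)).trans hle
  have ht0 : 0 < t := by linarith
  obtain ⟨L₁, hL₁, e₁⟩ := distLogMarginal_eq ht ht0 hα hY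
  obtain ⟨L₂, hL₂, e₂⟩ := distLogMarginal_eq ht ht0 (α := (4 * P - 1) / 2) (by linarith) hY
  set R := sumSize fun i => ∑ j, (t * Y j i ^ 2 - 1) with hR
  have hR0 : 0 ≤ R := tsum_nonneg fun i => by positivity
  rw [show 1 + 2 * ((4 * P - 1) / 2) = 4 * P by ring] at hL₂
  set J := t ^ (1 / (1 + 2 * α)) with hJ
  set g := t ^ (1 / (2 * P)) with hg
  have hg0 : 0 < g := Real.rpow_pos_of_pos ht0 _
  have hgb : 1 + 64 * P * S ≤ g := by
    calc 1 + 64 * P * S = ((1 + 64 * P * S) ^ (2 * P)) ^ (1 / (2 * P)) := by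
          rw [← Real.rpow_mul (by linarith)]; field_simp; simp
      _ ≤ g := Real.rpow_le_rpow (by positivity) hle (by positivity)
  have hJg : g ^ 2 ≤ J := by
    rw [hg, ← Real.rpow_natCast, ← Real.rpow_mul ht0.le]
    refine Real.rpow_le_rpow_of_exponent_le ht1 ?_
    have : 1 / (2 * P) * ((2 : ℕ) : ℝ) = 1 / P := by push_cast; field_simp
    rw [this]
    gcongr
  have hJ0 : 0 < J := Real.rpow_pos_of_pos ht0 _
  have hJ2 : t ^ (1 / (4 * P)) ≤ J := by
    refine Real.rpow_le_rpow_of_exponent_le ht1 ?_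
    gcongr
    linarith
  have hL₁' : |L₁| ≤ 2 ^ (4 * P) * J * R := by
    refine hL₁.trans ?_
    gcongr
    · norm_num
    · linarith
  have hL₂' : |L₂| ≤ 2 ^ (4 * P) * J * R := by
    refine hL₂.trans ?_
    gcongr
  have h1 := le_entropySum ht1 hα
  have h2 := entropySum_le ht0 hP
  rw [← hJ] at h1
  rw [← hg, ← hS] at h2
  rw [e₁, e₂] at hmax
  have h3 := abs_le.1 hL₁'
  have h4 := abs_le.1 hL₂'
  have h5 : (m : ℝ) * entropySum t α ≤
      m * entropySum t ((4 * P - 1) / 2) + 2 * (2 ^ (4 * P) * J * R) := by linarith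
  have hm0 : (0 : ℝ) ≤ m := by positivity
  have h6 : 2 * P * g * S ≤ J / 32 := by
    nlinarith [mul_le_mul_of_nonneg_left hgb hg0.le]
  have h7 : (m : ℝ) * (J / 16) ≤ m * (J / 32) + 2 * (2 ^ (4 * P) * J * R) := by
    calc (m : ℝ) * (J / 16) ≤ m * entropySum t α := by gcongr
      _ ≤ m * entropySum t ((4 * P - 1) / 2) + 2 * (2 ^ (4 * P) * J * R) := h5
      _ ≤ _ := by gcongr; exact h2.trans h6
  have h8 : (m : ℝ) * J ≤ 64 * 2 ^ (4 * P) * R * J := by linarith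
  have h9 : (m : ℝ) ≤ 64 * 2 ^ (4 * P) * R := le_of_mul_le_mul_right h8 hJ0
  rw [div_le_iff₀ (by positivity)]
  linarith

/-! ### Moments of the data -/

/-- Twice the variance of a chi-squared random variable with one degree of freedom. -/
noncomputable def chiConst : ℝ := 2 * ∫ z, (z ^ 2 - 1) ^ 2 ∂(gaussianReal 0 1)

lemma chiConst_nonneg : 0 ≤ chiConst :=
  mul_nonneg zero_le_two (integral_nonneg fun _ => sq_nonneg _)

lemma memLp_sq_gaussianReal (μ : ℝ) (v : ℝ≥0) :
    MemLp (fun z : ℝ => z ^ 2) 2 (gaussianReal μ v) := by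
  rw [memLp_two_iff_integrable_sq (by fun_prop)]
  have h := (memLp_id_gaussianReal (μ := μ) (v := v) 4).integrable_norm_pow (p := 4) (by norm_num)
  refine h.congr (Eventually.of_forall fun z => ?_)
  have h2 : |z| ^ 4 = (|z| ^ 2) ^ 2 := by ring
  simp only [id_eq, Real.norm_eq_abs, h2, sq_abs]

lemma memLp_mul_sq_sub_one (t μ : ℝ) (v : ℝ≥0) :
    MemLp (fun z : ℝ => t * z ^ 2 - 1) 2 (gaussianReal μ v) :=
  ((memLp_sq_gaussianReal μ v).const_mul t).sub (memLp_const 1)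

lemma integral_sq_gaussianReal (μ : ℝ) (v : ℝ≥0) :
    ∫ x, x ^ 2 ∂(gaussianReal μ v) = μ ^ 2 + v := by
  rw [integral_eq_lintegral_of_nonneg_ae (Eventually.of_forall fun x => sq_nonneg x)
    (by fun_prop), lintegral_sq_gaussianReal, ENNReal.toReal_ofReal (by positivity)]

lemma integral_mul_sq_sub_one {t : ℝ} (ht : 0 < t) (b : ℝ) :
    ∫ x, (t * x ^ 2 - 1) ∂(gaussianReal b t⁻¹.toNNReal) = t * b ^ 2 := by
  have hi : Integrable (fun x : ℝ => x ^ 2) (gaussianReal b t⁻¹.toNNReal) :=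
    (memLp_sq_gaussianReal _ _).integrable (by norm_num)
  rw [integral_sub (hi.const_mul t) (integrable_const _), integral_const_mul,
    integral_sq_gaussianReal, Real.coe_toNNReal _ (by positivity)]
  simp only [integral_const, probReal_univ, smul_eq_mul, mul_one]
  field_simp
  ring

lemma gaussianReal_eq_map {t : ℝ} (ht : 0 < t) (b : ℝ) :
    gaussianReal b t⁻¹.toNNReal = (gaussianReal 0 1).map fun z => b + (√t)⁻¹ * z := by
  have h1 : (fun z : ℝ => b + (√t)⁻¹ * z) = (fun z => b + z) ∘ fun z => (√t)⁻¹ * z := rfl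
  rw [h1, ← Measure.map_map (by fun_prop) (by fun_prop), gaussianReal_map_const_mul,
    gaussianReal_map_const_add]
  congr 1
  · simp
  · ext
    simp only [mul_one, NNReal.coe_mk]
    rw [Real.coe_toNNReal _ (by positivity), inv_pow, Real.sq_sqrt ht.le]

/-- For `x = b + z/√t` the centred variable is `2√t b z + (z² - 1)`; then `(u + v)² ≤ 2u² + 2v²`,
whose factor 2 is absorbed in `chiConst`. -/
lemma variance_mul_sq_sub_one_le {t : ℝ} (ht : 0 < t) (b : ℝ) :
    Var[fun x => t * x ^ 2 - 1; gaussianReal b t⁻¹.toNNReal] ≤ chiConst + 8 * (t * b ^ 2) := by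
  rw [variance_eq_integral (by fun_prop), integral_mul_sq_sub_one ht, gaussianReal_eq_map ht,
    integral_map (by fun_prop) (by fun_prop)]
  have hs : √t ≠ 0 := by positivity
  have hst : √t ^ 2 = t := Real.sq_sqrt ht.le
  have h1 : MemLp (fun z : ℝ => z ^ 2 - 1) 2 (gaussianReal 0 1) := by
    simpa using memLp_mul_sq_sub_one 1 0 1
  have h2 : Integrable (fun z : ℝ => (z ^ 2 - 1) ^ 2) (gaussianReal 0 1) := h1.integrable_sq
  have h3 : Integrable (fun z : ℝ => z ^ 2) (gaussianReal 0 1) :=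
    (memLp_sq_gaussianReal _ _).integrable (by norm_num)
  have hle : ∀ z : ℝ, (t * (b + (√t)⁻¹ * z) ^ 2 - 1 - t * b ^ 2) ^ 2 ≤
      8 * (t * b ^ 2) * z ^ 2 + 2 * (z ^ 2 - 1) ^ 2 := by
    intro z
    have e : t * (b + (√t)⁻¹ * z) ^ 2 - 1 - t * b ^ 2 = 2 * √t * b * z + (z ^ 2 - 1) := by
      have e1 : t * (√t)⁻¹ = √t := by rw [← div_eq_mul_inv, Real.div_sqrt]
      have e2 : √t * (√t)⁻¹ = 1 := mul_inv_cancel₀ hs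
      linear_combination (2 * b * z + (√t)⁻¹ * z ^ 2) * e1 + z ^ 2 * e2
    have e3 : (2 * √t * b * z) ^ 2 = 4 * (t * b ^ 2) * z ^ 2 := by
      linear_combination 4 * b ^ 2 * z ^ 2 * hst
    rw [e]
    nlinarith [sq_nonneg (2 * √t * b * z - (z ^ 2 - 1)), e3]
  calc ∫ z, (t * (b + (√t)⁻¹ * z) ^ 2 - 1 - t * b ^ 2) ^ 2 ∂(gaussianReal 0 1)
      ≤ ∫ z, (8 * (t * b ^ 2) * z ^ 2 + 2 * (z ^ 2 - 1) ^ 2) ∂(gaussianReal 0 1) := by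
        refine integral_mono_of_nonneg (Eventually.of_forall fun z => sq_nonneg _)
          ((h3.const_mul _).add (h2.const_mul 2)) (Eventually.of_forall hle)
    _ = chiConst + 8 * (t * b ^ 2) := by
        rw [integral_add (h3.const_mul _) (h2.const_mul 2), integral_const_mul, integral_const_mul,
          integral_sq_gaussianReal, chiConst]
        simp; ring

/-- The law of the data of one observer, at noise precision `t`. -/
noncomputable def seqLaw (t : ℝ) (θ : ℕ → ℝ) : Measure (ℕ → ℝ) :=
  Measure.infinitePi fun i => gaussianReal (θ i) t⁻¹.toNNReal

instance (t : ℝ) (θ : ℕ → ℝ) : IsProbabilityMeasure (seqLaw t θ) := by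
  unfold seqLaw; infer_instance

lemma localLaw_eq (σ n : ℝ) (m : ℕ) (θ : Ell2) :
    localLaw σ n m θ = seqLaw (n / (σ ^ 2 * m)) (coords θ) := by
  rw [localLaw, seqLaw, inv_div]

lemma dataLaw_eq (σ n : ℝ) (m : ℕ) (θ : Ell2) :
    dataLaw σ n m θ = Measure.pi fun _ : Fin m => seqLaw (n / (σ ^ 2 * m)) (coords θ) := by
  rw [dataLaw, localLaw_eq]

lemma measurePreserving_eval_seqLaw (t : ℝ) (θ : ℕ → ℝ) (i : ℕ) :
    MeasurePreserving (fun y : ℕ → ℝ => y i) (seqLaw t θ) (gaussianReal (θ i) t⁻¹.toNNReal) :=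
  measurePreserving_eval_infinitePi (fun i => gaussianReal (θ i) t⁻¹.toNNReal) i

/-- The partial sums of the normalized squared observations. -/
noncomputable def chiSum (t : ℝ) (k : ℕ) (y : ℕ → ℝ) : ℝ :=
  ∑ i ∈ Finset.range k, (t * y i ^ 2 - 1)

lemma measurable_chiSum (t : ℝ) (k : ℕ) : Measurable (chiSum t k) := by
  unfold chiSum; fun_prop

section
variable {t : ℝ} {θ : ℕ → ℝ}

lemma memLp_coord (i : ℕ) : MemLp (fun y : ℕ → ℝ => t * y i ^ 2 - 1) 2 (seqLaw t θ) :=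
  (memLp_mul_sq_sub_one t (θ i) t⁻¹.toNNReal).comp_measurePreserving
    (measurePreserving_eval_seqLaw t θ i)

lemma memLp_chiSum (k : ℕ) : MemLp (chiSum t k) 2 (seqLaw t θ) :=
  memLp_finsetSum _ fun i _ => memLp_coord i

lemma integral_chiSum (ht : 0 < t) (k : ℕ) :
    ∫ y, chiSum t k y ∂(seqLaw t θ) = t * ∑ i ∈ Finset.range k, θ i ^ 2 := by
  unfold chiSum
  rw [integral_finsetSum _ fun i _ => (memLp_coord i).integrable (by norm_num), Finset.mul_sum]
  refine Finset.sum_congr rfl fun i _ => ?_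
  rw [← integral_mul_sq_sub_one ht (θ i), ← (measurePreserving_eval_seqLaw t θ i).map_eq,
    integral_map (measurable_pi_apply i).aemeasurable (by fun_prop)]

lemma variance_chiSum_le (ht : 0 < t) (k : ℕ) :
    Var[chiSum t k; seqLaw t θ] ≤ k * chiConst + 8 * (t * ∑ i ∈ Finset.range k, θ i ^ 2) := by
  have e : chiSum t k = ∑ i ∈ Finset.range k, fun y : ℕ → ℝ => t * y i ^ 2 - 1 := by
    ext y; simp [chiSum]
  have hI : iIndepFun (fun i (y : ℕ → ℝ) => t * y i ^ 2 - 1) (seqLaw t θ) :=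
    iIndepFun_infinitePi (X := fun _ x => t * x ^ 2 - 1) fun _ => by fun_prop
  rw [e, IndepFun.variance_sum (fun i _ => memLp_coord i) fun i _ j _ hij => hI.indepFun hij]
  have h1 : ∀ i, Var[fun y : ℕ → ℝ => t * y i ^ 2 - 1; seqLaw t θ] ≤
      chiConst + 8 * (t * θ i ^ 2) := by
    intro i
    rw [(measurePreserving_eval_seqLaw t θ i).variance_fun_comp
      (f := fun x => t * x ^ 2 - 1) (by fun_prop)]
    exact variance_mul_sq_sub_one_le ht _
  refine (Finset.sum_le_sum fun i _ => h1 i).trans_eq ?_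
  rw [Finset.sum_add_distrib, Finset.sum_const, Finset.card_range, nsmul_eq_mul, Finset.mul_sum,
    Finset.mul_sum]

lemma integral_abs_le {Ω : Type*} {mΩ : MeasurableSpace Ω} {μ : Measure Ω}
    [IsProbabilityMeasure μ] {X : Ω → ℝ} (hX : MemLp X 2 μ) :
    ∫ x, |X x| ∂μ ≤ |∫ x, X x ∂μ| + √(Var[X; μ]) := by
  have h1 : ∫ x, |X x| ∂μ ≤ √(∫ x, X x ^ 2 ∂μ) := by
    refine Real.le_sqrt_of_sq_le ?_
    have h2 := variance_nonneg (fun x => |X x|) μ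
    have h3 : MemLp (fun x => |X x|) 2 μ := hX.abs
    rw [variance_eq_sub h3] at h2
    simpa using h2
  refine h1.trans ?_
  have h3 := variance_eq_sub hX
  have h4 : ∫ x, X x ^ 2 ∂μ = |∫ x, X x ∂μ| ^ 2 + Var[X; μ] := by
    rw [h3, sq_abs]; simp
  rw [h4]
  refine Real.sqrt_le_iff.2 ⟨by positivity, ?_⟩
  nlinarith [Real.sq_sqrt (variance_nonneg X μ), abs_nonneg (∫ x, X x ∂μ),
    Real.sqrt_nonneg (Var[X; μ]), mul_nonneg (abs_nonneg (∫ x, X x ∂μ))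
      (Real.sqrt_nonneg (Var[X; μ]))]

/-- The first absolute moment of the partial sums of all the observers. -/
lemma integral_abs_sum_chiSum_le (ht : 0 < t) (m k : ℕ) :
    ∫ Y, |∑ j, chiSum t k (Y j)| ∂(Measure.pi fun _ : Fin m => seqLaw t θ) ≤
      m * (t * ∑ i ∈ Finset.range k, θ i ^ 2) +
        √(m * (k * chiConst + 8 * (t * ∑ i ∈ Finset.range k, θ i ^ 2))) := by
  have hL : ∀ j : Fin m, MemLp (fun Y : Data m => chiSum t k (Y j)) 2
      (Measure.pi fun _ : Fin m => seqLaw t θ) := fun j =>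
    (memLp_chiSum k).comp_measurePreserving (measurePreserving_eval _ j)
  have hX : MemLp (fun Y : Data m => ∑ j, chiSum t k (Y j)) 2
      (Measure.pi fun _ : Fin m => seqLaw t θ) := memLp_finsetSum _ fun j _ => hL j
  refine (integral_abs_le hX).trans ?_
  have hA : 0 ≤ ∑ i ∈ Finset.range k, θ i ^ 2 := Finset.sum_nonneg fun _ _ => sq_nonneg _
  have h1 : ∫ Y, ∑ j, chiSum t k (Y j) ∂(Measure.pi fun _ : Fin m => seqLaw t θ) =
      m * (t * ∑ i ∈ Finset.range k, θ i ^ 2) := by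
    rw [integral_finsetSum _ fun j _ => (hL j).integrable (by norm_num)]
    simp_rw [fun j : Fin m => integral_comp_eval (μ := fun _ : Fin m => seqLaw t θ) (i := j)
      (f := chiSum t k) (measurable_chiSum t k).aestronglyMeasurable, integral_chiSum ht]
    simp
  have h2 : Var[fun Y : Data m => ∑ j, chiSum t k (Y j);
      Measure.pi fun _ : Fin m => seqLaw t θ] = m * Var[chiSum t k; seqLaw t θ] := by
    have := variance_sum_pi (μ := fun _ : Fin m => seqLaw t θ) (X := fun _ => chiSum t k)
      fun _ => memLp_chiSum k
    simp only [Finset.sum_const, Finset.card_univ, Fintype.card_fin, nsmul_eq_mul] at this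
    rw [← this]
    congr 1
    ext Y; simp
  rw [h1, h2, abs_of_nonneg (by positivity)]
  gcongr
  exact variance_chiSum_le ht k

/-- An `ℝ≥0∞`-valued version of `sumSize` of all the data. -/
noncomputable def totalSize (t : ℝ) {m : ℕ} (Y : Data m) : ℝ≥0∞ :=
  ∑' i, ENNReal.ofReal (|∑ j, chiSum t (i + 1) (Y j)| / freq i ^ 2)

lemma measurable_totalSize (t : ℝ) (m : ℕ) : Measurable (totalSize t (m := m)) := by
  refine Measurable.tsum fun i => ?_
  have h : ∀ j : Fin m, Measurable fun Y : Data m => chiSum t (i + 1) (Y j) :=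
    fun j => (measurable_chiSum t _).comp (measurable_pi_apply j)
  have h2 : Measurable fun Y : Data m => ∑ j, chiSum t (i + 1) (Y j) :=
    Finset.measurable_sum _ fun j _ => h j
  exact ((h2.abs).div_const _).ennreal_ofReal

lemma ofReal_sumSize_le (t : ℝ) {m : ℕ} (Y : Data m) :
    ENNReal.ofReal (sumSize fun i => ∑ j, (t * Y j i ^ 2 - 1)) ≤ totalSize t Y := by
  have e : ∀ i, ∑ l ∈ Finset.range (i + 1), ∑ j, (t * Y j l ^ 2 - 1) =
      ∑ j, chiSum t (i + 1) (Y j) := fun i => Finset.sum_comm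
  rw [sumSize, totalSize]
  simp_rw [e]
  by_cases hs : Summable fun i => |∑ j, chiSum t (i + 1) (Y j)| / freq i ^ 2
  · rw [ENNReal.ofReal_tsum_of_nonneg (fun i => by positivity) hs]
  · rw [tsum_eq_zero_of_not_summable hs]; simp

/-- The expectation is taken termwise; `freq i` under the root is the number `i + 1` of summands. -/
lemma lintegral_totalSize_le (ht : 0 < t) (m : ℕ) {B : ℕ → ℝ}
    (hB : ∀ i : ℕ, m * (t * ∑ l ∈ Finset.range (i + 1), θ l ^ 2) +
        √(m * (freq i * chiConst + 8 * (t * ∑ l ∈ Finset.range (i + 1), θ l ^ 2))) ≤ B i)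
    (hs : Summable fun i => B i / freq i ^ 2) :
    ∫⁻ Y, totalSize t Y ∂(Measure.pi fun _ : Fin m => seqLaw t θ) ≤
      ENNReal.ofReal (∑' i, B i / freq i ^ 2) := by
  have hm : ∀ i, Measurable fun Y : Data m => ∑ j, chiSum t (i + 1) (Y j) := fun i =>
    Finset.measurable_sum _ fun j _ => (measurable_chiSum t _).comp (measurable_pi_apply j)
  have hB0 : ∀ i, 0 ≤ B i := fun i => by
    refine le_trans ?_ (hB i)
    have : 0 ≤ ∑ l ∈ Finset.range (i + 1), θ l ^ 2 := Finset.sum_nonneg fun _ _ => sq_nonneg _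
    positivity
  unfold totalSize
  rw [lintegral_tsum fun i => (((hm i).abs).div_const _).ennreal_ofReal.aemeasurable,
    ENNReal.ofReal_tsum_of_nonneg (fun i => div_nonneg (hB0 i) (sq_nonneg _)) hs]
  refine ENNReal.tsum_le_tsum fun i => ?_
  have hL : MemLp (fun Y : Data m => ∑ j, chiSum t (i + 1) (Y j)) 2
      (Measure.pi fun _ : Fin m => seqLaw t θ) := memLp_finsetSum _ fun j _ =>
    (memLp_chiSum (i + 1)).comp_measurePreserving (measurePreserving_eval _ j)
  have hi : Integrable (fun Y : Data m => |∑ j, chiSum t (i + 1) (Y j)| / freq i ^ 2)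
      (Measure.pi fun _ : Fin m => seqLaw t θ) := ((hL.integrable (by norm_num)).abs).div_const _
  rw [← ofReal_integral_eq_lintegral_ofReal hi (Eventually.of_forall fun Y => by positivity),
    integral_div]
  refine ENNReal.ofReal_le_ofReal (div_le_div_of_nonneg_right ?_ (sq_nonneg _))
  refine (integral_abs_sum_chiSum_le ht m (i + 1)).trans (le_trans (le_of_eq ?_) (hB i))
  simp [freq]

/-- For a fixed square summable signal the partial sums are `O(√k)` in L¹, summable against
`k^(-2)`. This is the expectation bound for a single observer. -/
lemma ae_summable_chiSum (ht : 0 < t) (hθ : Summable fun i => θ i ^ 2) :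
    ∀ᵐ y ∂(seqLaw t θ), Summable fun i => |chiSum t (i + 1) y| / freq i ^ 2 := by
  set S := ∑' i, θ i ^ 2 with hS
  have hS0 : 0 ≤ S := tsum_nonneg fun _ => sq_nonneg _
  set C := t * S + √(chiConst + 8 * (t * S)) with hC
  have hs : Summable fun i => C * freq i ^ (1 / 2 : ℝ) / freq i ^ 2 := by
    have h1 := (summable_freq_rpow (s := -(3 / 2)) (by norm_num)).mul_left C
    refine h1.congr fun i => ?_
    rw [mul_div_assoc, ← Real.rpow_natCast (freq i) 2, ← Real.rpow_sub (freq_pos i)]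
    norm_num
  have hb := lintegral_totalSize_le (θ := θ) ht 1 (B := fun i => C * freq i ^ (1 / 2 : ℝ))
    (fun i => by
      have hA : ∑ l ∈ Finset.range (i + 1), θ l ^ 2 ≤ S := hθ.sum_le_tsum _ fun _ _ => sq_nonneg _
      have hf := one_le_freq i
      have hf2 : 1 ≤ freq i ^ (1 / 2 : ℝ) := Real.one_le_rpow hf (by norm_num)
      have hc := chiConst_nonneg
      simp only [Nat.cast_one, one_mul]
      calc t * ∑ l ∈ Finset.range (i + 1), θ l ^ 2 +
            √(freq i * chiConst + 8 * (t * ∑ l ∈ Finset.range (i + 1), θ l ^ 2))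
          ≤ t * S * freq i ^ (1 / 2 : ℝ) + √((chiConst + 8 * (t * S)) * freq i) := by
            have h1 : t * ∑ l ∈ Finset.range (i + 1), θ l ^ 2 ≤ t * S := by gcongr
            have h2 : 0 ≤ t * S := by positivity
            refine add_le_add ?_ (Real.sqrt_le_sqrt ?_)
            · nlinarith
            · nlinarith
        _ = _ := by
            rw [Real.sqrt_mul (by positivity), hC, Real.sqrt_eq_rpow (freq i)]; ring) hs
  have hfin := ae_lt_top (measurable_totalSize t 1) (ne_top_of_le_ne_top ENNReal.ofReal_ne_top hb)
  have hp := (measurePreserving_funUnique (seqLaw t θ) (Fin 1)).symm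
  have h3 := hp.quasiMeasurePreserving.ae hfin
  filter_upwards [h3] with y hy
  have h4 := ENNReal.summable_toReal hy.ne
  refine h4.congr fun i => ?_
  rw [ENNReal.toReal_ofReal (by positivity)]
  simp [MeasurableEquiv.funUnique]

end

/-! ### Almost sure properties of the data -/

section
variable {t : ℝ} {θ : ℕ → ℝ}

lemma ae_tendsto_noise (ht : 0 < t) :
    ∀ᵐ y ∂(seqLaw t θ), Tendsto
      (fun N : ℕ => (∑ i ∈ Finset.range N, (t * (y i - θ i) ^ 2 - 1)) / (N : ℝ)) atTop (𝓝 0) := by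
  have hlaw : ∀ i, (seqLaw t θ).map (fun y : ℕ → ℝ => t * (y i - θ i) ^ 2 - 1) =
      (gaussianReal 0 t⁻¹.toNNReal).map fun x => t * x ^ 2 - 1 := by
    intro i
    have e : (fun y : ℕ → ℝ => t * (y i - θ i) ^ 2 - 1) =
      (fun x => t * x ^ 2 - 1) ∘ (fun x => x - θ i) ∘ fun y => y i := rfl
    rw [e, ← Measure.map_map (by fun_prop) (by fun_prop),
      ← Measure.map_map (g := fun x => x - θ i) (by fun_prop) (measurable_pi_apply i),
      (measurePreserving_eval_seqLaw t θ i).map_eq, gaussianReal_map_sub_const, sub_self]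
  have hm : ∀ i, Measurable fun y : ℕ → ℝ => t * (y i - θ i) ^ 2 - 1 := fun i => by fun_prop
  have hident : ∀ i, IdentDistrib (fun y : ℕ → ℝ => t * (y i - θ i) ^ 2 - 1)
      (fun y : ℕ → ℝ => t * (y 0 - θ 0) ^ 2 - 1) (seqLaw t θ) (seqLaw t θ) := fun i =>
    ⟨(hm i).aemeasurable, (hm 0).aemeasurable, by rw [hlaw, hlaw]⟩
  have hI : iIndepFun (fun i (y : ℕ → ℝ) => t * (y i - θ i) ^ 2 - 1) (seqLaw t θ) :=
    iIndepFun_infinitePi (X := fun i x => t * (x - θ i) ^ 2 - 1) fun _ => by fun_prop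
  have hint0 : Integrable (fun x : ℝ => t * x ^ 2 - 1) (gaussianReal 0 t⁻¹.toNNReal) :=
    (memLp_mul_sq_sub_one _ _ _).integrable (by norm_num)
  have hmx : Measurable fun x : ℝ => t * x ^ 2 - 1 := by fun_prop
  have hint : Integrable (fun y : ℕ → ℝ => t * (y 0 - θ 0) ^ 2 - 1) (seqLaw t θ) := by
    have h1 : Integrable (fun z : ℝ => z)
        ((seqLaw t θ).map (fun y : ℕ → ℝ => t * (y 0 - θ 0) ^ 2 - 1)) := by
      rw [hlaw, integrable_map_measure (by fun_prop) hmx.aemeasurable]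
      exact hint0
    exact (integrable_map_measure (by fun_prop) (hm 0).aemeasurable).1 h1
  have hmean : ∫ y, (t * (y 0 - θ 0) ^ 2 - 1) ∂(seqLaw t θ) = 0 := by
    have h1 := integral_map (μ := seqLaw t θ) (hm 0).aemeasurable (f := fun z : ℝ => z)
      (by fun_prop)
    rw [← h1, hlaw, integral_map hmx.aemeasurable (by fun_prop), integral_mul_sq_sub_one ht]
    simp
  have h := strong_law_ae_real (μ := seqLaw t θ)
    (fun i (y : ℕ → ℝ) => t * (y i - θ i) ^ 2 - 1) hint (fun i j hij => hI.indepFun hij) hident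
  rwa [hmean] at h

/-- The noise part is `hy`, the signal part is bounded, and the cross term is `o(N)` by the
Cauchy–Schwarz inequality. -/
lemma tendsto_chiSum_div (ht : 0 < t) (hθ : Summable fun i => θ i ^ 2) {y : ℕ → ℝ}
    (hy : Tendsto (fun N : ℕ => (∑ i ∈ Finset.range N, (t * (y i - θ i) ^ 2 - 1)) / (N : ℝ))
      atTop (𝓝 0)) :
    Tendsto (fun N : ℕ => chiSum t N y / N) atTop (𝓝 0) := by
  set S := ∑' i, θ i ^ 2 with hS
  have hS0 : 0 ≤ S := tsum_nonneg fun _ => sq_nonneg _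
  have hA : ∀ N : ℕ, ∑ i ∈ Finset.range N, θ i ^ 2 ≤ S :=
    fun N => hθ.sum_le_tsum _ fun _ _ => sq_nonneg _
  set X : ℕ → ℝ := fun N => (∑ i ∈ Finset.range N, (t * (y i - θ i) ^ 2 - 1)) / N with hX
  have hsq : ∀ N : ℕ, 0 < N → ∑ i ∈ Finset.range N, (y i - θ i) ^ 2 = N * (X N + 1) / t := by
    intro N hN
    have hN' : (N : ℝ) ≠ 0 := by positivity
    have e1 : ∑ i ∈ Finset.range N, (t * (y i - θ i) ^ 2 - 1) =
        t * ∑ i ∈ Finset.range N, (y i - θ i) ^ 2 - N := by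
      rw [Finset.sum_sub_distrib, ← Finset.mul_sum]; simp
    simp only [hX]
    rw [e1]; field_simp; ring
  have hinv : Tendsto (fun N : ℕ => 1 / (N : ℝ)) atTop (𝓝 0) := tendsto_one_div_atTop_nhds_zero_nat
  have hlim : Tendsto (fun N : ℕ => |X N| + 2 * t * √(S * ((X N + 1) / t) * (1 / N)) +
      t * S * (1 / N)) atTop (𝓝 0) := by
    have h1 : Tendsto (fun N : ℕ => S * ((X N + 1) / t) * (1 / (N : ℝ))) atTop (𝓝 0) := by
      have h2 := (((hy.add_const 1).div_const t).const_mul S).mul hinv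
      simpa using h2
    have h3 := (Real.continuous_sqrt.tendsto 0).comp h1
    rw [Real.sqrt_zero] at h3
    have h4 := (hy.abs.add (h3.const_mul (2 * t))).add (hinv.const_mul (t * S))
    simpa using h4
  refine squeeze_zero_norm' ?_ hlim
  filter_upwards [eventually_gt_atTop 0] with N hN
  have hN' : (0 : ℝ) < N := by exact_mod_cast hN
  have e2 : chiSum t N y = ∑ i ∈ Finset.range N, (t * (y i - θ i) ^ 2 - 1) +
      2 * t * ∑ i ∈ Finset.range N, θ i * (y i - θ i) + t * ∑ i ∈ Finset.range N, θ i ^ 2 := by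
    rw [chiSum, Finset.mul_sum, Finset.mul_sum, ← Finset.sum_add_distrib, ← Finset.sum_add_distrib]
    exact Finset.sum_congr rfl fun i _ => by ring
  have hcs : |∑ i ∈ Finset.range N, θ i * (y i - θ i)| / N ≤
      √(S * ((X N + 1) / t) * (1 / N)) := by
    refine Real.le_sqrt_of_sq_le ?_
    rw [div_pow, sq_abs, div_le_iff₀ (by positivity)]
    refine (Finset.sum_mul_sq_le_sq_mul_sq _ _ _).trans ?_
    have h5 : S * ((X N + 1) / t) * (1 / N) * (N : ℝ) ^ 2 =
        S * ∑ i ∈ Finset.range N, (y i - θ i) ^ 2 := by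
      rw [hsq N hN]; field_simp
    rw [h5]
    exact mul_le_mul_of_nonneg_right (hA N) (Finset.sum_nonneg fun _ _ => sq_nonneg _)
  rw [e2, Real.norm_eq_abs, add_div, add_div]
  refine (abs_add_le _ _).trans (add_le_add ((abs_add_le _ _).trans (add_le_add le_rfl ?_)) ?_)
  · rw [abs_div, abs_mul, abs_of_pos (by positivity : (0 : ℝ) < 2 * t), abs_of_pos hN',
      mul_div_assoc]
    gcongr
  · have h6 : 0 ≤ ∑ i ∈ Finset.range N, θ i ^ 2 := Finset.sum_nonneg fun _ _ => sq_nonneg _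
    rw [abs_of_nonneg (by positivity), div_eq_mul_one_div]
    gcongr
    exact hA N

lemma ae_slowSums (ht : 0 < t) (hθ : Summable fun i => θ i ^ 2) :
    ∀ᵐ y ∂(seqLaw t θ), SlowSums fun i => t * y i ^ 2 - 1 := by
  filter_upwards [ae_tendsto_noise (θ := θ) ht, ae_summable_chiSum ht hθ] with y h1 h2
  exact ⟨tendsto_chiSum_div ht hθ h1, h2⟩

/-- One null set has to serve every `α`, because the estimator depends on the data. The prior
variances decrease in `α`, so the countably many values `1/(q+1)` suffice. -/
lemma ae_summable_priorVar (ht : 0 < t) (hθ : Summable fun i => θ i ^ 2) :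
    ∀ᵐ y ∂(seqLaw t θ), ∀ α : ℝ, 0 < α → Summable fun i => y i ^ 2 * priorVar α i := by
  have h1 : ∀ q : ℕ, ∀ᵐ y ∂(seqLaw t θ),
      Summable fun i => y i ^ 2 * priorVar (1 / ((q : ℝ) + 1)) i := by
    intro q
    set a : ℝ := 1 / ((q : ℝ) + 1) with ha
    have ha0 : 0 < a := by positivity
    have h2 := ae_summable_sq (μ := seqLaw t θ) (X := fun i y => y i * √(priorVar a i))
      (fun i => (measurable_pi_apply i).mul_const _) (by
        have h3 : ∀ i, ∫⁻ y, ENNReal.ofReal ((y i * √(priorVar a i)) ^ 2) ∂(seqLaw t θ) =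
            ENNReal.ofReal ((θ i ^ 2 + t⁻¹) * priorVar a i) := by
          intro i
          have hp := (priorVar_pos a i).le
          have h4 := (measurePreserving_eval_seqLaw t θ i).lintegral_comp
            (f := fun x => ENNReal.ofReal ((x * √(priorVar a i)) ^ 2)) (by fun_prop)
          rw [h4]
          simp_rw [mul_pow, Real.sq_sqrt hp, ENNReal.ofReal_mul (sq_nonneg _)]
          rw [lintegral_mul_const _ (by fun_prop), lintegral_sq_gaussianReal,
            Real.coe_toNNReal _ (by positivity), ENNReal.ofReal_mul (by positivity)]
        simp_rw [h3]
        have hs : Summable fun i => (θ i ^ 2 + t⁻¹) * priorVar a i := by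
          simp_rw [add_mul]
          refine Summable.add (hθ.of_nonneg_of_le (fun i => ?_) fun i => ?_)
            ((summable_priorVar ha0).mul_left _)
          · have := priorVar_pos a i; positivity
          · refine mul_le_of_le_one_right (sq_nonneg _) ?_
            exact Real.rpow_le_one_of_one_le_of_nonpos (one_le_freq i) (by linarith)
        rw [← ENNReal.ofReal_tsum_of_nonneg (fun i => by
          have := priorVar_pos a i; positivity) hs]
        exact ENNReal.ofReal_ne_top)
    filter_upwards [h2] with y hy
    refine hy.congr fun i => ?_
    rw [mul_pow, Real.sq_sqrt (priorVar_pos a i).le]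
  filter_upwards [ae_all_iff.2 h1] with y hy α hα
  obtain ⟨q, hq⟩ := exists_nat_one_div_lt hα
  refine (hy q).of_nonneg_of_le (fun i => ?_) fun i => ?_
  · have := priorVar_pos α i; positivity
  · gcongr
    exact Real.rpow_le_rpow_of_exponent_le (one_le_freq i) (by linarith)

lemma ae_pi_of_ae {m : ℕ} {p : (ℕ → ℝ) → Prop} (h : ∀ᵐ y ∂(seqLaw t θ), p y) :
    ∀ᵐ Y ∂(Measure.pi fun _ : Fin m => seqLaw t θ), ∀ j, p (Y j) :=
  ae_all_iff.2 fun j =>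
    (measurePreserving_eval (fun _ : Fin m => seqLaw t θ) j).quasiMeasurePreserving.ae h

/-- The variance of the averaged observations. -/
lemma lintegral_average_sub_sq {m : ℕ} (hm : 0 < m) (ht : 0 < t) (i : ℕ) :
    ∫⁻ Y, ENNReal.ofReal (((m : ℝ)⁻¹ * ∑ j, Y j i - θ i) ^ 2)
      ∂(Measure.pi fun _ : Fin m => seqLaw t θ) = ENNReal.ofReal (1 / (m * t)) := by
  have hm' : (m : ℝ) ≠ 0 := by positivity
  have hL : MemLp (fun y : ℕ → ℝ => (m : ℝ)⁻¹ * y i) 2 (seqLaw t θ) :=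
    ((memLp_id_gaussianReal (μ := θ i) (v := t⁻¹.toNNReal) 2).comp_measurePreserving
      (measurePreserving_eval_seqLaw t θ i)).const_mul _
  have hLj : ∀ j : Fin m, MemLp (fun Y : Data m => (m : ℝ)⁻¹ * Y j i) 2
      (Measure.pi fun _ : Fin m => seqLaw t θ) := fun j =>
    hL.comp_measurePreserving (measurePreserving_eval _ j)
  have hX : MemLp (fun Y : Data m => ∑ j, (m : ℝ)⁻¹ * Y j i) 2
      (Measure.pi fun _ : Fin m => seqLaw t θ) := memLp_finsetSum _ fun j _ => hLj j
  have hmean1 : ∫ y, (m : ℝ)⁻¹ * y i ∂(seqLaw t θ) = (m : ℝ)⁻¹ * θ i := by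
    rw [integral_const_mul]
    congr 1
    have h1 := integral_map (μ := seqLaw t θ) (measurable_pi_apply i).aemeasurable
      (f := fun z : ℝ => z) (by fun_prop)
    rw [← h1, (measurePreserving_eval_seqLaw t θ i).map_eq, integral_id_gaussianReal]
  have hmean : ∫ Y, ∑ j, (m : ℝ)⁻¹ * Y j i ∂(Measure.pi fun _ : Fin m => seqLaw t θ) = θ i := by
    rw [integral_finsetSum _ fun j _ => (hLj j).integrable (by norm_num)]
    simp_rw [fun j : Fin m => integral_comp_eval (μ := fun _ : Fin m => seqLaw t θ) (i := j)
      (f := fun y => (m : ℝ)⁻¹ * y i) (by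
        exact ((measurable_pi_apply i).const_mul _).aestronglyMeasurable), hmean1]
    simp [hm']
  have hvar : Var[fun Y : Data m => ∑ j, (m : ℝ)⁻¹ * Y j i;
      Measure.pi fun _ : Fin m => seqLaw t θ] = 1 / (m * t) := by
    have h2 := variance_sum_pi (μ := fun _ : Fin m => seqLaw t θ)
      (X := fun _ y => (m : ℝ)⁻¹ * y i) fun _ => hL
    have h3 : Var[fun y : ℕ → ℝ => (m : ℝ)⁻¹ * y i; seqLaw t θ] = (m : ℝ)⁻¹ ^ 2 * t⁻¹ := by
      rw [variance_const_mul, (measurePreserving_eval_seqLaw t θ i).variance_fun_comp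
        (f := fun x => x) (by fun_prop), variance_fun_id_gaussianReal,
        Real.coe_toNNReal _ (by positivity)]
    have e : (fun Y : Data m => ∑ j, (m : ℝ)⁻¹ * Y j i) =
        ∑ j : Fin m, fun Y : Data m => (m : ℝ)⁻¹ * Y j i := by ext Y; simp
    rw [e, h2]
    simp_rw [h3]
    simp only [Finset.sum_const, Finset.card_univ, Fintype.card_fin, nsmul_eq_mul]
    field_simp
  rw [← hvar, variance_eq_integral hX.aemeasurable, hmean]
  have hX2 : MemLp (fun Y : Data m => ∑ j, (m : ℝ)⁻¹ * Y j i - θ i) 2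
      (Measure.pi fun _ : Fin m => seqLaw t θ) := hX.sub (memLp_const _)
  have hi : Integrable (fun Y : Data m => (∑ j, (m : ℝ)⁻¹ * Y j i - θ i) ^ 2)
      (Measure.pi fun _ : Fin m => seqLaw t θ) := hX2.integrable_sq
  rw [ofReal_integral_eq_lintegral_ofReal hi (Eventually.of_forall fun _ => sq_nonneg _)]
  simp_rw [Finset.mul_sum]

end

/-! ### The difficult signals -/

/-- A discrete substitute for comparison with an integral, from `exp z ≥ 1 + z` and `log z ≤ z - 1`;
the factor `2^(1+s)` pays for `k + 1 ≤ 2k`. -/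
lemma rpow_le_sub_rpow {s k : ℝ} (hs : 0 < s) (hk : 1 ≤ k) :
    k ^ (-1 - s) ≤ 2 ^ (1 + s) / s * (k ^ (-s) - (k + 1) ^ (-s)) := by
  have hk0 : 0 < k := by linarith
  have h1 : s / (k + 1) ≤ (k / (k + 1)) ^ (-s) - 1 := by
    have h2 : 0 < k / (k + 1) := by positivity
    have h3 := Real.log_le_sub_one_of_pos h2
    have h4 : k / (k + 1) - 1 = -(1 / (k + 1)) := by field_simp; ring
    rw [Real.rpow_def_of_pos h2]
    have h5 := Real.add_one_le_exp (Real.log (k / (k + 1)) * -s)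
    have h6 : s / (k + 1) ≤ Real.log (k / (k + 1)) * -s := by
      rw [h4] at h3
      have : s / (k + 1) = s * (1 / (k + 1)) := by ring
      nlinarith
    linarith
  have h7 : k ^ (-s) - (k + 1) ^ (-s) = (k + 1) ^ (-s) * ((k / (k + 1)) ^ (-s) - 1) := by
    rw [Real.div_rpow hk0.le (by linarith)]
    have : (k + 1) ^ (-s) ≠ 0 := (Real.rpow_pos_of_pos (by linarith) _).ne'
    field_simp
  have h8 : (2 * k) ^ (-1 - s) ≤ (k + 1) ^ (-1 - s) :=
    Real.rpow_le_rpow_of_nonpos (by linarith) (by linarith) (by linarith)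
  have h9 : (k + 1) ^ (-s) / (k + 1) = (k + 1) ^ (-1 - s) := by
    rw [show (-1 - s : ℝ) = -s - 1 by ring, Real.rpow_sub (by linarith), Real.rpow_one]
  have h10 : (2 : ℝ) ^ (1 + s) * (2 * k) ^ (-1 - s) = k ^ (-1 - s) := by
    rw [Real.mul_rpow (by norm_num) hk0.le, ← mul_assoc, ← Real.rpow_add (by norm_num)]
    norm_num
  calc k ^ (-1 - s) = 2 ^ (1 + s) * (2 * k) ^ (-1 - s) := h10.symm
    _ ≤ 2 ^ (1 + s) * ((k + 1) ^ (-s) / (k + 1)) := by rw [h9]; gcongr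
    _ = 2 ^ (1 + s) / s * ((k + 1) ^ (-s) * (s / (k + 1))) := by field_simp
    _ ≤ _ := by rw [h7]; gcongr

/-- Tails of the sums of powers of the frequencies. -/
lemma sum_tail_le {s K : ℝ} (hs : 0 < s) (hK : 0 < K) (N : ℕ) :
    ∑ i ∈ Finset.range N, (if K ≤ freq i then freq i ^ (-1 - s) else 0) ≤
      2 ^ (1 + s) / s * K ^ (-s) := by
  -- Capping at `K^(-s)` keeps the sequence antitone and bounds its initial value, so the
  -- telescoping needs no index for the cut.
  set φ : ℕ → ℝ := fun i => min (K ^ (-s)) (freq i ^ (-s)) with hφ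
  have h1 : ∀ i, (if K ≤ freq i then freq i ^ (-1 - s) else 0) ≤
      2 ^ (1 + s) / s * (φ i - φ (i + 1)) := by
    intro i
    have hC : 0 ≤ (2 : ℝ) ^ (1 + s) / s := by positivity
    have hmono : freq (i + 1) ^ (-s) ≤ freq i ^ (-s) :=
      Real.rpow_le_rpow_of_nonpos (freq_pos i) (by rw [freq_succ]; linarith) (by linarith)
    split_ifs with h
    · have h2 : freq i ^ (-s) ≤ K ^ (-s) := Real.rpow_le_rpow_of_nonpos hK h (by linarith)
      simp only [hφ]
      rw [min_eq_right h2, min_eq_right (hmono.trans h2), freq_succ]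
      exact rpow_le_sub_rpow hs (one_le_freq i)
    · refine mul_nonneg hC (sub_nonneg.2 ?_)
      exact min_le_min_left _ hmono
  refine (Finset.sum_le_sum fun i _ => h1 i).trans ?_
  rw [← Finset.mul_sum, Finset.sum_range_sub']
  have h3 : 0 ≤ φ N := le_min (by positivity) (Real.rpow_pos_of_pos (freq_pos N) _).le
  have h4 : φ 0 ≤ K ^ (-s) := min_le_left _ _
  gcongr
  linarith

/-- The cut-off frequency of the difficult signals. -/
noncomputable def cutoff (β σ n : ℝ) (m : ℕ) : ℝ :=
  (n / (σ ^ 2 * √(m : ℝ))) ^ (1 / (1 + 2 * β))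

lemma sum_sq_le_of_isDifficult {β M σ n : ℝ} {m : ℕ} {θ₀ : Ell2} (hβ : 0 < β)
    (hθ : IsDifficult β M σ n m θ₀) (hK : 0 < cutoff β σ n m) (k : ℕ) :
    ∑ i ∈ Finset.range k, coords θ₀ i ^ 2 ≤
      M ^ 2 * (2 ^ (1 + 2 * β) / (2 * β)) * cutoff β σ n m ^ (-(2 * β)) := by
  have h := sum_tail_le (s := 2 * β) (by positivity) hK k
  calc ∑ i ∈ Finset.range k, coords θ₀ i ^ 2
      = ∑ i ∈ Finset.range k,
          M ^ 2 * (if cutoff β σ n m ≤ freq i then freq i ^ (-1 - 2 * β) else 0) := by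
        refine Finset.sum_congr rfl fun i _ => ?_
        rw [hθ i, mul_ite, mul_zero]; rfl
    _ ≤ M ^ 2 * (2 ^ (1 + 2 * β) / (2 * β) * cutoff β σ n m ^ (-(2 * β))) := by
        rw [← Finset.mul_sum]; gcongr
    _ = _ := by ring

lemma cutoff_rpow {β σ n t : ℝ} {m : ℕ} (hβ : 0 < β) (hm : 0 < m) (ht : t = n / (σ ^ 2 * m))
    (ht0 : 0 < t) : cutoff β σ n m ^ (1 + 2 * β) = t * √(m : ℝ) := by
  have hm' : (0 : ℝ) < m := by exact_mod_cast hm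
  have hs : √(m : ℝ) * √(m : ℝ) = m := Real.mul_self_sqrt hm'.le
  have hs0 : 0 < √(m : ℝ) := Real.sqrt_pos.2 hm'
  have e : n / (σ ^ 2 * √(m : ℝ)) = t * √(m : ℝ) := by
    rw [ht]
    by_cases hσ : σ = 0
    · simp [hσ]
    · field_simp; rw [sq, hs]
  rw [cutoff, e, ← Real.rpow_mul (by positivity)]
  field_simp
  simp

/-- The balance behind the cut-off: the signal energy, of order `K^(-2β)`, amounts at local
precision to `K/√m` only. -/
lemma cutoff_rpow_neg {β σ n t : ℝ} {m : ℕ} (hβ : 0 < β) (hm : 0 < m) (ht : t = n / (σ ^ 2 * m))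
    (ht0 : 0 < t) (hK : 0 < cutoff β σ n m) :
    t * cutoff β σ n m ^ (-(2 * β)) = cutoff β σ n m / √(m : ℝ) := by
  have hm' : (0 : ℝ) < m := by exact_mod_cast hm
  have hs0 : 0 < √(m : ℝ) := Real.sqrt_pos.2 hm'
  have h1 : cutoff β σ n m ^ (-(2 * β)) = cutoff β σ n m / cutoff β σ n m ^ (1 + 2 * β) := by
    rw [show -(2 * β) = 1 - (1 + 2 * β) by ring, Real.rpow_sub hK, Real.rpow_one]
  rw [h1, cutoff_rpow hβ hm ht ht0]
  field_simp

lemma one_lt_cutoff {β σ n t : ℝ} {m : ℕ} (hβ : 0 < β) (hm : 0 < m) (ht : t = n / (σ ^ 2 * m))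
    (ht1 : 1 < t) : 1 < cutoff β σ n m := by
  have hm' : (1 : ℝ) ≤ m := by exact_mod_cast hm
  have hs : 1 ≤ √(m : ℝ) := Real.one_le_sqrt.2 hm'
  have h := cutoff_rpow hβ hm ht (by linarith)
  by_contra hle
  rw [not_lt] at hle
  have h0 : 0 ≤ cutoff β σ n m := by
    have hs0 : (0 : ℝ) < m := by linarith
    refine Real.rpow_nonneg (div_nonneg ?_ (by positivity)) _
    by_contra hn
    rw [not_le] at hn
    have : t ≤ 0 := by rw [ht]; exact div_nonpos_of_nonpos_of_nonneg hn.le (by positivity)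
    linarith
  have h2 := Real.rpow_le_one h0 hle (show 0 ≤ 1 + 2 * β by positivity)
  nlinarith

/-- The expected size of the sums of the data under a difficult signal. -/
lemma exists_lintegral_totalSize_le {β : ℝ} (hβ : 0 < β) (M : ℝ) : ∃ C : ℝ, 0 ≤ C ∧
    ∀ {σ n t : ℝ} {m : ℕ} {θ₀ : Ell2}, 0 < m → t = n / (σ ^ 2 * m) → 1 < t →
      IsDifficult β M σ n m θ₀ →
      ∫⁻ Y, totalSize t Y ∂(Measure.pi fun _ : Fin m => seqLaw t (coords θ₀)) ≤
        ENNReal.ofReal (C * √(m : ℝ)) := by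
  set D : ℝ := 2 ^ (1 + 2 * β) / (2 * β) with hD
  have hD0 : 0 ≤ D := by positivity
  set S := ∑' i, freq i ^ (-(3 / 2) : ℝ) with hS
  have hS0 : 0 ≤ S := tsum_nonneg fun i => (Real.rpow_pos_of_pos (freq_pos i) _).le
  have hc := chiConst_nonneg
  refine ⟨4 * M ^ 2 * D + √(chiConst + 8 * M ^ 2) * S, by positivity, ?_⟩
  intro σ n t m θ₀ hm ht ht1 hθ
  have ht0 : 0 < t := by linarith
  have hm' : (1 : ℝ) ≤ m := by exact_mod_cast hm
  have hm0 : (0 : ℝ) < m := by linarith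
  set K := cutoff β σ n m with hKdef
  have hK1 : 1 < K := one_lt_cutoff hβ hm ht ht1
  have hK0 : 0 < K := by linarith
  set q := √(m : ℝ) with hq
  have hq1 : 1 ≤ q := Real.one_le_sqrt.2 hm'
  have hqq : q * q = m := Real.mul_self_sqrt hm0.le
  have hKp := cutoff_rpow hβ hm ht ht0
  have hKn := cutoff_rpow_neg hβ hm ht ht0 hK0
  rw [← hKdef, ← hq] at hKp hKn
  have hθi : ∀ i, t * coords θ₀ i ^ 2 ≤ M ^ 2 := by
    intro i
    rw [hθ i]
    split_ifs with h
    · have h1 : freq i ^ (-1 - 2 * β) ≤ K ^ (-1 - 2 * β) :=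
        Real.rpow_le_rpow_of_nonpos hK0 h (by linarith)
      have h2 : t * K ^ (-1 - 2 * β) = 1 / q := by
        rw [show -1 - 2 * β = -(1 + 2 * β) by ring, Real.rpow_neg hK0.le, hKp]; field_simp
      calc t * (M ^ 2 * freq i ^ (-1 - 2 * β)) ≤ t * (M ^ 2 * K ^ (-1 - 2 * β)) := by gcongr
        _ = M ^ 2 * (t * K ^ (-1 - 2 * β)) := by ring
        _ = M ^ 2 * (1 / q) := by rw [h2]
        _ ≤ M ^ 2 * 1 := by gcongr; rw [div_le_one (by linarith)]; exact hq1
        _ = M ^ 2 := mul_one _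
    · rw [mul_zero]; positivity
  -- Only partial sums that reach `K` see the signal, with size at most `m t M² D K^(-2β) = q M² D
  -- K`. Since `∑_{k ≥ K} k^(-2) ≤ 4/K`, the factor `K` cancels and `q = √m` is left.
  set B : ℕ → ℝ := fun i => q * (M ^ 2 * D * K * (if K ≤ freq i then 1 else 0)) +
    q * √(chiConst + 8 * M ^ 2) * freq i ^ (1 / 2 : ℝ) with hBdef
  have hB : ∀ i : ℕ, m * (t * ∑ l ∈ Finset.range (i + 1), coords θ₀ l ^ 2) +
      √(m * (freq i * chiConst + 8 * (t * ∑ l ∈ Finset.range (i + 1), coords θ₀ l ^ 2))) ≤ B i := by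
    intro i
    have hf := freq_pos i
    refine add_le_add ?_ ?_
    · split_ifs with h
      · have h1 := sum_sq_le_of_isDifficult hβ hθ hK0 (i + 1)
        rw [← hD, ← hKdef] at h1
        calc (m : ℝ) * (t * ∑ l ∈ Finset.range (i + 1), coords θ₀ l ^ 2)
            ≤ m * (t * (M ^ 2 * D * K ^ (-(2 * β)))) := by gcongr
          _ = m * (M ^ 2 * D * (t * K ^ (-(2 * β)))) := by ring
          _ = _ := by rw [hKn, ← hqq]; field_simp
      · have h1 : ∑ l ∈ Finset.range (i + 1), coords θ₀ l ^ 2 = 0 := by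
          refine Finset.sum_eq_zero fun l hl => ?_
          rw [hθ l, if_neg]
          intro hle
          refine h (hle.trans ?_)
          have : (l : ℝ) ≤ i := by exact_mod_cast Nat.lt_succ_iff.1 (Finset.mem_range.1 hl)
          simpa [freq] using this
        rw [h1]; simp
    · have h1 : t * ∑ l ∈ Finset.range (i + 1), coords θ₀ l ^ 2 ≤ freq i * M ^ 2 := by
        rw [Finset.mul_sum]
        refine (Finset.sum_le_sum fun l _ => hθi l).trans_eq ?_
        simp [freq]
      calc √(m * (freq i * chiConst + 8 * (t * ∑ l ∈ Finset.range (i + 1), coords θ₀ l ^ 2)))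
          ≤ √(m * (chiConst + 8 * M ^ 2) * freq i) := by
            refine Real.sqrt_le_sqrt ?_
            rw [mul_assoc]
            refine mul_le_mul_of_nonneg_left ?_ hm0.le
            linarith
        _ = _ := by
            rw [Real.sqrt_mul (by positivity), Real.sqrt_mul hm0.le, Real.sqrt_eq_rpow (freq i)]
  set g : ℕ → ℝ := fun i => if K ≤ freq i then freq i ^ (-1 - 1 : ℝ) else 0 with hg
  have hg0 : ∀ i, 0 ≤ g i := fun i => by
    simp only [hg]; split_ifs; exacts [(Real.rpow_pos_of_pos (freq_pos i) _).le, le_rfl]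
  have hgN : ∀ N, ∑ i ∈ Finset.range N, g i ≤ 4 / K := by
    intro N
    refine (sum_tail_le zero_lt_one hK0 N).trans_eq ?_
    rw [Real.rpow_neg_one]; norm_num; ring
  have hgs : Summable g := summable_of_sum_range_le hg0 hgN
  have hgt : ∑' i, g i ≤ 4 / K := Real.tsum_le_of_sum_range_le hg0 hgN
  have hs3 := summable_freq_rpow (s := -(3 / 2)) (by norm_num)
  have hBf : ∀ i, B i / freq i ^ 2 = q * (M ^ 2 * D * K) * g i +
      q * √(chiConst + 8 * M ^ 2) * freq i ^ (-(3 / 2) : ℝ) := by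
    intro i
    have hf := freq_pos i
    have e1 : freq i ^ (-1 - 1 : ℝ) = 1 / freq i ^ 2 := by
      rw [show (-1 - 1 : ℝ) = -((2 : ℕ) : ℝ) by norm_num, Real.rpow_neg hf.le, Real.rpow_natCast]
      simp
    have e2 : freq i ^ (-(3 / 2) : ℝ) = freq i ^ (1 / 2 : ℝ) / freq i ^ 2 := by
      rw [← Real.rpow_natCast (freq i) 2, ← Real.rpow_sub hf]; norm_num
    simp only [hBdef, hg]
    rw [e2]
    split_ifs
    · rw [e1]; ring
    · ring
  have hs : Summable fun i => B i / freq i ^ 2 := by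
    simp_rw [hBf]
    exact (hgs.mul_left _).add (hs3.mul_left _)
  refine (lintegral_totalSize_le ht0 m hB hs).trans (ENNReal.ofReal_le_ofReal ?_)
  simp_rw [hBf]
  rw [(hgs.mul_left _).tsum_add (hs3.mul_left _), tsum_mul_left, tsum_mul_left, ← hS]
  calc q * (M ^ 2 * D * K) * ∑' i, g i + q * √(chiConst + 8 * M ^ 2) * S
      ≤ q * (M ^ 2 * D * K) * (4 / K) + q * √(chiConst + 8 * M ^ 2) * S := by gcongr
    _ = _ := by field_simp

/-! ### Bias and spread of the global posterior -/

lemma priorVar_eq_inv (α : ℝ) (i : ℕ) : priorVar α i = (freq i ^ (1 + 2 * α))⁻¹ := by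
  rw [priorVar, ← Real.rpow_neg (freq_pos i).le]; ring_nf

lemma postVar_eq (a α : ℝ) (i : ℕ) :
    postVar a (priorVar α) i = 1 / (freq i ^ (1 + 2 * α) + a) := by
  have := Real.rpow_pos_of_pos (freq_pos i) (1 + 2 * α)
  rw [postVar, priorVar_eq_inv]
  field_simp

/-- The block of coordinates on which the bias dominates. -/
noncomputable def block (K : ℝ) : Finset ℕ := Finset.Ico ⌈K⌉₊ (2 * ⌈K⌉₊)

lemma card_block (K : ℝ) : (block K).card = ⌈K⌉₊ := by
  rw [block, Nat.card_Ico]; omega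

lemma card_block_le {K : ℝ} (hK : 1 ≤ K) : ((block K).card : ℝ) ≤ 2 * K := by
  rw [card_block]
  have := Nat.ceil_lt_add_one (show 0 ≤ K by linarith)
  linarith

/-- Index `i` has frequency `i + 1`, so the last frequency of the block is `2⌈K⌉ ≤ 2K + 2 ≤ 4K`. -/
lemma freq_mem_block {K : ℝ} (hK : 1 ≤ K) {i : ℕ} (hi : i ∈ block K) :
    K ≤ freq i ∧ freq i ≤ 4 * K := by
  rw [block, Finset.mem_Ico] at hi
  have h1 := Nat.le_ceil K
  have h2 := Nat.ceil_lt_add_one (show 0 ≤ K by linarith)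
  have h3 : ((⌈K⌉₊ : ℕ) : ℝ) ≤ i := by exact_mod_cast hi.1
  have h4 : ((i + 1 : ℕ) : ℝ) ≤ ((2 * ⌈K⌉₊ : ℕ) : ℝ) := by exact_mod_cast hi.2
  push_cast at h4
  constructor
  · simp only [freq]; linarith
  · simp only [freq]; linarith

/-- By `haK` the shrinkage factor `s` is at most 1/2 above `K`, so at least half of each `θ i` is
lost. The identity `s y - θ = s (y - θ) - (1 - s) θ` separates this loss from the noise. -/
lemma block_bias {β M K a α : ℝ} (hβ : 0 < β) (hK : 1 ≤ K) (ha : 0 < a) (hα : 0 ≤ α)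
    (haK : a ≤ K ^ (1 + 2 * α)) {θ y : ℕ → ℝ}
    (hθ : ∀ i, θ i ^ 2 = if K ≤ freq i then M ^ 2 * freq i ^ (-1 - 2 * β) else 0) :
    M ^ 2 * 4 ^ (-2 - 2 * β) * K ^ (-(2 * β)) / 2 - ∑ i ∈ block K, (y i - θ i) ^ 2 ≤
      ∑ i ∈ block K, (a * postVar a (priorVar α) i * y i - θ i) ^ 2 := by
  have hK0 : 0 < K := by linarith
  have h1 : ∀ i ∈ block K, M ^ 2 * (4 * K) ^ (-1 - 2 * β) / 8 - (y i - θ i) ^ 2 ≤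
      (a * postVar a (priorVar α) i * y i - θ i) ^ 2 := by
    intro i hi
    obtain ⟨hi1, hi2⟩ := freq_mem_block hK hi
    have hf := freq_pos i
    set s := a * postVar a (priorVar α) i with hs
    have hs0 : 0 ≤ s := mul_nonneg ha.le (postVar_pos ha.le α i).le
    have hs1 : s ≤ 1 / 2 := by
      have h2 : a ≤ freq i ^ (1 + 2 * α) :=
        haK.trans (Real.rpow_le_rpow hK0.le hi1 (by positivity))
      rw [hs, postVar_eq, mul_one_div, div_le_div_iff₀ (by linarith) two_pos]
      linarith
    have h3 : M ^ 2 * (4 * K) ^ (-1 - 2 * β) ≤ θ i ^ 2 := by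
      rw [hθ i, if_pos hi1]
      exact mul_le_mul_of_nonneg_left
        (Real.rpow_le_rpow_of_nonpos hf hi2 (by linarith)) (sq_nonneg _)
    have h4 : ((1 - s) * θ i) ^ 2 ≤ 2 * (s * y i - θ i) ^ 2 + 2 * (s * (y i - θ i)) ^ 2 := by
      nlinarith [sq_nonneg ((s * y i - θ i) + s * (y i - θ i))]
    have h5 : (1 / 4) * θ i ^ 2 ≤ ((1 - s) * θ i) ^ 2 := by
      rw [mul_pow]
      refine mul_le_mul_of_nonneg_right ?_ (sq_nonneg _)
      nlinarith
    have h6 : (s * (y i - θ i)) ^ 2 ≤ (y i - θ i) ^ 2 := by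
      rw [mul_pow]
      exact mul_le_of_le_one_left (sq_nonneg _) (by nlinarith)
    linarith
  refine le_trans ?_ (Finset.sum_le_sum h1)
  rw [Finset.sum_sub_distrib, Finset.sum_const, card_block, nsmul_eq_mul]
  refine sub_le_sub_right ?_ _
  have h7 : M ^ 2 * 4 ^ (-2 - 2 * β) * K ^ (-(2 * β)) / 2 =
      K * (M ^ 2 * (4 * K) ^ (-1 - 2 * β) / 8) := by
    rw [Real.mul_rpow (by norm_num) hK0.le, show (-2 - 2 * β : ℝ) = (-1 - 2 * β) - 1 by ring,
      Real.rpow_sub (by norm_num : (0 : ℝ) < 4), Real.rpow_one,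
      show -(2 * β) = 1 + (-1 - 2 * β) by ring, Real.rpow_add hK0, Real.rpow_one]
    ring
  rw [h7]
  refine mul_le_mul_of_nonneg_right (Nat.le_ceil K) ?_
  positivity

/-- Below `K` each variance is at most `1/a`. Above it, `haK` gives `freq^(1+2α) ≥ a
(freq/K)^(1+2β)`; `β ≤ α` makes the constant independent of `α`. -/
lemma tsum_postVar_le {β K a α : ℝ} (hβ : 0 < β) (hK : 1 ≤ K) (ha : 0 < a) (hα : β ≤ α)
    (haK : a ≤ K ^ (1 + 2 * α)) :
    ∑' i, postVar a (priorVar α) i ≤ (1 + 2 ^ (1 + 2 * β) / (2 * β)) * (K / a) := by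
  have hK0 : 0 < K := by linarith
  refine Real.tsum_le_of_sum_range_le (fun i => (postVar_pos ha.le α i).le) fun N => ?_
  have h1 : ∀ i, postVar a (priorVar α) i ≤ (1 / a) * (if i < ⌊K⌋₊ then 1 else 0) +
      (K ^ (1 + 2 * β) / a) * (if K ≤ freq i then freq i ^ (-1 - 2 * β) else 0) := by
    intro i
    have hf := freq_pos i
    have hfp := Real.rpow_pos_of_pos hf (1 + 2 * α)
    rw [postVar_eq]
    split_ifs with h2 h3 h3
    · have h4 : 0 ≤ K ^ (1 + 2 * β) / a * freq i ^ (-1 - 2 * β) := by positivity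
      have h5 : 1 / (freq i ^ (1 + 2 * α) + a) ≤ 1 / a := by gcongr; linarith
      linarith
    · have h5 : 1 / (freq i ^ (1 + 2 * α) + a) ≤ 1 / a := by gcongr; linarith
      linarith
    · have h6 : a * (freq i / K) ^ (1 + 2 * β) ≤ freq i ^ (1 + 2 * α) := by
        calc a * (freq i / K) ^ (1 + 2 * β) ≤ K ^ (1 + 2 * α) * (freq i / K) ^ (1 + 2 * α) := by
              gcongr
              exact (one_le_div hK0).2 h3
          _ = freq i ^ (1 + 2 * α) := by
              rw [← Real.mul_rpow hK0.le (by positivity)]; congr 1; field_simp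
      have h7 : 1 / (freq i ^ (1 + 2 * α) + a) ≤ 1 / (a * (freq i / K) ^ (1 + 2 * β)) := by
        gcongr; linarith
      refine h7.trans (le_of_eq ?_)
      rw [Real.div_rpow hf.le hK0.le, show -1 - 2 * β = -(1 + 2 * β) by ring,
        Real.rpow_neg hf.le]
      have := Real.rpow_pos_of_pos hf (1 + 2 * β)
      have := Real.rpow_pos_of_pos hK0 (1 + 2 * β)
      field_simp
      ring
    · exfalso
      rw [not_lt] at h2
      rw [not_le] at h3
      have h8 : i + 1 ≤ ⌊K⌋₊ := Nat.le_floor (by push_cast; exact h3.le)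
      omega
  refine (Finset.sum_le_sum fun i _ => h1 i).trans ?_
  rw [Finset.sum_add_distrib, ← Finset.mul_sum, ← Finset.mul_sum]
  have h9 : ∑ i ∈ Finset.range N, (if i < ⌊K⌋₊ then (1 : ℝ) else 0) ≤ K := by
    rw [Finset.sum_boole]
    have : (Finset.filter (fun i => i < ⌊K⌋₊) (Finset.range N)).card ≤ ⌊K⌋₊ := by
      calc _ ≤ (Finset.range ⌊K⌋₊).card := Finset.card_le_card fun i hi =>
            Finset.mem_range.2 (Finset.mem_filter.1 hi).2
        _ = _ := Finset.card_range _
    exact (Nat.cast_le.2 this).trans (Nat.floor_le hK0.le)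
  have h10 := sum_tail_le (s := 2 * β) (by positivity) hK0 N
  have h11 : K ^ (1 + 2 * β) * K ^ (-(2 * β)) = K := by
    rw [← Real.rpow_add hK0]; ring_nf; exact Real.rpow_one K
  calc (1 / a) * ∑ i ∈ Finset.range N, (if i < ⌊K⌋₊ then (1 : ℝ) else 0) +
        (K ^ (1 + 2 * β) / a) *
          ∑ i ∈ Finset.range N, (if K ≤ freq i then freq i ^ (-1 - 2 * β) else 0)
      ≤ (1 / a) * K + (K ^ (1 + 2 * β) / a) *
          (2 ^ (1 + 2 * β) / (2 * β) * K ^ (-(2 * β))) := by gcongr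
    _ = (1 / a) * K + 2 ^ (1 + 2 * β) / (2 * β) * (K ^ (1 + 2 * β) * K ^ (-(2 * β))) / a := by
        ring
    _ = _ := by rw [h11]; ring

lemma measure_le_of_lintegral_le {Ω : Type*} {mΩ : MeasurableSpace Ω} {μ : Measure Ω}
    {f : Ω → ℝ≥0∞} (hf : Measurable f) {x y : ℝ} (hy : 0 < y) (h : ∫⁻ ω, f ω ∂μ ≤ ENNReal.ofReal x) :
    μ {ω | ENNReal.ofReal y ≤ f ω} ≤ ENNReal.ofReal (x / y) := by
  refine (meas_ge_le_lintegral_div hf.aemeasurable (by simpa using hy)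
    ENNReal.ofReal_ne_top).trans ?_
  rw [ENNReal.ofReal_div_of_pos hy]
  gcongr

lemma measurable_coord (i : ℕ) : Measurable fun θ : Ell2 => coords θ i :=
  (measurable_pi_apply i).comp continuous_coords.measurable

/-- The squared norm of the bias, up to the rate. -/
noncomputable def biasConst (β M : ℝ) : ℝ := M ^ 2 * 4 ^ (-2 - 2 * β)

lemma biasConst_pos {β M : ℝ} (hM : 0 < M) : 0 < biasConst β M := by
  unfold biasConst; positivity

lemma lintegral_sum_block_le {Ω : Type*} {mΩ : MeasurableSpace Ω} {μ : Measure Ω}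
    {K a : ℝ} (hK : 1 ≤ K) (ha : 0 < a) {f : ℕ → Ω → ℝ} (hf : ∀ i, Measurable (f i))
    (h : ∀ i, ∫⁻ ω, ENNReal.ofReal (f i ω ^ 2) ∂μ ≤ ENNReal.ofReal (1 / a)) :
    ∫⁻ ω, ENNReal.ofReal (∑ i ∈ block K, f i ω ^ 2) ∂μ ≤ ENNReal.ofReal (2 * (K / a)) := by
  simp_rw [ENNReal.ofReal_sum_of_nonneg fun _ _ => sq_nonneg _]
  rw [lintegral_finsetSum _ fun i _ => ((hf i).pow_const 2).ennreal_ofReal]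
  refine (Finset.sum_le_sum fun i _ => h i).trans ?_
  rw [Finset.sum_const, nsmul_eq_mul, ← ENNReal.ofReal_natCast,
    ← ENNReal.ofReal_mul (by positivity)]
  refine ENNReal.ofReal_le_ofReal ?_
  calc ((block K).card : ℝ) * (1 / a) ≤ 2 * K * (1 / a) := by gcongr; exact card_block_le hK
    _ = _ := by ring

lemma postVar_le_inv {a α : ℝ} (ha : 0 < a) (i : ℕ) : postVar a (priorVar α) i ≤ 1 / a := by
  rw [le_div_iff₀ ha, mul_comm]
  exact mul_postVar_le_one ha.le α i

/-- Outside of an event of small probability, the global posterior has a spread that is much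
smaller than its bias. -/
lemma sub_sq_le_two_mul (x y z : ℝ) : (x - z) ^ 2 ≤ 2 * (y - z) ^ 2 + 2 * (y - x) ^ 2 := by
  nlinarith [sq_nonneg ((y - z) + (y - x))]

set_option maxHeartbeats 1000000 in
lemma exists_atypical_event {β M : ℝ} (hβ : 0 < β) (hM : 0 < M) : ∃ C t₀ : ℝ, 0 ≤ C ∧ 1 < t₀ ∧
    ∀ {σ n t : ℝ} {m : ℕ} {θ₀ : Ell2} {αhat : Data m → ℝ} {post : Kernel (Data m) Ell2},
      0 < m → t = n / (σ ^ 2 * m) → t₀ ≤ t → (8 * (1 + 2 * β) - 1) / 2 ≤ Real.log n →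
      IsDifficult β M σ n m θ₀ → IsDistMMLE σ n m θ₀ αhat → IsGlobalPosterior σ n m θ₀ αhat post →
      ∃ E : Set (Data m), MeasurableSet E ∧
        dataLaw σ n m θ₀ E ≤ ENNReal.ofReal (C / √(m : ℝ)) ∧
        ∀ᵐ Y ∂(dataLaw σ n m θ₀), Y ∉ E → 0 < αhat Y ∧
          biasConst β M / 4 * cutoff β σ n m ^ (-(2 * β)) ≤ ‖θ₀ - postMean (post Y)‖ ^ 2 ∧
          post Y {θ | ‖θ - θ₀‖ ^ 2 ≤ biasConst β M / 16 * cutoff β σ n m ^ (-(2 * β))} ≤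
            ENNReal.ofReal (C / √(m : ℝ)) ∧
          ∫⁻ θ, ‖θ - postMean (post Y)‖ₑ ^ 2 ∂(post Y) ≤
            ENNReal.ofReal (C * cutoff β σ n m ^ (-(2 * β)) / √(m : ℝ)) := by
  -- Twice `1 + 2β`, because then `K^P = (t√m)² ≥ m t = a` for `t ≥ 1`: failure of oversmoothing
  -- forces `1 + 2α < P`.
  set P : ℝ := 2 * (1 + 2 * β) with hP
  have hP1 : 1 ≤ P := by rw [hP]; linarith
  obtain ⟨t₁, ht₁, hdet⟩ := le_sumSize_of_le_distLogMarginal hP1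
  obtain ⟨C₀, hC₀, htot⟩ := exists_lintegral_totalSize_le hβ M
  set c₁ : ℝ := 1 / (64 * 2 ^ (4 * P)) with hc₁
  have hc₁0 : 0 < c₁ := by positivity
  set b := biasConst β M with hb
  have hb0 : 0 < b := biasConst_pos hM
  set D : ℝ := 2 ^ (1 + 2 * β) / (2 * β) with hD
  have hD0 : 0 ≤ D := by positivity
  -- `C₀/c₁` and `8/b` bound the two bad events, `32/b` the posterior mass near `θ₀`, and `1 + D`
  -- the total posterior variance.
  refine ⟨C₀ / c₁ + 40 / b + (1 + D), t₁ + 1, by positivity, by linarith, ?_⟩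
  set C := C₀ / c₁ + 40 / b + (1 + D) with hC
  intro σ n t m θ₀ αhat post hm ht htt hlog hθ hα hpost
  have ht1 : 1 < t := by linarith
  have ht0 : 0 < t := by linarith
  have hm1 : (1 : ℝ) ≤ m := by exact_mod_cast hm
  have hm0 : (0 : ℝ) < m := by linarith
  set K := cutoff β σ n m with hK
  have hK1 : 1 < K := one_lt_cutoff hβ hm ht ht1
  have hK0 : 0 < K := by linarith
  set q := √(m : ℝ) with hq
  have hq1 : 1 ≤ q := Real.one_le_sqrt.2 hm1
  have hqq : q * q = m := Real.mul_self_sqrt hm0.le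
  have hq0 : 0 < q := by linarith
  have hKp : K ^ (1 + 2 * β) = t * q := cutoff_rpow hβ hm ht ht0
  have hKn : t * K ^ (-(2 * β)) = K / q := cutoff_rpow_neg hβ hm ht ht0 hK0
  set κ := K ^ (-(2 * β)) with hκ
  have hκ0 : 0 < κ := Real.rpow_pos_of_pos hK0 _
  set a : ℝ := m * t with ha
  have ha0 : 0 < a := by positivity
  have hKa : K / a = κ / q := by
    rw [ha, div_eq_div_iff (by positivity) hq0.ne', ← hqq]
    have h1 : K = t * κ * q := by rw [hKn]; field_simp
    rw [h1]; ring
  have hlaw : dataLaw σ n m θ₀ = Measure.pi fun _ : Fin m => seqLaw t (coords θ₀) := by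
    rw [dataLaw_eq, ht]
  have hsq := summable_coords_sq θ₀
  set Q : Data m → ℝ := fun Y =>
    ∑ i ∈ block K, ((m : ℝ)⁻¹ * ∑ j, Y j i - coords θ₀ i) ^ 2 with hQ
  have hQi : ∀ i, Measurable fun Y : Data m => (m : ℝ)⁻¹ * ∑ j, Y j i - coords θ₀ i :=
    fun i => by fun_prop
  have hQm : Measurable Q := Finset.measurable_fun_sum _ fun i _ => (hQi i).pow_const 2
  set E₁ : Set (Data m) := {Y | ENNReal.ofReal (c₁ * m) ≤ totalSize t Y} with hE₁
  -- The averaged noise on the block exceeds half of the guaranteed bias `b/2 · κ`.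
  set E₂ : Set (Data m) := {Y | ENNReal.ofReal (b / 4 * κ) ≤ ENNReal.ofReal (Q Y)} with hE₂
  have hE₁P : dataLaw σ n m θ₀ E₁ ≤ ENNReal.ofReal (C₀ / c₁ / q) := by
    rw [hlaw]
    refine (measure_le_of_lintegral_le (measurable_totalSize t m) (by positivity)
      (htot hm ht ht1 hθ)).trans_eq ?_
    congr 1
    rw [← hq, ← hqq]; field_simp
  have hE₂P : dataLaw σ n m θ₀ E₂ ≤ ENNReal.ofReal (8 / b / q) := by
    rw [hlaw]
    have h1 := lintegral_sum_block_le (μ := Measure.pi fun _ : Fin m => seqLaw t (coords θ₀))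
      hK1.le ha0 hQi fun i => (lintegral_average_sub_sq (θ := coords θ₀) hm ht0 i).le
    refine (measure_le_of_lintegral_le hQm.ennreal_ofReal (by positivity) h1).trans_eq ?_
    congr 1
    rw [hKa]; field_simp; norm_num
  refine ⟨E₁ ∪ E₂, (measurableSet_le measurable_const (measurable_totalSize t m)).union
    (measurableSet_le measurable_const hQm.ennreal_ofReal), ?_, ?_⟩
  · refine (measure_union_le _ _).trans ((add_le_add hE₁P hE₂P).trans ?_)
    rw [← ENNReal.ofReal_add (by positivity) (by positivity), ← add_div]
    refine ENNReal.ofReal_le_ofReal ?_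
    gcongr
    have : 8 / b ≤ 40 / b := by gcongr; norm_num
    linarith
  have hslow : ∀ᵐ Y ∂(dataLaw σ n m θ₀), ∀ j, SlowSums fun i => t * Y j i ^ 2 - 1 := by
    rw [hlaw]; exact ae_pi_of_ae (ae_slowSums ht0 hsq)
  have hsumm : ∀ᵐ Y ∂(dataLaw σ n m θ₀), ∀ j, ∀ α : ℝ, 0 < α →
      Summable fun i => Y j i ^ 2 * priorVar α i := by
    rw [hlaw]; exact ae_pi_of_ae (ae_summable_priorVar ht0 hsq)
  have hprob : IsMarkovKernel post := hpost.1
  filter_upwards [hslow, hsumm, hα.2, hpost.2] with Y hY1 hY2 hY3 hY4 hYE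
  rw [Set.mem_union, not_or] at hYE
  set α := αhat Y with hαdef
  have hα0 : 0 ≤ α := hY3.1.1
  -- Otherwise `α` is bounded although it beats the comparison point `(4P - 1)/2`, which the
  -- assumption on `log n` places in the search interval; the data would then lie in `E₁`.
  have haK : a ≤ K ^ (1 + 2 * α) := by
    by_contra hlt
    rw [not_le] at hlt
    have h1 : a ≤ K ^ P := by
      have h2 : K ^ P = (t * q) ^ 2 := by
        rw [← hKp, ← Real.rpow_natCast, ← Real.rpow_mul hK0.le, hP]; congr 1; push_cast; ring
      rw [h2, ha, ← hqq]
      nlinarith [mul_pos ht0 (mul_pos hq0 hq0)]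
    have h3 : 1 + 2 * α < P := (Real.rpow_lt_rpow_left_iff hK1).1 (hlt.trans_le h1)
    have h4 : (4 * P - 1) / 2 ∈ Set.Icc 0 (Real.log n) :=
      ⟨by linarith, by rw [hP]; linarith⟩
    have h5 := hdet ht (by linarith) hY1 hα0 h3.le (hY3.2 h4)
    refine hYE.1 ((ENNReal.ofReal_le_ofReal ?_).trans (ofReal_sumSize_le t Y))
    rw [hc₁, one_div_mul_eq_div]
    exact h5
  have hβα : β ≤ α := by
    have h1 : K ^ (1 + 2 * β) ≤ K ^ (1 + 2 * α) := by
      refine le_trans ?_ haK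
      rw [hKp, ha, ← hqq]
      nlinarith [mul_pos ht0 hq0]
    have := (Real.rpow_le_rpow_left_iff hK1).1 h1
    linarith
  have hαpos : 0 < α := by linarith
  obtain ⟨hmean, hspread, htrace⟩ := barycenter_genPosterior hm ha0.le hαpos
    (by rw [ha, ht]) (fun j => hY2 j α hαpos) (hY4 hαpos)
  set μ := post Y with hμ
  have hQY : Q Y < b / 4 * κ := by
    exact lt_of_not_ge fun h => hYE.2 (ENNReal.ofReal_le_ofReal h)
  have hbias : b / 4 * κ ≤ ∑ i ∈ block K, (coords (postMean μ) i - coords θ₀ i) ^ 2 := by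
    have h1 := block_bias (M := M) (y := fun i => (m : ℝ)⁻¹ * ∑ j, Y j i) hβ hK1.le ha0 hα0 haK
      (θ := coords θ₀) hθ
    simp_rw [hmean]
    have h2 : M ^ 2 * 4 ^ (-2 - 2 * β) * K ^ (-(2 * β)) / 2 = b / 2 * κ := by
      rw [hb, biasConst, hκ]; ring
    rw [h2] at h1
    have h3 : b / 2 * κ - Q Y ≤ _ := h1
    linarith
  refine ⟨hαpos, ?_, ?_, ?_⟩
  · refine hbias.trans ((sum_sq_le_norm_sq (postMean μ - θ₀) _).trans_eq ?_)
    rw [norm_sub_rev]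
  · have hXm : ∀ i, Measurable fun θ : Ell2 => coords θ i - coords (postMean μ) i :=
      fun i => (measurable_coord i).sub_const _
    have h1 := lintegral_sum_block_le (μ := μ) hK1.le ha0 hXm fun i =>
      (hspread i).trans (ENNReal.ofReal_le_ofReal (postVar_le_inv ha0 i))
    have hSm : Measurable fun θ : Ell2 =>
        ENNReal.ofReal (∑ i ∈ block K, (coords θ i - coords (postMean μ) i) ^ 2) :=
      (Finset.measurable_fun_sum _ fun i _ => (hXm i).pow_const 2).ennreal_ofReal
    have h2 := measure_le_of_lintegral_le hSm (show 0 < b / 16 * κ by positivity) h1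
    refine (measure_mono fun θ hθs => ?_).trans (h2.trans (ENNReal.ofReal_le_ofReal ?_))
    · have hθs' : ‖θ - θ₀‖ ^ 2 ≤ b / 16 * κ := hθs
      refine ENNReal.ofReal_le_ofReal ?_
      have h3 := (sum_sq_le_norm_sq (θ - θ₀) (block K)).trans hθs'
      have h4 : ∑ i ∈ block K, (coords (postMean μ) i - coords θ₀ i) ^ 2 ≤
          2 * ∑ i ∈ block K, coords (θ - θ₀) i ^ 2 +
            2 * ∑ i ∈ block K, (coords θ i - coords (postMean μ) i) ^ 2 := by
        rw [Finset.mul_sum, Finset.mul_sum, ← Finset.sum_add_distrib]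
        refine Finset.sum_le_sum fun i _ => ?_
        rw [coords_sub, Pi.sub_apply]
        exact sub_sq_le_two_mul _ _ _
      linarith
    · rw [hKa]
      have h5 : 2 * (κ / q) / (b / 16 * κ) = 32 / b / q := by field_simp; norm_num
      rw [h5]
      gcongr
      have : 32 / b ≤ 40 / b := by gcongr; norm_num
      have : 0 ≤ C₀ / c₁ := by positivity
      linarith
  · refine htrace.trans (ENNReal.ofReal_le_ofReal ?_)
    refine (tsum_postVar_le hβ hK1.le ha0 hβα haK).trans ?_
    rw [hKa, ← hD, mul_div_assoc]
    gcongr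
    have h6 : 0 ≤ C₀ / c₁ := by positivity
    have h7 : 0 ≤ 40 / b := by positivity
    linarith

/-! ### From the atypical event to the two limits. -/

lemma rate_eq {β M σ n : ℝ} {m : ℕ} (hβ : 0 < β) (hσ : 0 < σ) (hm : 0 < m) (hn : 0 < n) :
    (√(biasConst β M) / 4 * (σ ^ 2) ^ (β / (1 + 2 * β)) *
      (n / √(m : ℝ)) ^ (-(β / (1 + 2 * β)))) ^ 2 =
      biasConst β M / 16 * cutoff β σ n m ^ (-(2 * β)) := by
  have hm0 : (0 : ℝ) < m := by exact_mod_cast hm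
  have hs : 0 < √(m : ℝ) := Real.sqrt_pos.2 hm0
  set x := n / (σ ^ 2 * √(m : ℝ)) with hx
  have hx0 : 0 < x := by positivity
  have h1 : n / √(m : ℝ) = σ ^ 2 * x := by rw [hx]; field_simp
  have h2 : (σ ^ 2) ^ (β / (1 + 2 * β)) * (n / √(m : ℝ)) ^ (-(β / (1 + 2 * β))) =
      x ^ (-(β / (1 + 2 * β))) := by
    rw [h1, Real.mul_rpow (by positivity) hx0.le, ← mul_assoc, ← Real.rpow_add (by positivity)]
    simp
  have h3 : cutoff β σ n m ^ (-(2 * β)) = (x ^ (-(β / (1 + 2 * β)))) ^ 2 := by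
    rw [cutoff, ← hx, ← Real.rpow_mul hx0.le, ← Real.rpow_natCast, ← Real.rpow_mul hx0.le]
    congr 1; push_cast; field_simp
  have hb : 0 ≤ biasConst β M := by unfold biasConst; positivity
  rw [mul_assoc, h2, h3, mul_pow, div_pow, Real.sq_sqrt hb]
  norm_num

lemma div_sqrt_le_of_le {C ε x : ℝ} (hε : 0 < ε) (hx : 0 < x)
    (h : (C / ε) ^ 2 ≤ x) : C / √x ≤ ε := by
  have h1 : C / ε ≤ √x := Real.le_sqrt_of_sq_le h
  rw [div_le_iff₀ hε] at h1
  rw [div_le_iff₀ (Real.sqrt_pos.2 hx)]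
  linarith

end DistributedWN

open DistributedWN
theorem mainTheorem3 (β M σ : ℝ) (hβ : 0 < β) (hM : 0 < M) (hσ : 0 < σ) :
    (∃ c : ℝ, 0 < c ∧ ∀ ε : ℝ, 0 < ε → ∃ T : ℝ, ∀ (m : ℕ) (n : ℝ),
      T ≤ (m : ℝ) → T ≤ n / m →
      ∀ (θ₀ : Ell2) (αhat : Data m → ℝ) (post : Kernel (Data m) Ell2),
        IsDifficult β M σ n m θ₀ →
        IsDistMMLE σ n m θ₀ αhat →
        IsGlobalPosterior σ n m θ₀ αhat post →
        ∫⁻ Y, post Y {θ | ‖θ - θ₀‖ ≤ c * (n / √(m : ℝ)) ^ (-(β / (1 + 2 * β)))}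
          ∂(dataLaw σ n m θ₀) ≤ ENNReal.ofReal ε) ∧
    (∀ γ : ℝ, 0 < γ → γ < 1 → ∀ L : ℝ, 0 < L →
      ∀ ε : ℝ, 0 < ε → ∃ T : ℝ, ∀ (m : ℕ) (n : ℝ),
      T ≤ (m : ℝ) → T ≤ n / m →
      ∀ (θ₀ : Ell2) (αhat : Data m → ℝ) (post : Kernel (Data m) Ell2) (r : Data m → ℝ),
        IsDifficult β M σ n m θ₀ →
        IsDistMMLE σ n m θ₀ αhat →
        IsGlobalPosterior σ n m θ₀ αhat post →
        (∀ᵐ Y ∂(dataLaw σ n m θ₀), 0 < αhat Y → IsCredibleRadius (post Y) γ (r Y)) →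
        dataLaw σ n m θ₀ {Y | θ₀ ∈ credibleBall (post Y) L (r Y)} ≤ ENNReal.ofReal ε) := by
  obtain ⟨C, t₀, hC, ht₀, hmain⟩ := exists_atypical_event hβ hM
  have hb0 : 0 < biasConst β M := biasConst_pos hM
  -- The middle term makes the local precision at least `t₀`, the exponential makes `log n` large
  -- enough for the comparison point, and the 1 ensures `m ≥ 1`, hence `n ≥ n/m`.
  set T₀ : ℝ := 1 + t₀ * σ ^ 2 + Real.exp ((8 * (1 + 2 * β) - 1) / 2) with hT₀
  have hT₀1 : 1 ≤ T₀ := by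
    have : 0 ≤ t₀ * σ ^ 2 := by positivity
    have := Real.exp_pos ((8 * (1 + 2 * β) - 1) / 2)
    linarith
  have hbasic : ∀ (m : ℕ) (n : ℝ), T₀ ≤ m → T₀ ≤ n / m → 0 < m ∧ 0 < n ∧
      t₀ ≤ n / (σ ^ 2 * m) ∧ (8 * (1 + 2 * β) - 1) / 2 ≤ Real.log n := by
    intro m n h1 h2
    have hm0 : (0 : ℝ) < m := by linarith
    have he := Real.exp_pos ((8 * (1 + 2 * β) - 1) / 2)
    have hn : T₀ ≤ n := by
      rw [le_div_iff₀ hm0] at h2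
      nlinarith
    refine ⟨by exact_mod_cast hm0, by linarith, ?_, ?_⟩
    · rw [mul_comm, ← div_div, le_div_iff₀ (by positivity)]
      linarith
    · rw [Real.le_log_iff_exp_le (by linarith)]
      have : 0 ≤ t₀ * σ ^ 2 := by positivity
      linarith
  constructor
  · refine ⟨√(biasConst β M) / 4 * (σ ^ 2) ^ (β / (1 + 2 * β)), by positivity, fun ε hε => ?_⟩
    refine ⟨T₀ + (2 * C / ε) ^ 2, ?_⟩
    intro m n hmT hnT θ₀ αhat post hθ hα hpost
    have hε2 : 0 ≤ (2 * C / ε) ^ 2 := sq_nonneg _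
    obtain ⟨hm, hn, ht, hlog⟩ := hbasic m n (by linarith) (by linarith)
    have hm0 : (0 : ℝ) < m := by exact_mod_cast hm
    obtain ⟨E, hEm, hEP, hE⟩ := hmain hm rfl ht hlog hθ hα hpost
    have hprob : IsMarkovKernel post := hpost.1
    have hlawp : IsProbabilityMeasure (dataLaw σ n m θ₀) := by
      rw [dataLaw_eq]; infer_instance
    calc ∫⁻ Y, post Y {θ | ‖θ - θ₀‖ ≤ √(biasConst β M) / 4 * (σ ^ 2) ^ (β / (1 + 2 * β)) *
            (n / √(m : ℝ)) ^ (-(β / (1 + 2 * β)))} ∂(dataLaw σ n m θ₀)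
        ≤ ∫⁻ Y, (E.indicator 1 Y + ENNReal.ofReal (C / √(m : ℝ))) ∂(dataLaw σ n m θ₀) := by
          refine lintegral_mono_ae ?_
          filter_upwards [hE] with Y hY
          by_cases hYE : Y ∈ E
          · rw [Set.indicator_of_mem hYE]
            exact prob_le_one.trans le_self_add
          · refine le_trans (measure_mono fun θ hθs => ?_) ((hY hYE).2.2.1.trans le_add_self)
            rw [Set.mem_ofPred_eq, ← rate_eq hβ hσ hm hn]
            exact pow_le_pow_left₀ (norm_nonneg _) hθs 2
      _ = dataLaw σ n m θ₀ E + ENNReal.ofReal (C / √(m : ℝ)) := by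
          rw [lintegral_add_right _ measurable_const, lintegral_indicator_one hEm]
          simp
      _ ≤ ENNReal.ofReal (C / √(m : ℝ)) + ENNReal.ofReal (C / √(m : ℝ)) := by gcongr
      _ = ENNReal.ofReal (2 * C / √(m : ℝ)) := by
          rw [← ENNReal.ofReal_add (by positivity) (by positivity)]
          congr 1; ring
      _ ≤ ENNReal.ofReal ε :=
          ENNReal.ofReal_le_ofReal (div_sqrt_le_of_le hε hm0 (by linarith))
  · intro γ hγ hγ1 L hL ε hε
    -- If the blown-up ball covers `θ₀`, then `L r` is at least the bias, so `r² ≥ biasConst ·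
    -- κ/(4L²)`; Markov's inequality then leaves mass at most `δ/√m` at distance at least `r`.
    set δ := 4 * L ^ 2 * C / biasConst β M with hδ
    refine ⟨T₀ + (C / ε) ^ 2 + (δ / (γ / 2)) ^ 2, ?_⟩
    intro m n hmT hnT θ₀ αhat post r hθ hα hpost hr
    have hε2 : 0 ≤ (C / ε) ^ 2 := sq_nonneg _
    have hδ2 : 0 ≤ (δ / (γ / 2)) ^ 2 := sq_nonneg _
    obtain ⟨hm, hn, ht, hlog⟩ := hbasic m n (by linarith) (by linarith)
    have hm0 : (0 : ℝ) < m := by exact_mod_cast hm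
    have hK0 : 0 < cutoff β σ n m :=
      zero_lt_one.trans (one_lt_cutoff hβ hm rfl (by linarith))
    set κ := cutoff β σ n m ^ (-(2 * β)) with hκ
    have hκ0 : 0 < κ := Real.rpow_pos_of_pos hK0 _
    obtain ⟨E, hEm, hEP, hE⟩ := hmain hm rfl ht hlog hθ hα hpost
    have hprob : IsMarkovKernel post := hpost.1
    refine le_trans (measure_mono_ae ?_) (hEP.trans (ENNReal.ofReal_le_ofReal
      (div_sqrt_le_of_le hε hm0 (by linarith))))
    filter_upwards [hE, hr] with Y hY hrY hball
    -- Outside `E` the estimator is positive, so the radius is calibrated: mass `γ` lies beyond `r`,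
    -- against the bound `γ/2`.
    by_contra hYE
    obtain ⟨hα0, hbias, -, htrace⟩ := hY hYE
    have hcred := hrY hα0
    have hball' : ‖θ₀ - postMean (post Y)‖ ≤ L * r Y := hball
    have hsq : biasConst β M / 4 * κ ≤ (L * r Y) ^ 2 :=
      hbias.trans (pow_le_pow_left₀ (norm_nonneg _) hball' 2)
    have hLr : 0 ≤ L * r Y := (norm_nonneg _).trans hball'
    have hr0 : 0 < r Y := by
      have h1 : 0 < biasConst β M / 4 * κ := by positivity
      rcases hLr.eq_or_lt with h2 | h2
      · rw [← h2] at hsq; norm_num at hsq; linarith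
      · exact pos_of_mul_pos_right h2 hL.le
    have hmeas : Measurable fun θ : Ell2 => ‖θ - postMean (post Y)‖ₑ ^ 2 :=
      ((measurable_id.sub_const _).enorm).pow_const 2
    have hmarkov := measure_le_of_lintegral_le hmeas (show 0 < r Y ^ 2 by positivity) htrace
    have hsmall : C * κ / √(m : ℝ) / r Y ^ 2 ≤ γ / 2 := by
      have h3 : δ / √(m : ℝ) ≤ γ / 2 :=
        div_sqrt_le_of_le (by positivity) hm0 (by linarith)
      refine le_trans ?_ h3
      have hs : 0 < √(m : ℝ) := Real.sqrt_pos.2 hm0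
      rw [hδ, div_div, div_div, div_le_div_iff₀ (by positivity) (by positivity)]
      have h4 : κ * biasConst β M ≤ 4 * L ^ 2 * r Y ^ 2 := by
        rw [mul_pow] at hsq; linarith
      calc C * κ * (biasConst β M * √(m : ℝ)) = C * √(m : ℝ) * (κ * biasConst β M) := by ring
        _ ≤ C * √(m : ℝ) * (4 * L ^ 2 * r Y ^ 2) := by gcongr
        _ = _ := by ring
    have hone : (1 : ℝ≥0∞) ≤ ENNReal.ofReal (1 - γ) + ENNReal.ofReal (γ / 2) := by
      calc (1 : ℝ≥0∞) = post Y Set.univ := measure_univ.symm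
        _ ≤ post Y ({θ | ‖θ - postMean (post Y)‖ ≤ r Y} ∪
              {θ | ENNReal.ofReal (r Y ^ 2) ≤ ‖θ - postMean (post Y)‖ₑ ^ 2}) := by
            refine measure_mono fun θ _ => ?_
            rcases le_total ‖θ - postMean (post Y)‖ (r Y) with h5 | h5
            · exact Or.inl h5
            · refine Or.inr ?_
              rw [Set.mem_ofPred_eq, ← ofReal_norm, ← ENNReal.ofReal_pow (norm_nonneg _)]
              exact ENNReal.ofReal_le_ofReal (pow_le_pow_left₀ hr0.le h5 2)
        _ ≤ _ := (measure_union_le _ _).trans (add_le_add hcred.le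
            (hmarkov.trans (ENNReal.ofReal_le_ofReal hsmall)))
    rw [← ENNReal.ofReal_add (by linarith) (by linarith), ENNReal.one_le_ofReal] at hone
    linarith
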